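/- For graphs $H$, $F$ and a positive integer $n$, let $\mathrm{ex}(n,H,\text{rainbow-}F)$ denote the maximal number of copies of $H$ (that is, of subgraphs isomorphic to $H$) that a properly edge-coloured simple graph on $n$ vertices can contain if it has no rainbow subgraph isomorphic to $F$. Here an edge-colouring is proper if any two distinct edges that share a vertex have different colours, any number of colours may be used, and a subgraph is rainbow if all of its edges have different colours. Let $C_m$ denote the cycle with $m$ vertices. Theorem 1.2. Let $s\ge 4$ and $t\ge 3$ be integers. Then, as $n\to\infty$ with $s$ and $t$ fixed (the implied constants may depend on $s$ and $t$), $$ \mathrm{ex}(n,C_s,\text{rainbow-}C_t)= \begin{cases} \Theta(n^{s/2}) & \text{if } t=4,\\ \Theta(n^{s/2}) & \text{if } s,t \text{ are even and } s\ne t,\\ \Theta(n^{s/2-1}) & \text{if } s=t\ge 6 \text{ and } t \text{ is even},\\ \Theta(n^{(s-1)/2}) & \text{if } t\ge 6 \text{ is even and } s \text{ is odd},\\ \Theta(n^{s-2}) & \text{if } s,t \text{ are odd and } s\le t,\\ \Theta(n^{s}) & \text{if } t \text{ is odd, and } s>t \text{ or } s \text{ is even}. \end{cases} $$ -/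

import Mathlib

open Filter Asymptotics

namespace RainbowTuran

/-- A proper edge-colouring of `G` with colours in `K`: distinct edges of `G` that share a vertex
receive distinct colours. (The vertices of the line graph are the edges of `G`, two of them being
adjacent when they are distinct and have a common endpoint.) -/
abbrev ProperEdgeColoring {V : Type*} (G : SimpleGraph V) (K : Type*) :=
  G.lineGraph.Coloring K

/-- The edge-coloured graph `(G, c)` has a rainbow subgraph isomorphic to `F`: there is a copy of
`F` in `G` whose edges all have different colours. -/
def HasRainbow {V W K : Type*} {G : SimpleGraph V} (c : ProperEdgeColoring G K)
    (F : SimpleGraph W) : Prop :=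
  ∃ φ : SimpleGraph.Copy F G, Function.Injective fun e : F.edgeSet => c (φ.mapEdgeSet e)

open scoped Classical in
/-- `ex(n, H, rainbow-F)`: the maximal number of copies of `H` (subgraphs isomorphic to `H`) in a
properly edge-coloured graph on `n` vertices with no rainbow subgraph isomorphic to `F`.
Finite graphs have finitely many edges, so natural numbers suffice as colours. -/
noncomputable def rainbowEx (n : ℕ) {W W' : Type*} (H : SimpleGraph W) (F : SimpleGraph W') : ℕ :=
  Finset.sup {G : SimpleGraph (Fin n) | ∃ c : ProperEdgeColoring G ℕ, ¬ HasRainbow c F}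
    fun G => G.copyCount H

/-- An arbitrary set of colours gives the same extremal number. -/
theorem copyCount_le_rainbowEx {n : ℕ} {W W' K : Type*} (H : SimpleGraph W) (F : SimpleGraph W')
    (G : SimpleGraph (Fin n)) (c : ProperEdgeColoring G K) (hc : ¬ HasRainbow c F) :
    G.copyCount H ≤ rainbowEx n H F := by
  classical
  obtain ⟨f, hf⟩ := Countable.exists_injective_nat (Set.range c)
  refine Finset.le_sup (f := fun G : SimpleGraph (Fin n) => G.copyCount H) ?_
  simp only [Finset.mem_filter, Finset.mem_univ, true_and]
  refine ⟨SimpleGraph.Coloring.mk (fun e => f ⟨c e, e, rfl⟩) ?_, ?_⟩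
  · intro e e' h h'
    exact c.valid h (congrArg Subtype.val (hf h'))
  · rintro ⟨φ, hφ⟩
    refine hc ⟨φ, fun e e' h => hφ ?_⟩
    exact congrArg f (Subtype.ext h)

/-- The maximum is attained as soon as `F` has an edge. -/
theorem exists_copyCount_eq_rainbowEx (n : ℕ) {W W' : Type*} (H : SimpleGraph W)
    (F : SimpleGraph W') (hF : F ≠ ⊥) :
    ∃ (G : SimpleGraph (Fin n)) (c : ProperEdgeColoring G ℕ),
      ¬ HasRainbow c F ∧ G.copyCount H = rainbowEx n H F := by
  classical
  have hne : ({G : SimpleGraph (Fin n) | ∃ c : ProperEdgeColoring G ℕ, ¬ HasRainbow c F} :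
      Finset (SimpleGraph (Fin n))).Nonempty := by
    refine ⟨⊥, ?_⟩
    simp only [Finset.mem_filter, Finset.mem_univ, true_and]
    refine ⟨SimpleGraph.Coloring.mk (fun _ => 0) fun {e} => ?_, ?_⟩
    · exact absurd e.2 (by simp)
    · rintro ⟨φ, -⟩
      obtain ⟨a, b, hab⟩ := SimpleGraph.ne_bot_iff_exists_adj.mp hF
      exact φ.toHom.map_adj hab
  obtain ⟨G, hG, h⟩ := Finset.exists_mem_eq_sup _ hne fun G => G.copyCount H
  simp only [Finset.mem_filter, Finset.mem_univ, true_and] at hG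
  obtain ⟨c, hc⟩ := hG
  exact ⟨G, c, hc, h.symm⟩

end RainbowTuran

/-! All counting is done with labelled cycles `ZMod s → V`, which differ in number from copies of
`C_s` by a bounded factor (`rainbowEx_le_of_card_cycs_le`, `card_cycs_le_rainbowEx`).

Upper bounds. The common tool is peeling: from a relation between two sets, repeatedly delete the
pairs with fewer than `C` partners on one side. If a pair survives many rounds, one can walk
greedily back and forth along surviving pairs, always choosing new vertices and colours, and close
up to a rainbow `C_t`. So in a graph without one every pair is deleted, which says that one of its
members is determined, up to boundedly many choices, by the other (`lev_or_mem`).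

For even `t`, peeling the paths `a b c` with `a` fixed shows that each is either thin (`b` is
determined by `a, c`) or such that each end is determined by the rest and `a, c` have many common
neighbours (`exists_twoPath_cover`). For even `t ≥ 6`, peeling once more shows that there are only
`O(n^2)` three-edge paths whose two inner vertices are both thin (`card_thinPaths_le`). Sort the
cycles by their set of thin positions. Four consecutive vertices can then be chosen in `O(n^2)`
ways, and every two further ones cost one factor `n`; this gives the exponent `⌊s/2⌋`. For `s = t`
one more factor is saved: if every other vertex can be replaced by many others, a rainbow cycle
arises; if fat and thin positions mix suitably, one vertex comes for free; and if all positions are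
thin, the repeated colour of the non-rainbow cycle determines a vertex.

For `t = 4`, codegrees are at most 5, so every other vertex of a cycle determines the rest; for odd
`s` one also needs the bound `O(n^{3/2})` on the number of edges. For odd `s ≤ t`, two vertices of
each cycle are determined by the others, since otherwise a part of the cycle could be rerouted into
a rainbow `C_t` (`IsCyc.exists_two_chooser`).

Lower bounds. The complete blow-up of `C_s` has no `C_t` at all if `t` is odd and `s` is even or
larger than `t`. For odd `t` in general, two of the complete bipartite graphs are replaced by
perfect matchings of one common colour, which every odd cycle has to cross. For even `t ≥ 6` and `s
≠ t`, every other vertex of `C_s` is blown up; only 4-cycles and `s`-cycles arise. For `s = t`, two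
pairs of neighbouring blown-up vertices are joined by matchings of one colour. For `t = 4` and `s ≠
4` the cycles are found in algebraic graphs without 4-cycles. For `s = t = 4` a Cayley graph in
characteristic 2, coloured by its generators, has many 4-cycles but no rainbow one. -/

namespace RainbowTuran

/-! ### Labelled cycles and their relation to copies of cycle graphs -/

/-- Edges of `G` that meet in a vertex have different values under `col`. -/
def Proper {V K : Type*} (G : SimpleGraph V) (col : Sym2 V → K) : Prop :=
  ∀ a b c, G.Adj a b → G.Adj a c → col s(a, b) = col s(a, c) → b = c

/-- `f` runs once around a cycle of length `t` of `G`. -/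
def IsCyc {V : Type*} (G : SimpleGraph V) (t : ℕ) (f : ZMod t → V) : Prop :=
  Function.Injective f ∧ ∀ i, G.Adj (f i) (f (i + 1))

/-- No cycle of length `t` has edges of pairwise different colours. -/
def RainbowFree {V K : Type*} (G : SimpleGraph V) (col : Sym2 V → K) (t : ℕ) : Prop :=
  ∀ f, IsCyc G t f → ¬ Function.Injective fun i => col s(f i, f (i + 1))

open scoped Classical in
/-- All labelled cycles of length `s` of `G`. -/
noncomputable def cycs {V : Type*} [Fintype V] (G : SimpleGraph V) (s : ℕ) [NeZero s] :
    Finset (ZMod s → V) :=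
  Finset.univ.filter fun f => IsCyc G s f

theorem mem_cycs {V : Type*} [Fintype V] {G : SimpleGraph V} {s : ℕ} [NeZero s] {f : ZMod s → V} :
    f ∈ cycs G s ↔ IsCyc G s f := by
  simp [cycs]

/-- The colouring given by a function on all unordered pairs. -/
def Proper.coloring {V K : Type*} {G : SimpleGraph V} {col : Sym2 V → K} (h : Proper G col) :
    ProperEdgeColoring G K :=
  SimpleGraph.Coloring.mk (fun e => col e) fun {e e'} hee' he => by
    obtain ⟨e, he1⟩ := e
    obtain ⟨e', he2⟩ := e'
    obtain ⟨hne, v, hv, hv'⟩ := SimpleGraph.lineGraph_adj_iff_exists.1 hee'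
    obtain ⟨a, rfl⟩ := Sym2.mem_iff_exists.1 hv
    obtain ⟨b, rfl⟩ := Sym2.mem_iff_exists.1 hv'
    have hab := h v a b he1 he2 he
    subst hab
    exact hne rfl

theorem exists_proper_of_coloring {V K : Type*} [Nonempty K] {G : SimpleGraph V}
    (c : ProperEdgeColoring G K) :
    ∃ col : Sym2 V → K, Proper G col ∧ ∀ e : G.edgeSet, col e = c e := by
  classical
  -- Non-edges get an arbitrary colour: properness and rainbow cycles look at edges only.
  refine ⟨fun e => if h : e ∈ G.edgeSet then c ⟨e, h⟩ else Classical.arbitrary K, ?_, ?_⟩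
  · intro a b d hab had h
    have h1 : s(a, b) ∈ G.edgeSet := hab
    have h2 : s(a, d) ∈ G.edgeSet := had
    simp only [h1, h2, dite_true] at h
    by_contra hbd
    refine c.valid (v := ⟨s(a, b), h1⟩) (w := ⟨s(a, d), h2⟩) ?_ h
    rw [SimpleGraph.lineGraph_adj_iff_exists]
    refine ⟨?_, a, by simp, by simp⟩
    intro h3
    rw [Subtype.mk.injEq] at h3
    exact hbd (Sym2.congr_right.1 h3)
  · intro e
    simp [e.2]

/-- The vertices of a copy of a cycle graph, in order. -/
def cycleMap {V : Type*} {G : SimpleGraph V} {t : ℕ}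
    (φ : SimpleGraph.Copy (SimpleGraph.cycleGraph (t + 2)) G) (i : ZMod (t + 2)) : V :=
  φ.toHom (show Fin (t + 2) from i)

theorem isCyc_cycleMap {V : Type*} {G : SimpleGraph V} {t : ℕ}
    (φ : SimpleGraph.Copy (SimpleGraph.cycleGraph (t + 2)) G) : IsCyc G (t + 2) (cycleMap φ) := by
  refine ⟨φ.injective, fun i => φ.toHom.map_adj ?_⟩
  have key : ∀ j : Fin (t + 2), (SimpleGraph.cycleGraph (t + 2)).Adj j (j + 1) := by
    intro j
    rw [SimpleGraph.cycleGraph_adj]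
    right
    exact add_sub_cancel_left _ _
  exact key i

/-- The copy of the cycle graph traced by `f`. -/
def IsCyc.copy {V : Type*} {G : SimpleGraph V} {t : ℕ} {f : ZMod (t + 2) → V}
    (hf : IsCyc G (t + 2) f) : SimpleGraph.Copy (SimpleGraph.cycleGraph (t + 2)) G :=
  SimpleGraph.Hom.toCopy ⟨fun i : Fin (t + 2) => f (show ZMod (t + 2) from i), fun {i j} h => by
    rcases SimpleGraph.cycleGraph_adj.1 h with h | h
    · have : i = j + 1 := sub_eq_iff_eq_add'.1 h
      rw [this]
      exact (hf.2 j).symm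
    · have : j = i + 1 := sub_eq_iff_eq_add'.1 h
      rw [this]
      exact hf.2 i⟩ hf.1

theorem cycleMap_copy {V : Type*} {G : SimpleGraph V} {t : ℕ} {f : ZMod (t + 2) → V}
    (hf : IsCyc G (t + 2) f) : cycleMap hf.copy = f := rfl

theorem cycleMap_injective {V : Type*} {G : SimpleGraph V} {t : ℕ} :
    Function.Injective (cycleMap (G := G) (t := t)) := by
  intro φ ψ h
  exact SimpleGraph.Copy.ext fun a => congrFun h a

theorem exists_eq_of_mem_edgeSet_cycleGraph {t : ℕ}
    (e : (SimpleGraph.cycleGraph (t + 2)).edgeSet) :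
    ∃ i : Fin (t + 2), (e : Sym2 (Fin (t + 2))) = s(i, i + 1) := by
  obtain ⟨e, he⟩ := e
  induction e with
  | h i j =>
    have he' : (SimpleGraph.cycleGraph (t + 2)).Adj i j := he
    rcases SimpleGraph.cycleGraph_adj.1 he' with h | h
    · refine ⟨j, ?_⟩
      change s(i, j) = _
      rw [sub_eq_iff_eq_add'.1 h]
      exact Sym2.eq_swap
    · refine ⟨i, ?_⟩
      change s(i, j) = _
      rw [sub_eq_iff_eq_add'.1 h]

theorem hasRainbow_of_isCyc {V K : Type*} {G : SimpleGraph V} {t : ℕ}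
    (c : ProperEdgeColoring G K) (col : Sym2 V → K) (hcol : ∀ e : G.edgeSet, col e = c e)
    {f : ZMod (t + 2) → V} (hf : IsCyc G (t + 2) f)
    (hinj : Function.Injective fun i => col s(f i, f (i + 1))) :
    HasRainbow c (SimpleGraph.cycleGraph (t + 2)) := by
  refine ⟨hf.copy, ?_⟩
  intro e e' hee'
  obtain ⟨i, hi⟩ := exists_eq_of_mem_edgeSet_cycleGraph e
  obtain ⟨j, hj⟩ := exists_eq_of_mem_edgeSet_cycleGraph e'
  simp only [← hcol] at hee'
  have h1 : ∀ (e : (SimpleGraph.cycleGraph (t + 2)).edgeSet) (i : Fin (t + 2)), (e : Sym2 (Fin (t + 2))) = s(i, i + 1) →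
      ((hf.copy.mapEdgeSet e : G.edgeSet) : Sym2 V) =
        s(f (show ZMod (t + 2) from i), f ((show ZMod (t + 2) from i) + 1)) := by
    intro e i hi
    change Sym2.map _ (e : Sym2 (Fin (t + 2))) = _
    rw [hi]; rfl
  rw [h1 e i hi, h1 e' j hj] at hee'
  have hij : i = j := hinj hee'
  subst hij
  exact Subtype.ext (hi.trans hj.symm)

theorem exists_isCyc_of_hasRainbow {V K : Type*} {G : SimpleGraph V} {t : ℕ}
    (c : ProperEdgeColoring G K) (col : Sym2 V → K) (hcol : ∀ e : G.edgeSet, col e = c e)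
    (ht : 3 ≤ t + 2) (h : HasRainbow c (SimpleGraph.cycleGraph (t + 2))) :
    ∃ f, IsCyc G (t + 2) f ∧ Function.Injective fun i => col s(f i, f (i + 1)) := by
  obtain ⟨φ, hφ⟩ := h
  refine ⟨cycleMap φ, isCyc_cycleMap φ, ?_⟩
  intro i j hij
  have adj : ∀ i : Fin (t + 2), s(i, i + 1) ∈ (SimpleGraph.cycleGraph (t + 2)).edgeSet := by
    intro i
    refine (SimpleGraph.cycleGraph_adj).2 (Or.inr ?_)
    exact add_sub_cancel_left _ _
  have h1 : ∀ i : Fin (t + 2), c (φ.mapEdgeSet ⟨s(i, i + 1), adj i⟩) =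
      col s(cycleMap φ i, cycleMap φ ((show ZMod (t + 2) from i) + 1)) := by
    intro i
    rw [← hcol]
    rfl
  have h2 := hφ ((h1 i).trans (hij.trans (h1 j).symm))
  rw [Subtype.mk.injEq] at h2
  have h3 : (s(i, i + 1) : Sym2 (ZMod (t + 2))) = s(j, j + 1) := h2
  rcases Sym2.eq_iff.1 h3 with h | ⟨h, h'⟩
  · exact h.1
  · exfalso
    rw [h, add_assoc, add_eq_left] at h'
    have h4 : ((2 : ℕ) : ZMod (t + 2)) = 0 := by
      rw [← h']; push_cast; norm_num
    rw [ZMod.natCast_eq_zero_iff] at h4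
    have := Nat.le_of_dvd (by norm_num) h4
    omega

theorem copyCount_le_card_cycs {V : Type*} [Fintype V] (G : SimpleGraph V) {s : ℕ} [NeZero s]
    (hs : 2 ≤ s) : G.copyCount (SimpleGraph.cycleGraph s) ≤ (cycs G s).card := by
  classical
  obtain ⟨s, rfl⟩ := Nat.exists_eq_add_of_le' hs
  rw [SimpleGraph.copyCount_eq_card_image_copyToSubgraph]
  refine Finset.card_image_le.trans ?_
  refine Finset.card_le_card_of_injOn cycleMap ?_ cycleMap_injective.injOn
  intro φ _
  exact mem_cycs.2 (isCyc_cycleMap φ)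

/-- An upper bound for the number of labelled `s`-cycles bounds `rainbowEx`. -/
theorem rainbowEx_le_of_card_cycs_le {n s t B : ℕ} [NeZero s] (hs : 2 ≤ s) (ht : 2 ≤ t)
    (h : ∀ (G : SimpleGraph (Fin n)) (col : Sym2 (Fin n) → ℕ), Proper G col →
      RainbowFree G col t → (cycs G s).card ≤ B) :
    rainbowEx n (SimpleGraph.cycleGraph s) (SimpleGraph.cycleGraph t) ≤ B := by
  classical
  refine Finset.sup_le fun G hG => ?_
  simp only [Finset.mem_filter, Finset.mem_univ, true_and] at hG
  obtain ⟨c, hc⟩ := hG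
  obtain ⟨col, hp, hcol⟩ := exists_proper_of_coloring c
  obtain ⟨t, rfl⟩ := Nat.exists_eq_add_of_le' ht
  have hfree : RainbowFree G col (t + 2) := fun f hf hinj =>
    hc (hasRainbow_of_isCyc c col hcol hf hinj)
  exact (copyCount_le_card_cycs G hs).trans (h G col hp hfree)

/-- Copies with the same image have the same vertex set. Relative to one of them, each is encoded by
a map from `Fin s` to itself, so at most `s ^ s` labelled cycles trace a given subgraph. -/
theorem card_cycs_le_copyCount {V : Type*} [Fintype V] (G : SimpleGraph V) {s : ℕ} [NeZero s]
    (hs : 2 ≤ s) :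
    (cycs G s).card ≤ s ^ s * G.copyCount (SimpleGraph.cycleGraph s) := by
  classical
  obtain ⟨s, rfl⟩ := Nat.exists_eq_add_of_le' hs
  rw [SimpleGraph.copyCount_eq_card_image_copyToSubgraph]
  have h1 : cycs G (s + 2) ⊆ Finset.univ.image (cycleMap (G := G) (t := s)) := by
    intro f hf
    exact Finset.mem_image.2 ⟨(mem_cycs.1 hf).copy, Finset.mem_univ _, cycleMap_copy _⟩
  refine (Finset.card_le_card h1).trans (Finset.card_image_le.trans ?_)
  refine Finset.card_le_mul_card_image _ _ ?_
  intro A hA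
  obtain ⟨φ₀, -, rfl⟩ := Finset.mem_image.1 hA
  have key : ∀ φ : (SimpleGraph.cycleGraph (s + 2)).Copy G, φ.toSubgraph = φ₀.toSubgraph →
      ∀ i, ∃ j, φ₀ j = φ i := by
    intro φ h i
    have h2 : φ i ∈ φ.toSubgraph.verts := ⟨i, by simp, rfl⟩
    rw [h] at h2
    obtain ⟨j, -, hj⟩ := h2
    exact ⟨j, hj⟩
  calc _ ≤ (Finset.univ : Finset (Fin (s + 2) → Fin (s + 2))).card := by
        refine Finset.card_le_card_of_injOn
          (fun φ i => if h : ∃ j, φ₀ j = φ i then h.choose else 0) (fun _ _ => Finset.mem_univ _) ?_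
        intro φ hφ ψ hψ h
        simp only [Finset.coe_filter, Finset.mem_univ, true_and, Set.mem_ofPred_eq] at hφ hψ
        ext i
        have h3 := congrFun h i
        simp only [key φ hφ i, key ψ hψ i, dite_true] at h3
        rw [← (key φ hφ i).choose_spec, ← (key ψ hψ i).choose_spec, h3]
    _ = _ := by simp

/-- A rainbow-free coloured graph on at most `n` vertices gives a lower bound for `rainbowEx`. -/
theorem card_cycs_le_rainbowEx {V K : Type*} [Fintype V] [Nonempty V] {G : SimpleGraph V}
    {col : Sym2 V → K} {n s t : ℕ} [NeZero s] (hs : 2 ≤ s) (ht : 3 ≤ t) (hn : Fintype.card V ≤ n)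
    (hp : Proper G col) (hf : RainbowFree G col t) :
    (cycs G s).card ≤
      s ^ s * rainbowEx n (SimpleGraph.cycleGraph s) (SimpleGraph.cycleGraph t) := by
  classical
  obtain ⟨e⟩ : Nonempty (V ↪ Fin n) := by
    rw [Function.Embedding.nonempty_iff_card_le]; simpa using hn
  -- The graph is transported to `Fin n` along `e`, leaving the vertices outside the range isolated.
  -- Colours are pulled back through the left inverse `g`, whose values off the range do not matter.
  let g : Fin n → V := Function.invFun e
  have hg : ∀ v, g (e v) = v := Function.leftInverse_invFun e.injective
  have hmap : ∀ a b, (G.map e).Adj a b → G.Adj (g a) (g b) ∧ e (g a) = a ∧ e (g b) = b := by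
    rintro a b ⟨hab, u, v, huv, rfl, rfl⟩
    simp only [hg, and_self, and_true]
    exact huv
  have hp' : Proper (G.map e) fun x => col (Sym2.map g x) := by
    intro a b d hab had h
    obtain ⟨h1, h2, h3⟩ := hmap _ _ hab
    obtain ⟨h4, -, h5⟩ := hmap _ _ had
    have := hp _ _ _ h1 h4 h
    rw [← h3, ← h5, this]
  have hno : ¬ HasRainbow hp'.coloring (SimpleGraph.cycleGraph t) := by
    intro h
    obtain ⟨t, rfl⟩ := Nat.exists_eq_add_of_le' (show 2 ≤ t by omega)
    obtain ⟨f, hf1, hf2⟩ := exists_isCyc_of_hasRainbow hp'.coloring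
      (fun x => col (Sym2.map g x)) (fun _ => rfl) ht h
    refine hf (fun i => g (f i)) ⟨?_, fun i => (hmap _ _ (hf1.2 i)).1⟩ hf2
    intro i j hij
    apply hf1.1
    rw [← (hmap _ _ (hf1.2 i)).2.1, ← (hmap _ _ (hf1.2 j)).2.1]
    exact congrArg e hij
  refine le_trans ?_ (Nat.mul_le_mul_left _ (copyCount_le_rainbowEx _ _ _ _ hno))
  refine le_trans ?_ (card_cycs_le_copyCount _ hs)
  refine Finset.card_le_card_of_injOn (fun f i => e (f i)) ?_ ?_
  · intro f hf
    have hf' := mem_cycs.1 hf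
    refine mem_cycs.2 ⟨e.injective.comp hf'.1, fun i => ?_⟩
    exact (SimpleGraph.map_adj_apply).2 (hf'.2 i)
  · intro f _ f' _ h
    funext i
    exact e.injective (congrFun h i)

theorem val_add_one_cases {t : ℕ} [NeZero t] (i : ZMod t) :
    (i.val + 1 < t ∧ (i + 1).val = i.val + 1) ∨ (i.val + 1 = t ∧ (i + 1).val = 0) := by
  have hi := ZMod.val_lt i
  have h1 : i + 1 = ((i.val + 1 : ℕ) : ZMod t) := by
    push_cast
    rw [ZMod.natCast_zmod_val]
  rcases Nat.lt_or_ge (i.val + 1) t with h2 | h2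
  · left
    refine ⟨h2, ?_⟩
    rw [h1, ZMod.val_cast_of_lt h2]
  · right
    have h3 : i.val + 1 = t := by omega
    refine ⟨h3, ?_⟩
    rw [h1, h3, ZMod.natCast_self, ZMod.val_zero]

/-! ### Rainbow paths and their greedy extension -/

section RainbowPaths

variable {V K : Type*} {G : SimpleGraph V} {col : Sym2 V → K}

/-- The colours along the path with vertex list `l`. -/
def pathColors (col : Sym2 V → K) : List V → List K
  | a :: b :: l => col s(a, b) :: pathColors col (b :: l)
  | _ => []

/-- `l` is the vertex list of a path of `G` whose edges have different colours. -/
def RPath (G : SimpleGraph V) (col : Sym2 V → K) : List V → Prop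
  | a :: b :: l => G.Adj a b ∧ a ∉ b :: l ∧ col s(a, b) ∉ pathColors col (b :: l) ∧
      RPath G col (b :: l)
  | _ => True

theorem RPath.nodup : ∀ {l : List V}, RPath G col l → l.Nodup
  | [], _ => List.nodup_nil
  | [a], _ => List.nodup_singleton a
  | _ :: _ :: _, h => List.nodup_cons.2 ⟨h.2.1, h.2.2.2.nodup⟩

theorem RPath.adj_getD (d : V) : ∀ {l : List V}, RPath G col l → ∀ i, i + 1 < l.length →
    G.Adj (l.getD i d) (l.getD (i + 1) d)
  | [], _, i, h => by simp at h
  | [a], _, i, h => by simp at h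
  | a :: b :: l, h, 0, _ => h.1
  | a :: b :: l, h, i + 1, hi => h.2.2.2.adj_getD d i (by simpa using hi)

theorem color_getD_mem (d : V) : ∀ (l : List V) (i : ℕ), i + 1 < l.length →
    col s(l.getD i d, l.getD (i + 1) d) ∈ pathColors col l
  | [], i, h => by simp at h
  | [a], i, h => by simp at h
  | a :: b :: l, 0, _ => List.mem_cons_self
  | a :: b :: l, i + 1, hi =>
    List.mem_cons_of_mem _ (color_getD_mem d (b :: l) i (by simpa using hi))

theorem RPath.color_getD_ne (d : V) : ∀ {l : List V}, RPath G col l → ∀ i j, i < j →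
    j + 1 < l.length →
    col s(l.getD i d, l.getD (i + 1) d) ≠ col s(l.getD j d, l.getD (j + 1) d)
  | [], _, i, j, _, h => by simp at h
  | [a], _, i, j, _, h => by simp at h
  | a :: b :: l, h, i, 0, hij, _ => by omega
  | a :: b :: l, h, 0, j + 1, _, hj => fun he =>
    h.2.2.1 (by
      have h1 := color_getD_mem (col := col) d (b :: l) j (by simpa using hj)
      simp only [List.getD_cons_succ, List.getD_cons_zero] at he h1
      exact he ▸ h1)
  | a :: b :: l, h, i + 1, j + 1, hij, hj =>
    h.2.2.2.color_getD_ne d i j (by omega) (by simpa using hj)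

theorem pathColors_length_le (col : Sym2 V → K) : ∀ l : List V,
    (pathColors col l).length ≤ l.length
  | [] => le_rfl
  | [_] => Nat.zero_le _
  | _ :: b :: l => Nat.succ_le_succ (pathColors_length_le col (b :: l))

/-- A rainbow path of `t` vertices whose ends are joined by an edge of a new colour closes up to a
rainbow cycle. -/
theorem RPath.not_rainbowFree {t : ℕ} {l : List V} {h d : V} (hl : RPath G col (h :: l))
    (hlen : l.length + 1 = t) (ht : 3 ≤ t) (hd : (h :: l).getLast? = some d) (hadj : G.Adj d h)
    (hcol : col s(d, h) ∉ pathColors col (h :: l)) : ¬ RainbowFree G col t := by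
  subst hlen
  intro hfree
  set L := h :: l with hL
  have hLlen : L.length = l.length + 1 := by simp [hL]
  have h0 : L.getD 0 d = h := by simp [hL]
  have hlast : L.getD l.length d = d := by
    rw [List.getD_eq_getElem?_getD]
    rw [List.getLast?_eq_getElem?, hLlen] at hd
    simp only [Nat.add_sub_cancel] at hd
    rw [hd]; rfl
  have hstep : ∀ i : ZMod (l.length + 1),
      (i.val + 1 < l.length + 1 ∧ (i + 1).val = i.val + 1) ∨
      (i.val = l.length ∧ (i + 1).val = 0) := by
    intro i
    rcases val_add_one_cases i with h1 | h1
    · exact Or.inl h1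
    · exact Or.inr ⟨by omega, h1.2⟩
  refine hfree (fun i => L.getD i.val d) ⟨?_, ?_⟩ ?_
  · intro i j hij
    have hi := ZMod.val_lt i
    have hj := ZMod.val_lt j
    simp only at hij
    rw [List.getD_eq_getElem _ _ (by omega), List.getD_eq_getElem _ _ (by omega),
      hl.nodup.getElem_inj_iff] at hij
    exact ZMod.val_injective _ hij
  · intro i
    beta_reduce
    rcases hstep i with ⟨h1, h2⟩ | ⟨h1, h2⟩
    · rw [h2]; exact hl.adj_getD d _ (by omega)
    · rw [h2, h1, h0, hlast]; exact hadj
  · intro i j hij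
    simp only at hij
    rcases hstep i with ⟨h1, h2⟩ | ⟨h1, h2⟩ <;> rcases hstep j with ⟨h3, h4⟩ | ⟨h3, h4⟩
    · rw [h2, h4] at hij
      apply ZMod.val_injective
      rcases lt_trichotomy i.val j.val with h5 | h5 | h5
      · exact absurd hij (hl.color_getD_ne d _ _ h5 (by omega))
      · exact h5
      · exact absurd hij.symm (hl.color_getD_ne d _ _ h5 (by omega))
    · rw [h2, h4, h3, h0, hlast] at hij
      exact absurd (hij ▸ color_getD_mem d L i.val (by omega)) hcol
    · rw [h2, h4, h1, h0, hlast] at hij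
      exact absurd (hij ▸ color_getD_mem d L j.val (by omega)) hcol
    · exact ZMod.val_injective _ (h1.trans h3.symm)

theorem rpath_cons {a b : V} {l : List V} (hl : RPath G col (b :: l)) (hab : G.Adj b a)
    (ha : a ∉ b :: l) (hc : col s(b, a) ∉ pathColors col (b :: l)) :
    RPath G col (a :: b :: l) :=
  ⟨hab.symm, ha, by rwa [Sym2.eq_swap], hl⟩

/-- Among sufficiently many common neighbours of `u` and `w` some vertex avoids given vertices,
and its edges to `u` and `w` avoid given colours. -/
theorem exists_fresh [DecidableEq V] (hp : Proper G col) {u w : V} {O X : Finset V} {Y : List K}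
    (hu : ∀ v ∈ O, G.Adj u v) (hw : ∀ v ∈ O, G.Adj w v) (hO : X.card + 2 * Y.length < O.card) :
    ∃ v ∈ O, v ∉ X ∧ col s(u, v) ∉ Y ∧ col s(w, v) ∉ Y := by
  classical
  by_contra hcon
  push Not at hcon
  -- By properness a colour occurs at most once at `u` and at most once at `w`, so each colour in
  -- `Y` excludes at most two vertices.
  have key : ∀ u, (∀ v ∈ O, G.Adj u v) → (O.filter fun v => col s(u, v) ∈ Y).card ≤ Y.length := by
    intro u hu
    refine le_trans ?_ (List.toFinset_card_le Y)
    refine Finset.card_le_card_of_injOn (fun v => col s(u, v)) ?_ ?_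
    · intro v hv
      simpa using (Finset.mem_filter.1 hv).2
    · intro v hv v' hv' h
      exact hp _ _ _ (hu v (Finset.mem_filter.1 hv).1) (hu v' (Finset.mem_filter.1 hv').1) h
  have hsub : O ⊆ X ∪ ((O.filter fun v => col s(u, v) ∈ Y) ∪
      (O.filter fun v => col s(w, v) ∈ Y)) := by
    intro v hv
    by_cases h1 : v ∈ X
    · simp [h1]
    · by_cases h2 : col s(u, v) ∈ Y
      · simp [h2, hv]
      · simp [hcon v hv h1 h2, hv]
  have h1 := Finset.card_le_card hsub
  have h2 := Finset.card_union_le X ((O.filter fun v => col s(u, v) ∈ Y) ∪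
      (O.filter fun v => col s(w, v) ∈ Y))
  have h3 := Finset.card_union_le (O.filter fun v => col s(u, v) ∈ Y)
      (O.filter fun v => col s(w, v) ∈ Y)
  have h4 := key u hu
  have h5 := key w hw
  omega

end RainbowPaths

/-! ### Peeling a relation -/

section Levels

variable {α β : Type*} [Fintype α] [Fintype β]

open scoped Classical in
/-- The pairs of a relation that survive `m` rounds of deleting the pairs having fewer than `C`
partners on one of the two sides. -/
def lev (R : α → β → Prop) (C : ℕ) : ℕ → α → β → Prop
  | 0 => R
  | m + 1 => fun a b => lev R C m a b ∧ C ≤ (Finset.univ.filter fun a' => lev R C m a' b).card ∧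
      C ≤ (Finset.univ.filter fun b' => lev R C m a b').card

variable {R : α → β → Prop} {C : ℕ}

theorem lev_anti {m m' : ℕ} (h : m ≤ m') {a : α} {b : β} (hab : lev R C m' a b) :
    lev R C m a b := by
  induction m', h using Nat.le_induction with
  | base => exact hab
  | succ k _ ih => exact ih hab.1

theorem lev_rel {m : ℕ} {a : α} {b : β} (hab : lev R C m a b) : R a b :=
  lev_anti (Nat.zero_le m) hab

open scoped Classical in
/-- The left elements deleted for having few competitors. -/
noncomputable def levLeft (R : α → β → Prop) (C m : ℕ) (b : β) : Finset α :=
  (Finset.range m).biUnion fun j =>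
    if (Finset.univ.filter fun a' => lev R C j a' b).card < C then
      Finset.univ.filter fun a' => lev R C j a' b else ∅

open scoped Classical in
/-- The right elements deleted for having few competitors. -/
noncomputable def levRight (R : α → β → Prop) (C m : ℕ) (a : α) : Finset β :=
  (Finset.range m).biUnion fun j =>
    if (Finset.univ.filter fun b' => lev R C j a b').card < C then
      Finset.univ.filter fun b' => lev R C j a b' else ∅

theorem card_levLeft_le (m : ℕ) (b : β) : (levLeft R C m b).card ≤ m * C := by
  classical
  refine (Finset.card_biUnion_le_card_mul _ _ C fun j _ => ?_).trans (by simp)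
  split_ifs with h
  · exact h.le
  · simp

theorem card_levRight_le (m : ℕ) (a : α) : (levRight R C m a).card ≤ m * C := by
  classical
  refine (Finset.card_biUnion_le_card_mul _ _ C fun j _ => ?_).trans (by simp)
  split_ifs with h
  · exact h.le
  · simp

/-- A pair that does not survive was deleted in some round, when one of its members had fewer than
`C` partners; the other member was then one of those few. Over `m` rounds at most `m * C` such
partners accumulate. With survival excluded by a rainbow cycle, this turns into a determination
statement. -/
theorem lev_or_mem (m : ℕ) {a : α} {b : β} (h : R a b) :
    lev R C m a b ∨ a ∈ levLeft R C m b ∨ b ∈ levRight R C m a := by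
  classical
  induction m with
  | zero => exact Or.inl h
  | succ m ih =>
    rcases ih with h | h | h
    · by_cases h1 : (Finset.univ.filter fun a' => lev R C m a' b).card < C
      · refine Or.inr (Or.inl ?_)
        refine Finset.mem_biUnion.2 ⟨m, Finset.self_mem_range_succ m, ?_⟩
        rw [if_pos h1]
        simpa using h
      · by_cases h2 : (Finset.univ.filter fun b' => lev R C m a b').card < C
        · refine Or.inr (Or.inr ?_)
          refine Finset.mem_biUnion.2 ⟨m, Finset.self_mem_range_succ m, ?_⟩
          rw [if_pos h2]
          simpa using h
        · exact Or.inl ⟨h, not_lt.1 h1, not_lt.1 h2⟩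
    · refine Or.inr (Or.inl ?_)
      exact Finset.biUnion_subset_biUnion_of_subset_left _
        (Finset.range_subset_range.2 (Nat.le_succ m)) h
    · refine Or.inr (Or.inr ?_)
      exact Finset.biUnion_subset_biUnion_of_subset_left _
        (Finset.range_subset_range.2 (Nat.le_succ m)) h

end Levels

/-! ### Prolonging rainbow paths and closing them up -/

section Paths

variable {V K : Type*} [Fintype V] {G : SimpleGraph V} {col : Sym2 V → K}

open scoped Classical in
/-- The common neighbours of two vertices. -/
noncomputable def commonNbrs (G : SimpleGraph V) (u w : V) : Finset V :=
  Finset.univ.filter fun v => G.Adj u v ∧ G.Adj w v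

theorem mem_commonNbrs {u w v : V} : v ∈ commonNbrs G u w ↔ G.Adj u v ∧ G.Adj w v := by
  simp [commonNbrs]

/-- A rainbow path is prolonged through `w 0, w 1, …, w m`, with new vertices in between, if
consecutive vertices of this sequence have many common neighbours. -/
theorem RPath.prolong (hp : Proper G col) {w : ℕ → V} {m T : ℕ} {l₀ : List V} {d : V}
    {A : Finset V} {Y : List K} (h0 : RPath G col (w 0 :: l₀))
    (hlast : (w 0 :: l₀).getLast? = some d)
    (hfat : ∀ j < m, T ≤ (commonNbrs G (w j) (w (j + 1))).card)
    (hinj : ∀ i j, i < j → j ≤ m → w i ≠ w j) (hav : ∀ j, 1 ≤ j → j ≤ m → w j ∉ w 0 :: l₀)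
    (hT : 3 * (l₀.length + 1 + 2 * m) + A.card + (m + 1) + 2 * Y.length < T) :
    ∃ l, RPath G col (w m :: l) ∧ (w m :: l).getLast? = some d ∧
      l.length = l₀.length + 2 * m ∧
      (∀ v ∈ w m :: l, v ∈ w 0 :: l₀ ∨ (∃ i, 1 ≤ i ∧ i ≤ m ∧ v = w i) ∨ v ∉ A) ∧
      ∀ y ∈ pathColors col (w m :: l), y ∈ pathColors col (w 0 :: l₀) ∨ y ∉ Y := by
  classical
  -- All `w i` are forbidden for the new intermediate vertices, so that none of these occupies a
  -- later vertex of the sequence.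
  set B : Finset V := A ∪ (Finset.range (m + 1)).image w with hB
  have hBcard : B.card ≤ A.card + (m + 1) := by
    refine (Finset.card_union_le _ _).trans ?_
    have := Finset.card_image_le (s := Finset.range (m + 1)) (f := w)
    rw [Finset.card_range] at this
    omega
  have main : ∀ j ≤ m, ∃ l, RPath G col (w j :: l) ∧ (w j :: l).getLast? = some d ∧
      l.length = l₀.length + 2 * j ∧
      (∀ v ∈ w j :: l, v ∈ w 0 :: l₀ ∨ (∃ i, 1 ≤ i ∧ i ≤ j ∧ v = w i) ∨ v ∉ B) ∧
      ∀ y ∈ pathColors col (w j :: l), y ∈ pathColors col (w 0 :: l₀) ∨ y ∉ Y := by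
    intro j
    induction j with
    | zero =>
      intro _
      exact ⟨l₀, h0, hlast, by simp, fun v hv => Or.inl hv, fun y hy => Or.inl hy⟩
    | succ j ih =>
      intro hj
      obtain ⟨l, h1, h2, h3, h4, h5⟩ := ih (by omega)
      have hlen := pathColors_length_le col (w j :: l)
      simp only [List.length_cons] at hlen
      have hX : ((w j :: l).toFinset ∪ B).card ≤ l.length + 1 + (A.card + (m + 1)) := by
        refine (Finset.card_union_le _ _).trans ?_
        have := List.toFinset_card_le (w j :: l)
        simp only [List.length_cons] at this
        omega
      obtain ⟨x, hx, hxX, hx1, hx2⟩ := exists_fresh hp (u := w j) (w := w (j + 1))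
        (O := commonNbrs G (w j) (w (j + 1))) (X := (w j :: l).toFinset ∪ B)
        (Y := pathColors col (w j :: l) ++ Y)
        (fun v hv => (mem_commonNbrs.1 hv).1) (fun v hv => (mem_commonNbrs.1 hv).2)
        (by
          have := hfat j (by omega)
          rw [List.length_append]
          omega)
      simp only [Finset.mem_union, List.mem_toFinset, not_or, List.mem_append] at hxX hx1 hx2
      obtain ⟨hadj1, hadj2⟩ := mem_commonNbrs.1 hx
      have hwB : ∀ i ≤ m, w i ∈ B := fun i hi =>
        Finset.mem_union_right _ (Finset.mem_image_of_mem _ (Finset.mem_range.2 (by omega)))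
      have hwl : w (j + 1) ∉ w j :: l := by
        intro hmem
        rcases h4 _ hmem with h | ⟨i, hi1, hi2, hi3⟩ | h
        · exact hav (j + 1) (by omega) hj h
        · exact hinj i (j + 1) (by omega) hj hi3.symm
        · exact h (hwB _ hj)
      have hP1 : RPath G col (x :: w j :: l) := rpath_cons h1 hadj1 hxX.1 hx1.1
      have hxw : x ≠ w (j + 1) := fun h => hxX.2 (h ▸ hwB _ hj)
      have hww : w (j + 1) ≠ w j := fun h => hwl (h ▸ List.mem_cons_self)
      have hP2 : RPath G col (w (j + 1) :: x :: w j :: l) := by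
        refine rpath_cons hP1 hadj2.symm ?_ ?_
        · rw [List.mem_cons, not_or]
          exact ⟨hxw.symm, hwl⟩
        · change _ ∉ col s(x, w j) :: pathColors col (w j :: l)
          rw [List.mem_cons, not_or]
          refine ⟨fun h => hww (hp _ _ _ hadj2.symm hadj1.symm h), ?_⟩
          rw [Sym2.eq_swap]
          exact hx2.1
      refine ⟨x :: w j :: l, hP2, ?_, by simp only [List.length_cons]; omega, ?_, ?_⟩
      · rw [List.getLast?_cons_cons, List.getLast?_cons_cons]
        exact h2
      · intro v hv
        rcases List.mem_cons.1 hv with rfl | hv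
        · exact Or.inr (Or.inl ⟨j + 1, by omega, le_rfl, rfl⟩)
        · rcases List.mem_cons.1 hv with rfl | hv
          · exact Or.inr (Or.inr hxX.2)
          · rcases h4 v hv with h | ⟨i, hi1, hi2, hi3⟩ | h
            · exact Or.inl h
            · exact Or.inr (Or.inl ⟨i, hi1, by omega, hi3⟩)
            · exact Or.inr (Or.inr h)
      · intro y hy
        change y ∈ col s(w (j + 1), x) :: col s(x, w j) :: pathColors col (w j :: l) at hy
        rcases List.mem_cons.1 hy with rfl | hy
        · exact Or.inr hx2.2
        · rcases List.mem_cons.1 hy with rfl | hy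
          · right
            rw [Sym2.eq_swap]
            exact hx1.2
          · exact h5 y hy
  obtain ⟨l, h1, h2, h3, h4, h5⟩ := main m le_rfl
  refine ⟨l, h1, h2, h3, fun v hv => ?_, h5⟩
  rcases h4 v hv with h | h | h
  · exact Or.inl h
  · exact Or.inr (Or.inl h)
  · exact Or.inr (Or.inr fun h' => h (Finset.mem_union_left _ h'))

/-- One step back and forth along pairs of a relation that survive many rounds of deletion. -/
theorem RPath.zigzag_step (hp : Proper G col) {R : V → V → Prop} {d h b₀ c₀ : V} {C j : ℕ}
    {l : List V} (hR : ∀ b c, R b c → G.Adj b c ∧ G.Adj c d) (hl : RPath G col (h :: l))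
    (hlast : (h :: l).getLast? = some d) (hh : h = c₀ ∨ ∀ b c, R b c → G.Adj h b)
    (hlev : lev R C (j + 2) b₀ c₀) (hC : 3 * (l.length + 2) < C) :
    ∃ b c, lev R C j b c ∧ RPath G col (c :: b :: h :: l) ∧
      col s(d, c) ∉ pathColors col (c :: b :: h :: l) := by
  classical
  -- Two rounds are used up: one provides many partners `b` of `c₀`, the other many partners `c` of
  -- the chosen `b`.
  obtain ⟨-, h1, -⟩ := hlev
  have hlen := pathColors_length_le col (h :: l)
  have hcard := List.toFinset_card_le (h :: l)
  simp only [List.length_cons] at hlen hcard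
  have hOadj : ∀ v ∈ Finset.univ.filter fun a' => lev R C (j + 1) a' c₀, G.Adj h v := by
    intro v hv
    have hv' := lev_rel (Finset.mem_filter.1 hv).2
    rcases hh with rfl | hh
    · exact (hR _ _ hv').1.symm
    · exact hh _ _ hv'
  obtain ⟨b, hb, hbX, hbY, -⟩ := exists_fresh hp (X := (h :: l).toFinset)
    (Y := pathColors col (h :: l)) hOadj hOadj (by omega)
  have hP1 : RPath G col (b :: h :: l) :=
    rpath_cons hl (hOadj b hb) (by simpa using hbX) hbY
  have hlen' := pathColors_length_le col (b :: h :: l)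
  have hcard' := List.toFinset_card_le (b :: h :: l)
  simp only [List.length_cons] at hlen' hcard'
  have hb2 : C ≤ (Finset.univ.filter fun c => lev R C j b c).card := (Finset.mem_filter.1 hb).2.2.2
  have hO1 : ∀ v ∈ Finset.univ.filter fun c => lev R C j b c, G.Adj b v := fun v hv =>
    (hR _ _ (lev_rel (Finset.mem_filter.1 hv).2)).1
  have hO2 : ∀ v ∈ Finset.univ.filter fun c => lev R C j b c, G.Adj d v := fun v hv =>
    (hR _ _ (lev_rel (Finset.mem_filter.1 hv).2)).2.symm
  have hlen1 : (pathColors col (b :: h :: l)).length ≤ l.length + 2 := by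
    change (pathColors col (h :: l)).length + 1 ≤ _
    omega
  obtain ⟨c, hc, hcX, hcY, hcd⟩ := exists_fresh hp (X := (b :: h :: l).toFinset)
    (Y := pathColors col (b :: h :: l)) hO1 hO2 (by omega)
  have hP2 : RPath G col (c :: b :: h :: l) :=
    rpath_cons hP1 (hO1 c hc) (by simpa using hcX) hcY
  refine ⟨b, c, (Finset.mem_filter.1 hc).2, hP2, ?_⟩
  change _ ∉ col s(c, b) :: pathColors col (b :: h :: l)
  rw [List.mem_cons, not_or]
  refine ⟨fun he => ?_, hcd⟩
  rw [Sym2.eq_swap] at he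
  have hdb := hp _ _ _ (hO2 c hc).symm (hO1 c hc).symm he
  have hd : d ∈ h :: l := List.mem_of_getLast? hlast
  rw [hdb] at hd
  exact hbX (List.mem_toFinset.2 hd)

/-- Every step adds two vertices and uses two rounds of deletion, and the new head is always joined
to the start `d` by an edge of a new colour; hence the cycle can be closed after the last step. The
head may at first be a vertex joined to all left elements of `R`; from the second step on it is the
right element of a surviving pair. -/
theorem RPath.zigzag (hp : Proper G col) {R : V → V → Prop} {d : V} {C : ℕ}
    (hR : ∀ b c, R b c → G.Adj b c ∧ G.Adj c d) (r : ℕ) : ∀ {h b₀ c₀ : V} {l : List V},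
    RPath G col (h :: l) → (h :: l).getLast? = some d → (h = c₀ ∨ ∀ b c, R b c → G.Adj h b) →
    lev R C (2 * (r + 1)) b₀ c₀ → 3 * (l.length + 2 * (r + 1)) < C →
    ¬ RainbowFree G col (l.length + 1 + 2 * (r + 1)) := by
  induction r with
  | zero =>
    intro h b₀ c₀ l hl hlast hh hlev hC
    obtain ⟨b, c, h1, h2, h3⟩ := hl.zigzag_step hp hR hlast hh hlev (by omega)
    refine h2.not_rainbowFree (d := d) (by simp only [List.length_cons]) (by omega) ?_
      (hR _ _ (lev_rel h1)).2.symm h3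
    rw [List.getLast?_cons_cons, List.getLast?_cons_cons]
    exact hlast
  | succ r ih =>
    intro h b₀ c₀ l hl hlast hh hlev hC
    obtain ⟨b, c, h1, h2, h3⟩ := hl.zigzag_step hp hR hlast hh (j := 2 * (r + 1)) hlev (by omega)
    have := ih (l := b :: h :: l) h2 (by
      rw [List.getLast?_cons_cons, List.getLast?_cons_cons]
      exact hlast) (Or.inl rfl) h1 (by simp only [List.length_cons]; omega)
    convert! this using 2
    simp only [List.length_cons]
    omega

end Paths

/-! ### Two-edge paths in graphs without a rainbow cycle of even length -/

/-- `M a c` and `D a b` are sets of at most `k` vertices such that for every path `a b c` either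
`b ∈ M a c`, or each end of the path lies in the set `D` given by the other two vertices and the
ends have at least `T` common neighbours. -/
structure IsCover {V : Type*} [Fintype V] (G : SimpleGraph V) (T k : ℕ) (M D : V → V → Finset V) :
    Prop where
  card_mid : ∀ a c, (M a c).card ≤ k
  card_end : ∀ a b, (D a b).card ≤ k
  cover : ∀ a b c, G.Adj a b → G.Adj b c → a ≠ c →
    b ∈ M a c ∨ (c ∈ D a b ∧ a ∈ D c b ∧ T ≤ (commonNbrs G a c).card)

open scoped Classical in
/-- In a graph without rainbow cycles of a given even length, in every path `a b c` either the
middle vertex is determined by the ends, up to boundedly many choices, or each of the ends is so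
determined by the other two vertices. -/
theorem exists_twoPath_cover (r T : ℕ) : ∃ k : ℕ, ∀ {V K : Type} [Fintype V] {G : SimpleGraph V}
    {col : Sym2 V → K}, Proper G col → RainbowFree G col (2 * (r + 2)) →
    ∃ M D : V → V → Finset V, IsCover G T k M D := by
  -- The zigzag starts with the path `b a` and needs `r + 1` steps to reach length `2 * (r + 2)`,
  -- hence `2 * (r + 1)` rounds; `C` exceeds three times the length it can reach.
  set C := 3 * (2 * r + 3) + 1 with hC
  set m := 2 * (r + 1) with hm
  refine ⟨2 * (m * C) + T, fun {V K} _ {G col} hp hfree => ?_⟩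
  let R : V → V → V → Prop := fun a c b => G.Adj a b ∧ G.Adj b c ∧ a ≠ c
  have hno : ∀ a c b, ¬ lev (R a) C m c b := by
    intro a c b hlev
    have hab : G.Adj a b := (lev_rel hlev).1
    have := RPath.zigzag hp (R := R a) (d := a) (C := C)
      (fun b c h => ⟨h.2.1.symm, h.1.symm⟩) r (h := b) (l := [a]) (c₀ := b)
      ⟨hab.symm, by simpa using hab.ne', by simp [pathColors], trivial⟩
      (by simp) (Or.inl rfl) hlev (by simp only [List.length_cons, List.length_nil]; omega)
    refine this ?_
    rwa [show [a].length + 1 + 2 * (r + 1) = 2 * (r + 2) by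
      simp only [List.length_cons, List.length_nil]; omega]
  -- A middle vertex is listed if it was deleted in the relation seen from either end, or if the
  -- ends have fewer than `T` common neighbours. This gives `2 * (m * C) + T`.
  refine ⟨fun a c => levRight (R a) C m c ∪ levRight (R c) C m a ∪
    (if (commonNbrs G a c).card < T then commonNbrs G a c else ∅),
    fun a b => levLeft (R a) C m b, ?_, ?_, ?_⟩
  · intro a c
    refine (Finset.card_union_le _ _).trans ?_
    have h1 := Finset.card_union_le (levRight (R a) C m c) (levRight (R c) C m a)
    have h2 := card_levRight_le (R := R a) (C := C) m c
    have h3 := card_levRight_le (R := R c) (C := C) m a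
    have h4 : (if (commonNbrs G a c).card < T then commonNbrs G a c else ∅).card ≤ T := by
      split_ifs with h
      · exact h.le
      · simp
    omega
  · intro a b
    exact (card_levLeft_le (R := R a) (C := C) m b).trans (by omega)
  · intro a b c hab hbc hac
    simp only [Finset.mem_union]
    by_cases hT : (commonNbrs G a c).card < T
    · left
      right
      rw [if_pos hT]
      exact mem_commonNbrs.2 ⟨hab, hbc.symm⟩
    rcases lev_or_mem (R := R a) (C := C) m (a := c) (b := b) ⟨hab, hbc, hac⟩ with h | h | h
    · exact absurd h (hno _ _ _)
    -- Here `c` is determined by `a, b`. The relation seen from `c` then shows that `a` is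
    -- determined by `c, b` as well, unless `b` is thin.
    · rcases lev_or_mem (R := R c) (C := C) m (a := a) (b := b)
        ⟨hbc.symm, hab.symm, hac.symm⟩ with h' | h' | h'
      · exact absurd h' (hno _ _ _)
      · exact Or.inr ⟨h, h', not_lt.1 hT⟩
      · exact Or.inl (Or.inl (Or.inr h'))
    · exact Or.inl (Or.inl (Or.inl h))

/-! ### Three-edge paths with thin inner vertices -/

section ThreePaths

variable {V K : Type*} [Fintype V] {G : SimpleGraph V} {col : Sym2 V → K}
  {M D : V → V → Finset V} {k : ℕ}

/-- Three-edge walks `a b c d` without backtracking whose inner vertices are determined by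
their neighbours. -/
def ThinPath (G : SimpleGraph V) (M : V → V → Finset V) (a b c d : V) : Prop :=
  G.Adj a b ∧ G.Adj b c ∧ G.Adj c d ∧ a ≠ c ∧ b ≠ d ∧ b ∈ M a c ∧ c ∈ M b d

open scoped Classical in
/-- The set of all thin paths. -/
noncomputable def thinPaths (G : SimpleGraph V) (M : V → V → Finset V) : Finset (V × V × V × V) :=
  Finset.univ.filter fun p => ThinPath G M p.1 p.2.1 p.2.2.1 p.2.2.2

open scoped Classical in
/-- The inner edges of the given colour of thin paths from `a` to `d`. -/
noncomputable def parallels (G : SimpleGraph V) (M : V → V → Finset V) (col : Sym2 V → K)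
    (a d : V) (y : K) : Finset (V × V) :=
  Finset.univ.filter fun e => ThinPath G M a e.1 e.2 d ∧ col s(e.1, e.2) = y

open scoped Classical in
/-- The neighbours of `a` along edges of a given colour. -/
noncomputable def colorNbrs (G : SimpleGraph V) (col : Sym2 V → K) (a : V) (y : K) : Finset V :=
  Finset.univ.filter fun v => G.Adj a v ∧ col s(a, v) = y

theorem mem_colorNbrs {a v : V} {y : K} :
    v ∈ colorNbrs G col a y ↔ G.Adj a v ∧ col s(a, v) = y := by
  simp [colorNbrs]

theorem card_colorNbrs_le (hp : Proper G col) (a : V) (y : K) :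
    (colorNbrs G col a y).card ≤ 1 := by
  refine Finset.card_le_one.2 fun v hv w hw => ?_
  rw [mem_colorNbrs] at hv hw
  exact hp _ _ _ hv.1 hw.1 (hv.2.trans hw.2.symm)

theorem mem_parallels {a d : V} {y : K} {e : V × V} :
    e ∈ parallels G M col a d y ↔ ThinPath G M a e.1 e.2 d ∧ col s(e.1, e.2) = y := by
  simp [parallels]

theorem mem_thinPaths {p : V × V × V × V} :
    p ∈ thinPaths G M ↔ ThinPath G M p.1 p.2.1 p.2.2.1 p.2.2.2 := by
  simp [thinPaths]

/-- On average a thin path has boundedly many parallels with the same inner colour. -/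
theorem sum_card_parallels_le {T : ℕ} (hp : Proper G col) (hM : IsCover G T k M D) :
    ∑ p ∈ thinPaths G M, (parallels G M col p.1 p.2.2.2 (col s(p.2.1, p.2.2.1))).card ≤
      (3 * k + 1) * (thinPaths G M).card := by
  classical
  -- For a thin path `p = (a, b, c, d)`, `Z p` holds the parallels `(b', c')` that can be listed
  -- from `p`: the edge `bc` itself, and those where `b'` or `c'` lies in an end set `D`, the other
  -- vertex being given by the colour.
  let Z : V × V × V × V → Finset (V × V) := fun p =>
    {(p.2.1, p.2.2.1)} ∪
    (D p.2.1 p.1).biUnion (fun b' => (colorNbrs G col b' (col s(p.2.1, p.2.2.1))).image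
      fun c' => (b', c')) ∪
    (D p.2.2.1 p.2.2.2).biUnion (fun c' => (colorNbrs G col c' (col s(p.2.1, p.2.2.1))).image
      fun b' => (b', c'))
  have hZ : ∀ p, (Z p).card ≤ 2 * k + 1 := by
    intro p
    refine (Finset.card_union_le _ _).trans ?_
    have h1 := Finset.card_union_le {(p.2.1, p.2.2.1)} ((D p.2.1 p.1).biUnion
      (fun b' => (colorNbrs G col b' (col s(p.2.1, p.2.2.1))).image fun c' => (b', c')))
    rw [Finset.card_singleton] at h1
    have h2 := Finset.card_biUnion_le_card_mul (D p.2.1 p.1)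
      (fun b' => (colorNbrs G col b' (col s(p.2.1, p.2.2.1))).image fun c' => (b', c')) 1
      fun b' _ => Finset.card_image_le.trans (card_colorNbrs_le hp _ _)
    have h3 := Finset.card_biUnion_le_card_mul (D p.2.2.1 p.2.2.2)
      (fun c' => (colorNbrs G col c' (col s(p.2.1, p.2.2.1))).image fun b' => (b', c')) 1
      fun b' _ => Finset.card_image_le.trans (card_colorNbrs_le hp _ _)
    have h4 := hM.card_end p.2.1 p.1
    have h5 := hM.card_end p.2.2.1 p.2.2.2
    omega
  -- For any other parallel, `a` is thin between `b, b'` and `d` is thin between `c, c'`. Then `q =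
  -- (b, a, b', c')` is itself a thin path, and it gives back `c` by the colour of `b'c'` and `d` up
  -- to `k` choices. So these pairs are charged to `q`.
  let W : V × V × V × V → Finset ((V × V × V × V) × (V × V)) := fun q =>
    (colorNbrs G col q.1 (col s(q.2.2.1, q.2.2.2))).biUnion fun c =>
      (M c q.2.2.2).image fun d => ((q.2.1, q.1, c, d), (q.2.2.1, q.2.2.2))
  have hW : ∀ q, (W q).card ≤ k := by
    intro q
    refine (Finset.card_biUnion_le_card_mul _ _ k fun c _ =>
      Finset.card_image_le.trans (hM.card_mid _ _)).trans ?_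
    have := card_colorNbrs_le hp q.1 (col s(q.2.2.1, q.2.2.2))
    nlinarith
  have hsub : ((thinPaths G M).sigma fun p =>
      parallels G M col p.1 p.2.2.2 (col s(p.2.1, p.2.2.1))).image (fun x => (x.1, x.2)) ⊆
      ((thinPaths G M).biUnion fun p => (Z p).image fun e => (p, e)) ∪
        (thinPaths G M).biUnion W := by
    intro x hx
    obtain ⟨⟨⟨a, b, c, d⟩, b', c'⟩, hy, rfl⟩ := Finset.mem_image.1 hx
    rw [Finset.mem_sigma] at hy
    obtain ⟨hP, hQ⟩ := hy
    have hP0 := hP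
    rw [mem_thinPaths] at hP
    rw [mem_parallels] at hQ
    simp only at hP hQ
    obtain ⟨hQ1, hQ2⟩ := hQ
    rw [Finset.mem_union]
    by_cases hz : (b', c') ∈ Z (a, b, c, d)
    · left
      exact Finset.mem_biUnion.2 ⟨_, hP0, Finset.mem_image_of_mem _ hz⟩
    · right
      simp only [Z, Finset.mem_union, Finset.mem_singleton, Finset.mem_biUnion, Finset.mem_image,
        not_or, Prod.mk.injEq, not_and, not_exists] at hz
      obtain ⟨⟨hz1, hz2⟩, hz3⟩ := hz
      obtain ⟨hab, hbc, hcd, hac, hbd, hb, hc⟩ := hP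
      obtain ⟨hab', hbc', hcd', hac', hbd', hb', hc'⟩ := hQ1
      have hbb : b ≠ b' := by
        rintro rfl
        exact hz1 rfl (hp _ _ _ hbc' hbc hQ2)
      have hcc : c ≠ c' := by
        rintro rfl
        refine hz1 (hp _ _ _ hbc'.symm hbc.symm ?_) rfl
        rw [Sym2.eq_swap, hQ2, Sym2.eq_swap]
      have h1 : a ∈ M b b' := by
        rcases hM.cover b a b' hab.symm hab' hbb with h | ⟨h, -⟩
        · exact h
        · exact absurd rfl (hz2 b' h c' (mem_colorNbrs.2 ⟨hbc', hQ2⟩) rfl)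
      have h2 : d ∈ M c c' := by
        rcases hM.cover c d c' hcd hcd'.symm hcc with h | ⟨h, -⟩
        · exact h
        · refine absurd rfl (hz3 c' h b' (mem_colorNbrs.2 ⟨hbc'.symm, ?_⟩) rfl)
          rw [Sym2.eq_swap, hQ2]
      refine Finset.mem_biUnion.2 ⟨(b, a, b', c'), mem_thinPaths.2
        ⟨hab.symm, hab', hbc', hbb, hac', h1, hb'⟩, ?_⟩
      exact Finset.mem_biUnion.2 ⟨c, mem_colorNbrs.2 ⟨hbc, hQ2.symm⟩,
        Finset.mem_image.2 ⟨d, h2, rfl⟩⟩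
  rw [← Finset.card_sigma, ← Finset.card_image_of_injective (f := fun x :
    (_ : V × V × V × V) × (V × V) => (x.1, x.2))]
  · refine (Finset.card_le_card hsub).trans ((Finset.card_union_le _ _).trans ?_)
    have h1 := Finset.card_biUnion_le_card_mul (thinPaths G M)
      (fun p => (Z p).image fun e => (p, e)) (2 * k + 1)
      fun p _ => Finset.card_image_le.trans (hZ p)
    have h2 := Finset.card_biUnion_le_card_mul (thinPaths G M) W k fun q _ => hW q
    nlinarith
  · rintro ⟨a, b⟩ ⟨c, d⟩ h
    simpa using h

/-- Thin paths with few parallels of the same inner colour, and with end edges of different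
colours. -/
def GoodPath (G : SimpleGraph V) (M : V → V → Finset V) (col : Sym2 V → K) (L : ℕ) (a : V)
    (e : V × V) (d : V) : Prop :=
  ThinPath G M a e.1 e.2 d ∧ (parallels G M col a d (col s(e.1, e.2))).card ≤ L ∧
    col s(a, e.1) ≠ col s(d, e.2)

open scoped Classical in
/-- At least half of the thin paths have few parallels. -/
theorem card_thinPaths_le_few {T : ℕ} (hp : Proper G col) (hM : IsCover G T k M D) :
    (thinPaths G M).card ≤ 2 * ((thinPaths G M).filter fun p =>
      (parallels G M col p.1 p.2.2.2 (col s(p.2.1, p.2.2.1))).card ≤ 2 * (3 * k + 1)).card := by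
  -- Markov's inequality: fewer than or exactly half of the paths can have more than twice the
  -- average bound.
  have h1 := sum_card_parallels_le hp hM
  have h2 := Finset.card_filter_add_card_filter_not (s := thinPaths G M) (fun p =>
    (parallels G M col p.1 p.2.2.2 (col s(p.2.1, p.2.2.1))).card ≤ 2 * (3 * k + 1))
  have h3 : ((thinPaths G M).filter fun p =>
      ¬ (parallels G M col p.1 p.2.2.2 (col s(p.2.1, p.2.2.1))).card ≤ 2 * (3 * k + 1)).card *
        (2 * (3 * k + 1)) ≤
      ∑ p ∈ thinPaths G M, (parallels G M col p.1 p.2.2.2 (col s(p.2.1, p.2.2.1))).card := by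
    rw [← smul_eq_mul]
    refine (Finset.card_nsmul_le_sum _ _ _ fun p hp => ?_).trans
      (Finset.sum_le_sum_of_subset (Finset.filter_subset _ _))
    exact (not_le.1 (Finset.mem_filter.1 hp).2).le
  have h4 := h3.trans h1
  have h5 : 2 * ((thinPaths G M).filter fun p =>
      ¬ (parallels G M col p.1 p.2.2.2 (col s(p.2.1, p.2.2.1))).card ≤ 2 * (3 * k + 1)).card ≤
      (thinPaths G M).card := by
    refine le_of_mul_le_mul_left (a := 3 * k + 1) ?_ (Nat.succ_pos _)
    calc _ = _ := by ring
      _ ≤ _ := h4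
  omega

/-- Among many good paths from `a` to `d` one is new in vertices and colours. -/
theorem exists_fresh_pair {T L : ℕ} (hp : Proper G col) (hM : IsCover G T k M D) {a d : V}
    {O : Finset (V × V)} (hO : ∀ e ∈ O, GoodPath G M col L a e d) {X : Finset V} {Y : List K}
    (hcard : 2 * (k * X.card) + L * Y.length + 2 * (k * Y.length) < O.card) :
    ∃ e ∈ O, e.1 ∉ X ∧ e.2 ∉ X ∧ col s(e.1, e.2) ∉ Y ∧ col s(a, e.1) ∉ Y ∧ col s(d, e.2) ∉ Y := by
  classical
  by_contra hcon
  push Not at hcon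
  have hY := List.toFinset_card_le Y
  have fib1 : ∀ b, (O.filter fun e => e.1 = b).card ≤ k := by
    intro b
    refine le_trans ?_ (hM.card_mid b d)
    refine Finset.card_le_card_of_injOn Prod.snd ?_ ?_
    · intro e he
      obtain ⟨he1, rfl⟩ := Finset.mem_filter.1 he
      exact (hO e he1).1.2.2.2.2.2.2
    · intro e he e' he' h
      exact Prod.ext ((Finset.mem_filter.1 he).2.trans (Finset.mem_filter.1 he').2.symm) h
  have fib2 : ∀ c, (O.filter fun e => e.2 = c).card ≤ k := by
    intro c
    refine le_trans ?_ (hM.card_mid a c)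
    refine Finset.card_le_card_of_injOn Prod.fst ?_ ?_
    · intro e he
      obtain ⟨he1, rfl⟩ := Finset.mem_filter.1 he
      exact (hO e he1).1.2.2.2.2.2.1
    · intro e he e' he' h
      exact Prod.ext h ((Finset.mem_filter.1 he).2.trans (Finset.mem_filter.1 he').2.symm)
  have c1 : (O.filter fun e => e.1 ∈ X).card ≤ k * X.card := by
    refine Finset.card_le_mul_card_image_of_maps_to (f := Prod.fst)
      (fun e he => (Finset.mem_filter.1 he).2) k fun b _ => ?_
    exact (Finset.card_le_card (Finset.filter_subset_filter _ (Finset.filter_subset _ _))).trans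
      (fib1 b)
  have c2 : (O.filter fun e => e.2 ∈ X).card ≤ k * X.card := by
    refine Finset.card_le_mul_card_image_of_maps_to (f := Prod.snd)
      (fun e he => (Finset.mem_filter.1 he).2) k fun b _ => ?_
    exact (Finset.card_le_card (Finset.filter_subset_filter _ (Finset.filter_subset _ _))).trans
      (fib2 b)
  -- Properness does not limit how many of the disjoint edges `bc` share a colour; this is where the
  -- bound `L` on parallels is needed.
  have c3 : (O.filter fun e => col s(e.1, e.2) ∈ Y).card ≤ L * Y.toFinset.card := by
    refine Finset.card_le_mul_card_image_of_maps_to (f := fun e : V × V => col s(e.1, e.2))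
      (fun e he => List.mem_toFinset.2 (Finset.mem_filter.1 he).2) L fun y _ => ?_
    rcases Finset.eq_empty_or_nonempty ((O.filter fun e => col s(e.1, e.2) ∈ Y).filter
      fun e => col s(e.1, e.2) = y) with h | ⟨e, he⟩
    · rw [h]; simp
    · simp only [Finset.mem_filter] at he
      refine le_trans (Finset.card_le_card ?_) (hO e he.1.1).2.1
      intro e' he'
      simp only [Finset.mem_filter] at he'
      exact mem_parallels.2 ⟨(hO e' he'.1.1).1, he'.2.trans he.2.symm⟩
  have c4 : (O.filter fun e => col s(a, e.1) ∈ Y).card ≤ k * Y.toFinset.card := by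
    refine Finset.card_le_mul_card_image_of_maps_to (f := fun e : V × V => col s(a, e.1))
      (fun e he => List.mem_toFinset.2 (Finset.mem_filter.1 he).2) k fun y _ => ?_
    rcases Finset.eq_empty_or_nonempty ((O.filter fun e => col s(a, e.1) ∈ Y).filter
      fun e => col s(a, e.1) = y) with h | ⟨e, he⟩
    · rw [h]; simp
    · simp only [Finset.mem_filter] at he
      refine le_trans (Finset.card_le_card ?_) (fib1 e.1)
      intro e' he'
      simp only [Finset.mem_filter] at he' ⊢
      exact ⟨he'.1.1, hp _ _ _ (hO e' he'.1.1).1.1 (hO e he.1.1).1.1 (he'.2.trans he.2.symm)⟩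
  have c5 : (O.filter fun e => col s(d, e.2) ∈ Y).card ≤ k * Y.toFinset.card := by
    refine Finset.card_le_mul_card_image_of_maps_to (f := fun e : V × V => col s(d, e.2))
      (fun e he => List.mem_toFinset.2 (Finset.mem_filter.1 he).2) k fun y _ => ?_
    rcases Finset.eq_empty_or_nonempty ((O.filter fun e => col s(d, e.2) ∈ Y).filter
      fun e => col s(d, e.2) = y) with h | ⟨e, he⟩
    · rw [h]; simp
    · simp only [Finset.mem_filter] at he
      refine le_trans (Finset.card_le_card ?_) (fib2 e.2)
      intro e' he'
      simp only [Finset.mem_filter] at he' ⊢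
      exact ⟨he'.1.1, hp _ _ _ (hO e' he'.1.1).1.2.2.1.symm (hO e he.1.1).1.2.2.1.symm
        (he'.2.trans he.2.symm)⟩
  have hsub : O ⊆ (O.filter fun e => e.1 ∈ X) ∪ ((O.filter fun e => e.2 ∈ X) ∪
      ((O.filter fun e => col s(e.1, e.2) ∈ Y) ∪ ((O.filter fun e => col s(a, e.1) ∈ Y) ∪
        (O.filter fun e => col s(d, e.2) ∈ Y)))) := by
    intro e he
    simp only [Finset.mem_union, Finset.mem_filter, he, true_and]
    have := hcon e he
    tauto
  have h0 := Finset.card_le_card hsub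
  have h1 := Finset.card_union_le (O.filter fun e => e.1 ∈ X) ((O.filter fun e => e.2 ∈ X) ∪
      ((O.filter fun e => col s(e.1, e.2) ∈ Y) ∪ ((O.filter fun e => col s(a, e.1) ∈ Y) ∪
        (O.filter fun e => col s(d, e.2) ∈ Y))))
  have h2 := Finset.card_union_le (O.filter fun e => e.2 ∈ X)
      ((O.filter fun e => col s(e.1, e.2) ∈ Y) ∪ ((O.filter fun e => col s(a, e.1) ∈ Y) ∪
        (O.filter fun e => col s(d, e.2) ∈ Y)))
  have h3 := Finset.card_union_le (O.filter fun e => col s(e.1, e.2) ∈ Y)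
    ((O.filter fun e => col s(a, e.1) ∈ Y) ∪ (O.filter fun e => col s(d, e.2) ∈ Y))
  have h4 := Finset.card_union_le (O.filter fun e => col s(a, e.1) ∈ Y)
    (O.filter fun e => col s(d, e.2) ∈ Y)
  have e1 := Nat.mul_le_mul_left L hY
  have e2 := Nat.mul_le_mul_left k hY
  omega

/-- One step along good paths from a fixed vertex `a`. -/
theorem RPath.goodPath_step {T L C j : ℕ} (hp : Proper G col) (hM : IsCover G T k M D)
    {a h b₀ d₀ : V} {l : List V} (hl : RPath G col (h :: l))
    (hlast : (h :: l).getLast? = some a) (hlev : lev (GoodPath G M col L a) C (j + 2) (b₀, h) d₀)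
    (hC : (4 * k + L + 3) * (l.length + 2) < C) :
    ∃ b c d, lev (GoodPath G M col L a) C j (b, c) d ∧ RPath G col (b :: c :: d :: h :: l) ∧
      G.Adj a b ∧ col s(a, b) ∉ pathColors col (b :: c :: d :: h :: l) := by
  classical
  -- One round provides many `d` for the pair `(b₀, h)`, the other many pairs `(b, c)` for the
  -- chosen `d`.
  obtain ⟨-, -, h1⟩ := hlev
  have hlen := pathColors_length_le col (h :: l)
  have hcard := List.toFinset_card_le (h :: l)
  simp only [List.length_cons] at hlen hcard
  have hOadj : ∀ v ∈ Finset.univ.filter fun d => lev (GoodPath G M col L a) C (j + 1) (b₀, h) d,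
      G.Adj h v := by
    intro v hv
    exact (lev_rel (Finset.mem_filter.1 hv).2).1.2.2.1
  obtain ⟨d, hd, hdX, hdY, -⟩ := exists_fresh hp (X := (h :: l).toFinset)
    (Y := pathColors col (h :: l)) hOadj hOadj (by nlinarith)
  have hP1 : RPath G col (d :: h :: l) :=
    rpath_cons hl (hOadj d hd) (by simpa using hdX) hdY
  have hcard' := List.toFinset_card_le (d :: h :: l)
  simp only [List.length_cons] at hcard'
  have hlen' : (pathColors col (d :: h :: l)).length ≤ l.length + 2 := by
    change (pathColors col (h :: l)).length + 1 ≤ _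
    omega
  have hb2 : C ≤ (Finset.univ.filter fun e => lev (GoodPath G M col L a) C j e d).card :=
    (Finset.mem_filter.1 hd).2.2.1
  obtain ⟨⟨b, c⟩, he, hbX, hcX, hbcY, habY, hdcY⟩ := exists_fresh_pair (L := L)
    (X := (d :: h :: l).toFinset) (Y := pathColors col (d :: h :: l)) hp hM
    (fun e he => lev_rel (Finset.mem_filter.1 he).2) (by
      have e1 := Nat.mul_le_mul_left k hcard'
      have e2 := Nat.mul_le_mul_left k hlen'
      have e3 := Nat.mul_le_mul_left L hlen'
      nlinarith)
  have hlevj := (Finset.mem_filter.1 he).2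
  obtain ⟨hab, hbc, hcd, hac, hbd, -, -⟩ := (lev_rel hlevj).1
  simp only [List.mem_toFinset] at hbX hcX
  simp only at hab hbc hcd hac hbd hbcY habY hdcY
  have ha : a ∈ d :: h :: l := List.mem_cons_of_mem _ (List.mem_of_getLast? hlast)
  have hP2 : RPath G col (c :: d :: h :: l) := rpath_cons hP1 hcd.symm hcX hdcY
  have hP3 : RPath G col (b :: c :: d :: h :: l) := by
    refine rpath_cons hP2 hbc.symm ?_ ?_
    · rw [List.mem_cons, not_or]
      exact ⟨hbc.ne, hbX⟩
    · change _ ∉ col s(c, d) :: pathColors col (d :: h :: l)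
      rw [List.mem_cons, not_or]
      refine ⟨fun h => hbd (hp _ _ _ hbc.symm hcd h), ?_⟩
      rw [Sym2.eq_swap]
      exact hbcY
  refine ⟨b, c, d, hlevj, hP3, hab, ?_⟩
  change _ ∉ col s(b, c) :: col s(c, d) :: pathColors col (d :: h :: l)
  simp only [List.mem_cons, not_or]
  refine ⟨fun h => hac ?_, ?_, habY⟩
  · rw [Sym2.eq_swap] at h
    exact hp _ _ _ hab.symm hbc h
  -- The edges `ab` and `cd` are disjoint, so properness says nothing; their colours differ by the
  -- last condition in `GoodPath`.
  · have := (lev_rel hlevj).2.2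
    rwa [Sym2.eq_swap (a := c)]

/-- A good path surviving many rounds of deletion yields a rainbow cycle. -/
theorem RPath.goodPath_not_rainbowFree {T L C : ℕ} (hp : Proper G col) (hM : IsCover G T k M D)
    {a : V} (r : ℕ) : ∀ {h b₀ d₀ : V} {l : List V}, RPath G col (h :: l) →
    (h :: l).getLast? = some a → lev (GoodPath G M col L a) C (2 * (r + 1)) (b₀, h) d₀ →
    (4 * k + L + 3) * (l.length + 2 * (r + 1)) < C →
    ¬ RainbowFree G col (l.length + 1 + 2 * (r + 1) + 1) := by
  induction r with
  | zero =>
    intro h b₀ d₀ l hl hlast hlev hC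
    obtain ⟨b, c, d, -, h2, h3, h4⟩ := hl.goodPath_step hp hM hlast hlev hC
    refine h2.not_rainbowFree (d := a) (by simp only [List.length_cons]) (by omega) ?_ h3 h4
    rw [List.getLast?_cons_cons, List.getLast?_cons_cons, List.getLast?_cons_cons]
    exact hlast
  | succ r ih =>
    intro h b₀ d₀ l hl hlast hlev hC
    obtain ⟨b, c, d, h1, h2, -, -⟩ := hl.goodPath_step hp hM hlast (j := 2 * (r + 1)) hlev
      (lt_of_le_of_lt (Nat.mul_le_mul_left _ (by omega)) hC)
    -- The path goes on from `c`; the vertex `b` is kept only in the last step, where it closes the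
    -- cycle at `a`.
    have := ih (l := d :: h :: l) h2.2.2.2 (by
      rw [List.getLast?_cons_cons, List.getLast?_cons_cons]
      exact hlast) h1
      (lt_of_le_of_lt (Nat.mul_le_mul_left _ (by simp only [List.length_cons]; omega)) hC)
    convert! this using 2
    simp only [List.length_cons]
    omega

end ThreePaths

/-- In a graph without rainbow cycles of a given even length at least six there are at most
quadratically many thin paths. -/
theorem card_thinPaths_le (r k : ℕ) : ∃ k' : ℕ, ∀ {V K : Type} [Fintype V] {G : SimpleGraph V}
    {col : Sym2 V → K} {M D : V → V → Finset V} {T : ℕ}, Proper G col →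
    RainbowFree G col (2 * (r + 3)) → IsCover G T k M D →
    (thinPaths G M).card ≤ k' * Fintype.card V ^ 2 := by
  classical
  set L := 2 * (3 * k + 1) with hL
  set C := (4 * k + L + 3) * (2 + 2 * (r + 1)) + 1 with hC
  set m := 2 * (r + 1) with hm
  -- The summands bound the paths for which the pair `(b, c)` is deleted (determined by `a, d`),
  -- those for which `d` is deleted (fix `a, c`, then `b` has `k` choices), and those with end edges
  -- of equal colour (fix `a, c`, then `b`, then `d` by its colour). The factor 2 restores the paths
  -- with many parallels.
  refine ⟨2 * (m * C + k * (m * C) + k), fun {V K} _ {G col M D T} hp hfree hM => ?_⟩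
  have hno : ∀ a e d, ¬ lev (GoodPath G M col L a) C m e d := by
    rintro a ⟨b, c⟩ d hlev
    obtain ⟨⟨hab, hbc, hcd, hac, hbd, -, -⟩, -, -⟩ := lev_rel hlev
    have := RPath.goodPath_not_rainbowFree (G := G) (col := col) hp hM r (h := c) (l := [b, a])
      ⟨hbc.symm, by simp [hbc.ne', hac.symm], by
        simp only [pathColors, List.mem_cons, List.not_mem_nil, or_false]
        intro h
        rw [Sym2.eq_swap] at h
        exact hac (hp _ _ _ hbc hab.symm h).symm, hab.symm, by simpa using hab.ne',
        by simp [pathColors], trivial⟩ (by simp) hlev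
      (Nat.lt_succ_of_le (Nat.mul_le_mul_left _
        (by simp only [List.length_cons, List.length_nil]; omega)))
    refine this ?_
    rwa [show [b, a].length + 1 + 2 * (r + 1) + 1 = 2 * (r + 3) by
      simp only [List.length_cons, List.length_nil]; omega]
  set n := Fintype.card V with hn
  have huniv : (Finset.univ : Finset (V × V)).card = n ^ 2 := by
    rw [Finset.card_univ, Fintype.card_prod, sq]
  set N := thinPaths G M with hN
  have c1 : (N.filter fun p => (p.2.1, p.2.2.1) ∈
      levLeft (GoodPath G M col L p.1) C m p.2.2.2).card ≤ (m * C) * n ^ 2 := by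
    rw [← huniv]
    refine Finset.card_le_mul_card_image_of_maps_to (f := fun p : V × V × V × V => (p.1, p.2.2.2))
      (fun _ _ => Finset.mem_univ _) _ ?_
    rintro ⟨a, d⟩ -
    refine le_trans ?_ (card_levLeft_le (R := GoodPath G M col L a) (C := C) m d)
    refine Finset.card_le_card_of_injOn (fun p => (p.2.1, p.2.2.1)) ?_ ?_
    · rintro ⟨a', b, c, d'⟩ h
      simp only [Finset.coe_filter, Set.mem_ofPred_eq, Finset.mem_filter, Prod.mk.injEq] at h
      obtain ⟨⟨-, h⟩, rfl, rfl⟩ := h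
      exact h
    · rintro ⟨a', b, c, d'⟩ h ⟨a'', b', c', d''⟩ h' heq
      simp only [Finset.coe_filter, Set.mem_ofPred_eq, Prod.mk.injEq] at h h' heq
      simp [h.2.1, h.2.2, h'.2.1, h'.2.2, heq.1, heq.2]
  have c2 : (N.filter fun p => p.2.2.2 ∈
      levRight (GoodPath G M col L p.1) C m (p.2.1, p.2.2.1)).card ≤ (k * (m * C)) * n ^ 2 := by
    rw [← huniv]
    refine Finset.card_le_mul_card_image_of_maps_to (f := fun p : V × V × V × V => (p.1, p.2.2.1))
      (fun _ _ => Finset.mem_univ _) _ ?_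
    rintro ⟨a, c⟩ -
    refine le_trans (Finset.card_le_card (t := (M a c).biUnion fun b =>
      (levRight (GoodPath G M col L a) C m (b, c)).image fun d => (a, b, c, d)) ?_) ?_
    · rintro ⟨a', b, c', d⟩ h
      simp only [Finset.mem_filter, Prod.mk.injEq] at h
      obtain ⟨⟨h1, h2⟩, rfl, rfl⟩ := h
      exact Finset.mem_biUnion.2 ⟨b, (mem_thinPaths.1 h1).2.2.2.2.2.1,
        Finset.mem_image_of_mem _ h2⟩
    · refine (Finset.card_biUnion_le_card_mul _ _ (m * C) fun b _ =>
        Finset.card_image_le.trans (card_levRight_le _ _)).trans ?_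
      exact Nat.mul_le_mul_right _ (hM.card_mid _ _)
  have c3 : (N.filter fun p => col s(p.1, p.2.1) = col s(p.2.2.2, p.2.2.1)).card ≤
      k * n ^ 2 := by
    rw [← huniv]
    refine Finset.card_le_mul_card_image_of_maps_to (f := fun p : V × V × V × V => (p.1, p.2.2.1))
      (fun _ _ => Finset.mem_univ _) _ ?_
    rintro ⟨a, c⟩ -
    refine le_trans ?_ (hM.card_mid a c)
    refine Finset.card_le_card_of_injOn (fun p => p.2.1) ?_ ?_
    · rintro ⟨a', b, c', d⟩ h
      simp only [Finset.coe_filter, Set.mem_ofPred_eq, Finset.mem_filter, Prod.mk.injEq] at h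
      obtain ⟨⟨h1, -⟩, rfl, rfl⟩ := h
      exact (mem_thinPaths.1 h1).2.2.2.2.2.1
    · rintro ⟨a', b, c', d⟩ h ⟨a'', b', c'', d'⟩ h' heq
      simp only [Finset.coe_filter, Set.mem_ofPred_eq, Finset.mem_filter, Prod.mk.injEq] at h h' heq
      obtain ⟨⟨h1, h2⟩, rfl, rfl⟩ := h
      obtain ⟨⟨h1', h2'⟩, rfl, rfl⟩ := h'
      subst heq
      have e1 := (mem_thinPaths.1 h1).2.2.1
      have e2 := (mem_thinPaths.1 h1').2.2.1
      simp only at e1 e2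
      have := hp _ _ _ e1 e2 (by rw [Sym2.eq_swap, ← h2, h2', Sym2.eq_swap])
      rw [this]
  have hsub : (N.filter fun p =>
      (parallels G M col p.1 p.2.2.2 (col s(p.2.1, p.2.2.1))).card ≤ L) ⊆
      (N.filter fun p => (p.2.1, p.2.2.1) ∈ levLeft (GoodPath G M col L p.1) C m p.2.2.2) ∪
      ((N.filter fun p => p.2.2.2 ∈ levRight (GoodPath G M col L p.1) C m (p.2.1, p.2.2.1)) ∪
      (N.filter fun p => col s(p.1, p.2.1) = col s(p.2.2.2, p.2.2.1))) := by
    intro p hp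
    simp only [Finset.mem_filter, Finset.mem_union] at hp ⊢
    by_cases hc : col s(p.1, p.2.1) = col s(p.2.2.2, p.2.2.1)
    · exact Or.inr (Or.inr ⟨hp.1, hc⟩)
    · rcases lev_or_mem (C := C) m (R := GoodPath G M col L p.1) (a := (p.2.1, p.2.2.1))
        (b := p.2.2.2) ⟨mem_thinPaths.1 hp.1, hp.2, hc⟩ with h | h | h
      · exact absurd h (hno _ _ _)
      · exact Or.inl ⟨hp.1, h⟩
      · exact Or.inr (Or.inl ⟨hp.1, h⟩)
  have h1 := card_thinPaths_le_few hp hM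
  have h2 := (Finset.card_le_card hsub).trans ((Finset.card_union_le _ _).trans
    (Nat.add_le_add_left (Finset.card_union_le _ _) _))
  calc N.card ≤ 2 * ((m * C) * n ^ 2 + (k * (m * C) * n ^ 2 + k * n ^ 2)) :=
        h1.trans (Nat.mul_le_mul_left 2 (h2.trans (by gcongr)))
    _ = _ := by ring

/-! ### Counting restrictions of functions to sets of positions -/

section Projections

variable {ι V : Type*}

open scoped Classical in
/-- The number of restrictions to `J` of functions in `S`. -/
noncomputable def proj (S : Finset (ι → V)) (J : Finset ι) : ℕ :=
  (S.image fun f i => if i ∈ J then some (f i) else none).card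

theorem proj_le_card_image {β : Type*} [DecidableEq β] {S : Finset (ι → V)} {J : Finset ι}
    (h : (ι → V) → β) (hh : ∀ f ∈ S, ∀ g ∈ S, h f = h g → ∀ i ∈ J, f i = g i) :
    proj S J ≤ (S.image h).card := by
  classical
  refine Finset.card_le_card_of_forall_subsingleton
    (fun g y => ∃ f ∈ S, (fun i => if i ∈ J then some (f i) else none) = g ∧ h f = y) ?_ ?_
  · intro g hg
    obtain ⟨f, hf, rfl⟩ := Finset.mem_image.1 hg
    exact ⟨h f, Finset.mem_image_of_mem _ hf, f, hf, rfl, rfl⟩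
  · rintro y - g ⟨-, f, hf, rfl, hy⟩ g' ⟨-, f', hf', rfl, hy'⟩
    funext i
    by_cases hi : i ∈ J
    · simp only [hi, if_true]
      rw [hh f hf f' hf' (hy.trans hy'.symm) i hi]
    · simp [hi]

theorem proj_mono {S : Finset (ι → V)} {J J' : Finset ι} (h : J ⊆ J') : proj S J ≤ proj S J' := by
  classical
  refine proj_le_card_image _ fun f _ g _ he i hi => ?_
  have := congrFun he i
  simpa [h hi] using this

theorem proj_empty_le (S : Finset (ι → V)) : proj S ∅ ≤ 1 := by
  classical
  refine (proj_le_card_image (fun _ => ()) fun _ _ _ _ _ i hi => ?_).trans ?_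
  · simp at hi
  · exact Finset.card_le_one.2 fun _ _ _ _ => rfl

theorem card_le_proj {S : Finset (ι → V)} {J : Finset ι} (hJ : ∀ i, i ∈ J) :
    S.card ≤ proj S J := by
  classical
  rw [proj, Finset.card_image_of_injective]
  intro f g h
  funext i
  have := congrFun h i
  simpa [hJ i] using this

/-- If the value at `j` is determined, up to `k` choices, by the values on `J`, then adding `j` to
`J` multiplies the number of restrictions by at most `k`. -/
theorem proj_insert_le [DecidableEq ι] {S : Finset (ι → V)} {J : Finset ι} {j : ι} {k : ℕ}
    (Φ : (ι → V) → Finset V) (hΦ : ∀ f g, (∀ i ∈ J, f i = g i) → Φ f = Φ g)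
    (hk : ∀ f, (Φ f).card ≤ k) (hS : ∀ f ∈ S, f j ∈ Φ f) :
    proj S (insert j J) ≤ k * proj S J := by
  classical
  refine Finset.card_le_mul_card_image_of_maps_to
    (f := fun (g : ι → Option V) i => if i ∈ J then g i else none) ?_ k ?_
  · intro g hg
    obtain ⟨f, hf, rfl⟩ := Finset.mem_image.1 hg
    refine Finset.mem_image.2 ⟨f, hf, ?_⟩
    funext i
    by_cases hi : i ∈ J <;> simp [hi]
  · intro y hy
    obtain ⟨f₀, hf₀, rfl⟩ := Finset.mem_image.1 hy
    refine le_trans ?_ (hk f₀)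
    rw [← Finset.card_image_of_injective (Φ f₀) (Option.some_injective V)]
    refine Finset.card_le_card_of_injOn (fun g => g j) ?_ ?_
    · intro g hg
      simp only [Finset.coe_filter, Set.mem_ofPred_eq] at hg
      obtain ⟨hg1, hg2⟩ := hg
      obtain ⟨f, hf, rfl⟩ := Finset.mem_image.1 hg1
      have : ∀ i ∈ J, f i = f₀ i := fun i hi => by
        have := congrFun hg2 i
        simpa [hi] using this
      simp only [Finset.mem_insert, true_or, if_true]
      refine Finset.mem_coe.2 (Finset.mem_image_of_mem _ ?_)
      rw [hΦ f₀ f fun i hi => (this i hi).symm]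
      exact hS f hf
    · intro g hg g' hg' h
      simp only [Finset.coe_filter, Set.mem_ofPred_eq] at hg hg'
      obtain ⟨hg1, hg2⟩ := hg
      obtain ⟨hg1', hg2'⟩ := hg'
      obtain ⟨f, hf, rfl⟩ := Finset.mem_image.1 hg1
      obtain ⟨f', hf', rfl⟩ := Finset.mem_image.1 hg1'
      have h1 : ∀ i ∈ J, f i = f₀ i := fun i hi => by
        have := congrFun hg2 i
        simpa [hi] using this
      have h2 : ∀ i ∈ J, f' i = f₀ i := fun i hi => by
        have := congrFun hg2' i
        simpa [hi] using this
      simp only [Finset.mem_insert, true_or, if_true] at h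
      funext i
      by_cases hi : i ∈ J
      · simp [hi, h1 i hi, h2 i hi]
      · by_cases hij : i = j
        · subst hij
          simpa using h
        · simp [hi, hij]

theorem proj_insert_le_card_mul [Fintype V] [DecidableEq ι] (S : Finset (ι → V)) (J : Finset ι) (j : ι) :
    proj S (insert j J) ≤ Fintype.card V * proj S J :=
  proj_insert_le (fun _ => Finset.univ) (fun _ _ _ => rfl) (fun _ => le_rfl)
    fun _ _ => Finset.mem_univ _

theorem proj_pair_le [Fintype V] [DecidableEq ι] (S : Finset (ι → V)) (i j : ι) :
    proj S {i, j} ≤ Fintype.card V ^ 2 := by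
  have h1 := proj_insert_le_card_mul S {j} i
  have h2 := proj_insert_le_card_mul S ∅ j
  have h3 := proj_empty_le S
  rw [insert_empty_eq] at h2
  calc _ ≤ Fintype.card V * (Fintype.card V * 1) :=
        h1.trans (Nat.mul_le_mul_left _ (h2.trans (Nat.mul_le_mul_left _ h3)))
    _ = _ := by ring

end Projections

/-! ### Blocks of consecutive positions on a cycle -/

section Blocks

variable {s : ℕ}

/-- The positions `a, a + 1, …, a + m - 1`. -/
def blk (a : ZMod s) (m : ℕ) : Finset (ZMod s) :=
  (Finset.range m).image fun i : ℕ => a + (i : ZMod s)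

theorem mem_blk {a x : ZMod s} {m : ℕ} : x ∈ blk a m ↔ ∃ i < m, a + (i : ZMod s) = x := by
  simp [blk]

theorem blk_succ (a : ZMod s) (m : ℕ) : blk a (m + 1) = insert (a + (m : ZMod s)) (blk a m) := by
  rw [blk, Finset.range_add_one, Finset.image_insert, blk]

theorem mem_blk_self (a : ZMod s) {m i : ℕ} (h : i < m) : a + (i : ZMod s) ∈ blk a m :=
  mem_blk.2 ⟨i, h, rfl⟩

theorem mem_blk_of_val_lt [NeZero s] {a x : ZMod s} {m : ℕ} (h : (x - a).val < m) :
    x ∈ blk a m := by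
  refine mem_blk.2 ⟨_, h, ?_⟩
  rw [ZMod.natCast_zmod_val]
  ring

theorem eq_neg_of_val_add {y : ZMod s} [NeZero s] {j : ℕ} (h : y.val + j = s) :
    y = -(j : ZMod s) := by
  have h1 : ((y.val + j : ℕ) : ZMod s) = 0 := by rw [h, ZMod.natCast_self]
  push_cast at h1
  rw [ZMod.natCast_zmod_val] at h1
  exact eq_neg_of_add_eq_zero_left h1

theorem mem_blk_full [NeZero s] (a x : ZMod s) : x ∈ blk a s :=
  mem_blk_of_val_lt (ZMod.val_lt _)

theorem eq_or_mem_blk [NeZero s] {m : ℕ} (hs : s = m + 1) (a x : ZMod s) :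
    x = a ∨ x ∈ blk (a + 1) m := by
  by_cases h : (x - (a + 1)).val < m
  · exact Or.inr (mem_blk_of_val_lt h)
  · left
    have h1 := ZMod.val_lt (x - (a + 1))
    have h2 := eq_neg_of_val_add (y := x - (a + 1)) (j := 1) (by omega)
    push_cast at h2
    linear_combination h2

theorem eq_or_eq_or_mem_blk [NeZero s] {m : ℕ} (hs : s = m + 2) (a x : ZMod s) :
    x = a ∨ x = a + 1 ∨ x ∈ blk (a + 2) m := by
  by_cases h : (x - (a + 2)).val < m
  · exact Or.inr (Or.inr (mem_blk_of_val_lt h))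
  · have h1 := ZMod.val_lt (x - (a + 2))
    rcases (show (x - (a + 2)).val + 1 = s ∨ (x - (a + 2)).val + 2 = s by omega) with h2 | h2
    · have h2 := eq_neg_of_val_add h2
      push_cast at h2
      exact Or.inr (Or.inl (by linear_combination h2))
    · have h2 := eq_neg_of_val_add h2
      push_cast at h2
      exact Or.inl (by linear_combination h2)

theorem natCast_ne_zero_of_lt {j : ℕ} (h0 : 0 < j) (h : j < s) : (j : ZMod s) ≠ 0 := by
  intro he
  rw [ZMod.natCast_eq_zero_iff] at he
  exact absurd (Nat.le_of_dvd h0 he) (by omega)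

end Blocks

/-! ### Cycles with a given set of thin positions -/

section Patterns

variable {V : Type*} [Fintype V] {G : SimpleGraph V} {M D : V → V → Finset V} {T k s : ℕ}

/-- All members of `S` are `s`-cycles, thin exactly at the positions in `P`. -/
structure HasPattern (G : SimpleGraph V) (M D : V → V → Finset V) (T : ℕ)
    (S : Finset (ZMod s → V)) (P : Finset (ZMod s)) : Prop where
  cyc : ∀ f ∈ S, IsCyc G s f
  thin : ∀ f ∈ S, ∀ i ∈ P, f i ∈ M (f (i - 1)) (f (i + 1))
  right : ∀ f ∈ S, ∀ i ∉ P, f (i + 1) ∈ D (f (i - 1)) (f i)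
  left : ∀ f ∈ S, ∀ i ∉ P, f (i - 1) ∈ D (f (i + 1)) (f i)
  fat : ∀ f ∈ S, ∀ i ∉ P, T ≤ (commonNbrs G (f (i - 1)) (f (i + 1))).card

open scoped Classical in
/-- The positions where a cycle is thin. -/
noncomputable def pattern (M : V → V → Finset V) [NeZero s] (f : ZMod s → V) : Finset (ZMod s) :=
  Finset.univ.filter fun i => f i ∈ M (f (i - 1)) (f (i + 1))

theorem hasPattern_of_forall [NeZero s] (hs : 3 ≤ s) (hM : IsCover G T k M D)
    {S : Finset (ZMod s → V)} {P : Finset (ZMod s)}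
    (hS : ∀ f ∈ S, IsCyc G s f ∧ pattern M f = P) : HasPattern G M D T S P := by
  have key : ∀ f ∈ S, ∀ i ∉ P, f (i + 1) ∈ D (f (i - 1)) (f i) ∧ f (i - 1) ∈ D (f (i + 1)) (f i) ∧
      T ≤ (commonNbrs G (f (i - 1)) (f (i + 1))).card := by
    intro f hf i hi
    obtain ⟨hf1, rfl⟩ := hS f hf
    have h1 : G.Adj (f (i - 1)) (f i) := by
      have := hf1.2 (i - 1)
      rwa [sub_add_cancel] at this
    rcases hM.cover _ _ _ h1 (hf1.2 i) (fun h => by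
      have h2 := hf1.1 h
      have h3 : ((2 : ℕ) : ZMod s) = 0 := by push_cast; linear_combination -h2
      exact natCast_ne_zero_of_lt (by norm_num) (by omega) h3) with h | h
    · exact absurd (by simpa [pattern] using h) hi
    · exact h
  refine ⟨fun f hf => (hS f hf).1, fun f hf i hi => ?_, fun f hf i hi => (key f hf i hi).1,
    fun f hf i hi => (key f hf i hi).2.1, fun f hf i hi => (key f hf i hi).2.2⟩
  obtain ⟨-, rfl⟩ := hS f hf
  simpa [pattern] using hi

variable {S : Finset (ZMod s → V)} {P : Finset (ZMod s)}

theorem HasPattern.proj_thin (h : HasPattern G M D T S P) (hM : IsCover G T k M D)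
    {J : Finset (ZMod s)} {i : ZMod s} (hi : i ∈ P) (h1 : i - 1 ∈ J) (h2 : i + 1 ∈ J) :
    proj S (insert i J) ≤ k * proj S J :=
  proj_insert_le (fun f => M (f (i - 1)) (f (i + 1)))
    (fun f g hfg => by simp only [hfg _ h1, hfg _ h2]) (fun _ => hM.card_mid _ _)
    fun f hf => h.thin f hf i hi

theorem HasPattern.proj_right (h : HasPattern G M D T S P) (hM : IsCover G T k M D)
    {J : Finset (ZMod s)} {i : ZMod s} (hi : i ∉ P) (h1 : i - 1 ∈ J) (h2 : i ∈ J) :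
    proj S (insert (i + 1) J) ≤ k * proj S J :=
  proj_insert_le (fun f => D (f (i - 1)) (f i))
    (fun f g hfg => by simp only [hfg _ h1, hfg _ h2]) (fun _ => hM.card_end _ _)
    fun f hf => h.right f hf i hi

theorem HasPattern.proj_left (h : HasPattern G M D T S P) (hM : IsCover G T k M D)
    {J : Finset (ZMod s)} {i : ZMod s} (hi : i ∉ P) (h1 : i + 1 ∈ J) (h2 : i ∈ J) :
    proj S (insert (i - 1) J) ≤ k * proj S J :=
  proj_insert_le (fun f => D (f (i + 1)) (f i))
    (fun f g hfg => by simp only [hfg _ h1, hfg _ h2]) (fun _ => hM.card_end _ _)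
    fun f hf => h.left f hf i hi

/-- Two further positions after a block cost one free choice. -/
theorem HasPattern.proj_blk_add_two (h : HasPattern G M D T S P) (hM : IsCover G T k M D)
    (a : ZMod s) (m : ℕ) :
    proj S (blk a (m + 3)) ≤ k * Fintype.card V * proj S (blk a (m + 1)) := by
  set i : ZMod s := a + (m + 1 : ℕ) with hi
  have h1 : i - 1 ∈ blk a (m + 1) := by
    have := mem_blk_self a (Nat.lt_succ_self m)
    convert! this using 1
    rw [hi]; push_cast; ring
  have h2 : blk a (m + 3) = insert (i + 1) (insert i (blk a (m + 1))) := by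
    rw [blk_succ, blk_succ, hi]
    congr 1
    push_cast; ring
  rw [h2, mul_assoc]
  -- At a thin `i`, choose `i + 1` freely and then `i` between its neighbours; otherwise choose `i`
  -- freely and then `i + 1` from `D`.
  by_cases hP : i ∈ P
  · rw [Finset.insert_comm]
    refine (h.proj_thin hM hP (Finset.mem_insert_of_mem h1) (Finset.mem_insert_self _ _)).trans ?_
    exact Nat.mul_le_mul_left _ (proj_insert_le_card_mul _ _ _)
  · refine (h.proj_right hM hP (Finset.mem_insert_of_mem h1) (Finset.mem_insert_self _ _)).trans ?_
    exact Nat.mul_le_mul_left _ (proj_insert_le_card_mul _ _ _)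

theorem proj_insert_insert_pair_le {S : Finset (ZMod s → V)} {J : Finset (ZMod s)}
    {w x y z : ZMod s} (h1 : proj S (insert w (insert x {y, z})) ≤ k * proj S (insert x {y, z}))
    (h2 : proj S (insert x {y, z}) ≤ k * proj S {y, z}) (hJ : J ⊆ insert w (insert x {y, z})) :
    proj S J ≤ k ^ 2 * Fintype.card V ^ 2 := by
  calc proj S J ≤ k * (k * Fintype.card V ^ 2) :=
        (proj_mono hJ).trans (h1.trans (Nat.mul_le_mul_left _
          (h2.trans (Nat.mul_le_mul_left _ (proj_pair_le _ _ _)))))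
    _ = _ := by ring

/-- There are at most quadratically many restrictions to four consecutive positions. -/
theorem HasPattern.proj_blk_four (h : HasPattern G M D T S P) (hM : IsCover G T k M D) (hs : 3 ≤ s)
    {k' : ℕ} (hN : (thinPaths G M).card ≤ k' * Fintype.card V ^ 2) (a : ZMod s) :
    proj S (blk a 4) ≤ (k ^ 2 + k') * Fintype.card V ^ 2 := by
  classical
  have hblk : blk a 4 = {a, a + 1, a + 2, a + 3} := by
    ext x
    simp only [blk, Finset.mem_image, Finset.mem_range, Finset.mem_insert, Finset.mem_singleton]
    constructor
    · rintro ⟨i, hi, rfl⟩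
      interval_cases i <;> simp
    · rintro (rfl | rfl | rfl | rfl)
      exacts [⟨0, by simp⟩, ⟨1, by simp⟩, ⟨2, by simp⟩, ⟨3, by simp⟩]
  have e1 : a + 1 - 1 = a := by ring
  have e2 : a + 1 + 1 = a + 2 := by ring
  have e3 : a + 2 - 1 = a + 1 := by ring
  have e4 : a + 2 + 1 = a + 3 := by ring
  rw [hblk]
  -- Only if both inner positions are thin is the count of thin paths needed. In the other cases two
  -- suitable positions are free and determine the remaining two, up to `k` choices each.
  by_cases h1 : a + 1 ∈ P <;> by_cases h2 : a + 2 ∈ P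
  · have hne : ∀ f ∈ S, ∀ i, f i ≠ f (i + 2) := by
      intro f hf i he
      have h3 := (h.cyc f hf).1 he
      refine natCast_ne_zero_of_lt (s := s) (j := 2) (by norm_num) (by omega) ?_
      push_cast; linear_combination -h3
    have h3 : proj S {a, a + 1, a + 2, a + 3} ≤ (thinPaths G M).card := by
      refine (proj_le_card_image (fun f => (f a, f (a + 1), f (a + 2), f (a + 3))) ?_).trans
        (Finset.card_le_card ?_)
      · intro f _ g _ hfg i hi
        simp only [Prod.mk.injEq] at hfg
        simp only [Finset.mem_insert, Finset.mem_singleton] at hi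
        rcases hi with rfl | rfl | rfl | rfl
        exacts [hfg.1, hfg.2.1, hfg.2.2.1, hfg.2.2.2]
      · intro p hp
        obtain ⟨f, hf, rfl⟩ := Finset.mem_image.1 hp
        have hc := (h.cyc f hf).2
        have t1 := h.thin f hf _ h1
        have t2 := h.thin f hf _ h2
        rw [e1, e2] at t1
        rw [e3, e4] at t2
        refine mem_thinPaths.2 ⟨hc a, ?_, ?_, hne f hf a, ?_, t1, t2⟩
        · have := hc (a + 1); rwa [e2] at this
        · have := hc (a + 2); rwa [e4] at this
        · have := hne f hf (a + 1)
          rwa [show a + 1 + 2 = a + 3 by ring] at this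
    calc _ ≤ k' * Fintype.card V ^ 2 := h3.trans hN
      _ ≤ _ := Nat.mul_le_mul_right _ (Nat.le_add_left _ _)
  all_goals refine le_trans ?_ (Nat.mul_le_mul_right _ (Nat.le_add_right (k ^ 2) k'))
  · refine proj_insert_insert_pair_le (w := a + 3) (x := a + 1) (y := a) (z := a + 2) ?_ ?_ ?_
    · rw [← e4]
      exact h.proj_right hM h2 (by simp [e3]) (by simp)
    · exact h.proj_thin hM h1 (by simp) (by simp [e2])
    · intro x; simp; tauto
  · refine proj_insert_insert_pair_le (w := a) (x := a + 2) (y := a + 1) (z := a + 3) ?_ ?_ ?_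
    · nth_rw 1 [← e1]
      exact h.proj_left hM h1 (by simp [e2]) (by simp)
    · exact h.proj_thin hM h2 (by simp [e3]) (by simp [e4])
    · intro x; simp; tauto
  · refine proj_insert_insert_pair_le (w := a) (x := a + 3) (y := a + 1) (z := a + 2) ?_ ?_ ?_
    · nth_rw 1 [← e1]
      exact h.proj_left hM h1 (by simp [e2]) (by simp)
    · rw [← e4]
      exact h.proj_right hM h2 (by simp [e3]) (by simp)
    · intro x; simp; tauto

theorem HasPattern.proj_blk_even (h : HasPattern G M D T S P) (hM : IsCover G T k M D) (hs : 3 ≤ s)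
    {k' : ℕ} (hN : (thinPaths G M).card ≤ k' * Fintype.card V ^ 2) (a : ZMod s) (j : ℕ) :
    proj S (blk a (2 * j + 4)) ≤ (k ^ 2 + k') * k ^ j * Fintype.card V ^ (j + 2) := by
  induction j with
  | zero => simpa using h.proj_blk_four hM hs hN a
  | succ j ih =>
    calc _ ≤ k * Fintype.card V * proj S (blk a (2 * j + 4)) :=
          h.proj_blk_add_two hM a (2 * j + 3)
      _ ≤ k * Fintype.card V * ((k ^ 2 + k') * k ^ j * Fintype.card V ^ (j + 2)) :=
          Nat.mul_le_mul_left _ ih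
      _ = _ := by ring

theorem HasPattern.card_le_even (h : HasPattern G M D T S P) (hM : IsCover G T k M D)
    {k' : ℕ} (hN : (thinPaths G M).card ≤ k' * Fintype.card V ^ 2) {j : ℕ} [NeZero s]
    (hs : s = 2 * j + 4) :
    S.card ≤ (k ^ 2 + k') * k ^ j * Fintype.card V ^ (j + 2) := by
  refine (card_le_proj (J := blk 0 (2 * j + 4)) fun i => ?_).trans
    (h.proj_blk_even hM (by omega) hN 0 j)
  rw [← hs]
  exact mem_blk_full _ _

/-- Leaving out a thin position, which its neighbours determine, reduces to a block of even length
`s - 1`. If no position is thin, two consecutive vertices determine the whole cycle step by step. -/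
theorem HasPattern.card_le_odd (h : HasPattern G M D T S P) (hM : IsCover G T k M D)
    {k' : ℕ} (hN : (thinPaths G M).card ≤ k' * Fintype.card V ^ 2) {j : ℕ} [NeZero s]
    (hs : s = 2 * j + 5) :
    S.card ≤ (k * ((k ^ 2 + k') * k ^ j) + k ^ (2 * j + 3)) * Fintype.card V ^ (j + 2) := by
  by_cases hP : ∃ p, p ∈ P
  · obtain ⟨p, hp⟩ := hP
    have hcov := eq_or_mem_blk (s := s) (m := 2 * j + 4) (by omega) p
    have h2 : ((2 : ℕ) : ZMod s) ≠ 0 := natCast_ne_zero_of_lt (by norm_num) (by omega)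
    have h1 : ((1 : ℕ) : ZMod s) ≠ 0 := natCast_ne_zero_of_lt (by norm_num) (by omega)
    push_cast at h1 h2
    have m1 : p - 1 ∈ blk (p + 1) (2 * j + 4) :=
      (hcov (p - 1)).resolve_left fun h => h1 (by linear_combination -h)
    have m2 : p + 1 ∈ blk (p + 1) (2 * j + 4) :=
      (hcov (p + 1)).resolve_left fun h => h1 (by linear_combination h)
    calc S.card ≤ proj S (insert p (blk (p + 1) (2 * j + 4))) :=
          card_le_proj fun i => Finset.mem_insert.2 (hcov i)
      _ ≤ k * proj S (blk (p + 1) (2 * j + 4)) := h.proj_thin hM hp m1 m2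
      _ ≤ k * ((k ^ 2 + k') * k ^ j * Fintype.card V ^ (j + 2)) :=
          Nat.mul_le_mul_left _ (h.proj_blk_even hM (by omega) hN _ j)
      _ = k * ((k ^ 2 + k') * k ^ j) * Fintype.card V ^ (j + 2) := by ring
      _ ≤ _ := Nat.mul_le_mul_right _ (Nat.le_add_right _ _)
  · push Not at hP
    have key : ∀ m, proj S (blk 0 (m + 2)) ≤ k ^ m * Fintype.card V ^ 2 := by
      intro m
      induction m with
      | zero =>
        rw [pow_zero, one_mul]
        refine le_trans (proj_mono ?_) (proj_pair_le S 0 1)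
        intro x hx
        obtain ⟨i, hi, rfl⟩ := mem_blk.1 hx
        interval_cases i <;> simp
      | succ m ih =>
        have h3 : blk (0 : ZMod s) (m + 3) =
            insert (((m + 1 : ℕ) : ZMod s) + 1) (blk 0 (m + 2)) := by
          rw [blk_succ]
          congr 1
          push_cast; ring
        rw [h3]
        refine (h.proj_right hM (hP _) ?_ ?_).trans ?_
        · refine mem_blk.2 ⟨m, by omega, ?_⟩
          push_cast; ring
        · refine mem_blk.2 ⟨m + 1, by omega, ?_⟩
          ring
        · calc _ ≤ k * (k ^ m * Fintype.card V ^ 2) := Nat.mul_le_mul_left _ ih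
            _ = _ := by ring
    have hn : Fintype.card V ^ 2 ≤ Fintype.card V ^ (j + 2) := by
      rcases Nat.eq_zero_or_pos (Fintype.card V) with h0 | h0
      · simp [h0]
      · exact Nat.pow_le_pow_right h0 (by omega)
    calc S.card ≤ proj S (blk 0 (2 * j + 3 + 2)) :=
          card_le_proj fun i => by
            rw [show 2 * j + 3 + 2 = s by omega]
            exact mem_blk_full _ _
      _ ≤ k ^ (2 * j + 3) * Fintype.card V ^ (j + 2) := (key _).trans (Nat.mul_le_mul_left _ hn)
      _ ≤ _ := Nat.mul_le_mul_right _ (Nat.le_add_left _ _)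

end Patterns

/-! ### Upper bounds for even `t ≥ 6`, and the saving for `s = t` -/

section EvenUpper

variable {V K : Type*} [Fintype V] {G : SimpleGraph V} {col : Sym2 V → K}
  {M D : V → V → Finset V} {T k s : ℕ} {S : Finset (ZMod s → V)} {P : Finset (ZMod s)}

/-- The block of length `s - 2` from `i + 3` round to `i` determines `i + 1`, since `i` is not thin,
and then `i + 2`, since it is thin. Neither position costs a factor `n`. -/
theorem HasPattern.card_le_of_fat_of_thin (h : HasPattern G M D T S P) (hM : IsCover G T k M D)
    {k' : ℕ} (hN : (thinPaths G M).card ≤ k' * Fintype.card V ^ 2) {j : ℕ} [NeZero s]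
    (hs : s = 2 * j + 6) {i : ZMod s} (hi : i ∉ P) (hi2 : i + 2 ∈ P) :
    S.card ≤ k ^ 2 * ((k ^ 2 + k') * k ^ j) * Fintype.card V ^ (j + 2) := by
  have hcov := eq_or_eq_or_mem_blk (s := s) (m := 2 * j + 4) (by omega) (i + 1)
  have h1 : ((1 : ℕ) : ZMod s) ≠ 0 := natCast_ne_zero_of_lt (by norm_num) (by omega)
  have h2 : ((2 : ℕ) : ZMod s) ≠ 0 := natCast_ne_zero_of_lt (by norm_num) (by omega)
  have h3 : ((3 : ℕ) : ZMod s) ≠ 0 := natCast_ne_zero_of_lt (by norm_num) (by omega)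
  push_cast at h1 h2 h3
  have m1 : i - 1 ∈ blk (i + 1 + 2) (2 * j + 4) := by
    rcases hcov (i - 1) with h | h | h
    · exact absurd (by linear_combination -h) h2
    · exact absurd (by linear_combination -h) h3
    · exact h
  have m2 : i ∈ blk (i + 1 + 2) (2 * j + 4) := by
    rcases hcov i with h | h | h
    · exact absurd (by linear_combination -h) h1
    · exact absurd (by linear_combination -h) h2
    · exact h
  have m3 : i + 3 ∈ blk (i + 1 + 2) (2 * j + 4) := by
    rcases hcov (i + 3) with h | h | h
    · exact absurd (by linear_combination h) h2
    · exact absurd (by linear_combination h) h1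
    · exact h
  calc S.card ≤ proj S (insert (i + 2) (insert (i + 1) (blk (i + 1 + 2) (2 * j + 4)))) := by
        refine card_le_proj fun x => ?_
        rcases hcov x with h | h | h
        · simp [h]
        · simp [h, show i + 1 + 1 = i + 2 by ring]
        · simp [h]
    _ ≤ k * (k * ((k ^ 2 + k') * k ^ j * Fintype.card V ^ (j + 2))) := by
        refine (h.proj_thin hM hi2 ?_ ?_).trans (Nat.mul_le_mul_left _
          ((h.proj_right hM hi m1 m2).trans (Nat.mul_le_mul_left _
            (h.proj_blk_even hM (by omega) hN _ j))))
        · rw [show i + 2 - 1 = i + 1 by ring]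
          exact Finset.mem_insert_self _ _
        · rw [show i + 2 + 1 = i + 3 by ring]
          exact Finset.mem_insert_of_mem m3
    _ = _ := by ring

/-- Both edges at `x` and `y` have the same colour, so `y + 1` is determined by `y` and the edge at
`x`, and then the thin position `y + 2` by its neighbours. The condition `y + 2 ≠ x` keeps the edge
at `x` inside the block of the other `s - 2` positions. -/
theorem HasPattern.card_le_of_color (h : HasPattern G M D T S P) (hM : IsCover G T k M D)
    (hp : Proper G col) {k' : ℕ} (hN : (thinPaths G M).card ≤ k' * Fintype.card V ^ 2) {j : ℕ}
    [NeZero s] (hs : s = 2 * j + 6) (hP : ∀ i, i ∈ P) {x y : ZMod s} (hxy : x ≠ y)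
    (hyx : y + 2 ≠ x)
    (hcol : ∀ f ∈ S, col s(f x, f (x + 1)) = col s(f y, f (y + 1))) :
    S.card ≤ k * ((k ^ 2 + k') * k ^ j) * Fintype.card V ^ (j + 2) := by
  have hcov := eq_or_eq_or_mem_blk (s := s) (m := 2 * j + 4) (by omega) (y + 1)
  have h1 : ((1 : ℕ) : ZMod s) ≠ 0 := natCast_ne_zero_of_lt (by norm_num) (by omega)
  have h2 : ((2 : ℕ) : ZMod s) ≠ 0 := natCast_ne_zero_of_lt (by norm_num) (by omega)
  push_cast at h1 h2
  rcases S.eq_empty_or_nonempty with rfl | ⟨f, hf⟩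
  · simp
  have hxy1 : x ≠ y + 1 := by
    rintro rfl
    have h3 := hp _ _ _ ((h.cyc f hf).2 (y + 1)) ((h.cyc f hf).2 y).symm
      ((hcol f hf).trans (congrArg col Sym2.eq_swap))
    have h4 := (h.cyc f hf).1 h3
    exact h2 (by linear_combination h4)
  have m1 : x ∈ blk (y + 1 + 2) (2 * j + 4) := by
    rcases hcov x with h | h | h
    · exact absurd h hxy1
    · exact absurd (by linear_combination -h) hyx
    · exact h
  have m2 : x + 1 ∈ blk (y + 1 + 2) (2 * j + 4) := by
    rcases hcov (x + 1) with h | h | h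
    · exact absurd (by linear_combination h) hxy
    · exact absurd (by linear_combination h) hxy1
    · exact h
  have m3 : y ∈ blk (y + 1 + 2) (2 * j + 4) := by
    rcases hcov y with h | h | h
    · exact absurd (by linear_combination -h) h1
    · exact absurd (by linear_combination -h) h2
    · exact h
  have m4 : y + 3 ∈ blk (y + 1 + 2) (2 * j + 4) := by
    rcases hcov (y + 3) with h | h | h
    · exact absurd (by linear_combination h) h2
    · exact absurd (by linear_combination h) h1
    · exact h
  have hone : proj S (insert (y + 1) (blk (y + 1 + 2) (2 * j + 4))) ≤
      1 * proj S (blk (y + 1 + 2) (2 * j + 4)) :=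
    proj_insert_le (fun f => colorNbrs G col (f y) (col s(f x, f (x + 1))))
      (fun f g hfg => by simp only [hfg _ m1, hfg _ m2, hfg _ m3])
      (fun _ => card_colorNbrs_le hp _ _)
      fun f hf => mem_colorNbrs.2 ⟨(h.cyc f hf).2 y, (hcol f hf).symm⟩
  calc S.card ≤ proj S (insert (y + 2) (insert (y + 1) (blk (y + 1 + 2) (2 * j + 4)))) := by
        refine card_le_proj fun x => ?_
        rcases hcov x with h | h | h
        · simp [h]
        · simp [h, show y + 1 + 1 = y + 2 by ring]
        · simp [h]
    _ ≤ k * (1 * ((k ^ 2 + k') * k ^ j * Fintype.card V ^ (j + 2))) := by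
        refine (h.proj_thin hM (hP _) ?_ ?_).trans (Nat.mul_le_mul_left _
          (hone.trans (Nat.mul_le_mul_left _ (h.proj_blk_even hM (by omega) hN _ j))))
        · rw [show y + 2 - 1 = y + 1 by ring]
          exact Finset.mem_insert_self _ _
        · rw [show y + 2 + 1 = y + 3 by ring]
          exact Finset.mem_insert_of_mem m4
    _ = _ := by ring

/-- A cycle of even length can be made rainbow if every other vertex is replaceable. -/
theorem IsCyc.not_rainbowFree_of_fat (hp : Proper G col) {r : ℕ} {f : ZMod (2 * r + 4) → V}
    (hf : IsCyc G (2 * r + 4) f) {i : ZMod (2 * r + 4)} (hT : 7 * r + 14 ≤ T)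
    (hfat : ∀ m : ℕ, T ≤ (commonNbrs G (f (i + 2 * m - 1)) (f (i + 2 * m + 1))).card) :
    ¬ RainbowFree G col (2 * r + 4) := by
  classical
  have hzero : ((2 * r + 4 : ℕ) : ZMod (2 * r + 4)) = 0 := ZMod.natCast_self _
  push_cast at hzero
  -- The vertices `w 0, …, w (r + 1)` of every other position are kept and all vertices between them
  -- are chosen anew; the last one closes the path from `w (r + 1)` back to `w 0`.
  let w : ℕ → V := fun j => f (i + 2 * j - 1)
  have hw : ∀ j, T ≤ (commonNbrs G (w j) (w (j + 1))).card := by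
    intro j
    have := hfat j
    simp only [w]
    rwa [show i + 2 * ((j + 1 : ℕ) : ZMod (2 * r + 4)) - 1 = i + 2 * j + 1 by push_cast; ring]
  have hinj : ∀ a b, a < b → b ≤ r + 1 → w a ≠ w b := by
    intro a b hab hb he
    have h1 := hf.1 he
    refine natCast_ne_zero_of_lt (s := 2 * r + 4) (j := 2 * (b - a)) (by omega) (by omega) ?_
    push_cast [Nat.cast_sub hab.le]
    linear_combination -h1
  have hwlast : w (r + 2) = w 0 := by
    simp only [w]
    congr 1
    push_cast
    linear_combination hzero
  obtain ⟨l, h1, h2, h3, -, -⟩ := RPath.prolong (G := G) (col := col) hp (w := w) (m := r + 1)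
    (T := T) (l₀ := []) (d := w 0) (A := ∅) (Y := []) trivial rfl (fun j _ => hw j) hinj
    (by
      intro j hj1 hj2
      simpa using (hinj 0 j (by omega) hj2).symm)
    (by simp only [List.length_nil, Finset.card_empty]; omega)
  simp only [List.length_nil] at h3
  have hcard := List.toFinset_card_le (w (r + 1) :: l)
  have hlen := pathColors_length_le col (w (r + 1) :: l)
  simp only [List.length_cons] at hcard hlen
  have hO := hw (r + 1)
  rw [hwlast] at hO
  obtain ⟨x, hx, hxX, hx1, hx2⟩ := exists_fresh hp (X := (w (r + 1) :: l).toFinset)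
    (Y := pathColors col (w (r + 1) :: l)) (O := commonNbrs G (w (r + 1)) (w 0))
    (fun v hv => (mem_commonNbrs.1 hv).1) (fun v hv => (mem_commonNbrs.1 hv).2) (by omega)
  obtain ⟨ha1, ha2⟩ := mem_commonNbrs.1 hx
  have hP : RPath G col (x :: w (r + 1) :: l) := rpath_cons h1 ha1 (by simpa using hxX) hx1
  refine hP.not_rainbowFree (d := w 0) (by simp only [List.length_cons]; omega) (by omega)
    (by rw [List.getLast?_cons_cons]; exact h2) ha2 ?_
  change _ ∉ col s(x, w (r + 1)) :: pathColors col (w (r + 1) :: l)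
  rw [List.mem_cons, not_or]
  refine ⟨fun he => hinj 0 (r + 1) (by omega) le_rfl ?_, hx2⟩
  rw [Sym2.eq_swap] at he
  exact hp _ _ _ ha2.symm ha1.symm he

/-- If some position is not thin, going on in steps of two either meets a thin position right after
a fat one, or all positions of that parity are fat, which contradicts rainbow-freeness. If all
positions are thin, the repeated colour is used. -/
theorem HasPattern.card_le_self {r : ℕ} {S : Finset (ZMod (2 * r + 6) → V)}
    {P : Finset (ZMod (2 * r + 6))} (h : HasPattern G M D T S P) (hM : IsCover G T k M D)
    (hp : Proper G col) (hfree : RainbowFree G col (2 * r + 6)) (hT : 7 * r + 21 ≤ T) {k' : ℕ}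
    (hN : (thinPaths G M).card ≤ k' * Fintype.card V ^ 2) {x y : ZMod (2 * r + 6)} (hxy : x ≠ y)
    (hcol : ∀ f ∈ S, col s(f x, f (x + 1)) = col s(f y, f (y + 1))) :
    S.card ≤ (k ^ 2 + k) * ((k ^ 2 + k') * k ^ r) * Fintype.card V ^ (r + 2) := by
  have key : S.card ≤ k ^ 2 * ((k ^ 2 + k') * k ^ r) * Fintype.card V ^ (r + 2) ∨
      S.card ≤ k * ((k ^ 2 + k') * k ^ r) * Fintype.card V ^ (r + 2) := by
    by_cases h1 : ∃ i, i ∉ P ∧ i + 2 ∈ P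
    · obtain ⟨i, hi, hi2⟩ := h1
      exact Or.inl (h.card_le_of_fat_of_thin hM hN rfl hi hi2)
    push Not at h1
    by_cases h2 : ∃ i, i ∉ P
    · obtain ⟨i, hi⟩ := h2
      rcases S.eq_empty_or_nonempty with rfl | ⟨f, hf⟩
      · left; simp
      exfalso
      have h3 : ∀ m : ℕ, i + 2 * m ∉ P := by
        intro m
        induction m with
        | zero => simpa using hi
        | succ m ih =>
          have := h1 _ ih
          convert! this using 2
          push_cast; ring
      exact (h.cyc f hf).not_rainbowFree_of_fat (r := r + 1) hp (i := i) (T := T) (by omega)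
        (fun m => h.fat f hf _ (h3 m)) hfree
    · push Not at h2
      right
      -- The roles of `x` and `y` can be exchanged: `y + 2 = x` and `x + 2 = y` together would give
      -- `4 = 0`, but the length is at least 6.
      by_cases hyx : y + 2 = x
      · refine h.card_le_of_color hM hp hN rfl h2 hxy.symm ?_ fun f hf => (hcol f hf).symm
        intro hxy2
        refine natCast_ne_zero_of_lt (s := 2 * r + 6) (j := 4) (by omega) (by omega) ?_
        push_cast
        linear_combination hyx + hxy2
      · exact h.card_le_of_color hM hp hN rfl h2 hxy hyx hcol
  rcases key with h1 | h1
  · refine h1.trans (Nat.mul_le_mul_right _ (Nat.mul_le_mul_right _ (Nat.le_add_right _ _)))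
  · refine h1.trans (Nat.mul_le_mul_right _ (Nat.mul_le_mul_right _ (Nat.le_add_left _ _)))

end EvenUpper

/-- Cycles are sorted by a label with boundedly many values (thin positions, repeated colours,
determined positions), so that each class can be counted with this data fixed. -/
theorem card_cycs_le_of_pattern {V : Type*} [Fintype V] {G : SimpleGraph V} {β : Type*} [Fintype β]
    {s B : ℕ} [NeZero s] (label : (ZMod s → V) → β)
    (h : ∀ b, ∀ S ⊆ cycs G s, (∀ f ∈ S, label f = b) → S.card ≤ B) :
    (cycs G s).card ≤ B * Fintype.card β := by
  classical
  refine Finset.card_le_mul_card_image_of_maps_to (f := label) (fun _ _ => Finset.mem_univ _) B ?_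
  intro b _
  exact h b _ (Finset.filter_subset _ _) fun f hf => (Finset.mem_filter.1 hf).2

/-- Even cycles in graphs without rainbow cycles of a given even length at least six. -/
theorem card_cycs_even_le (r j : ℕ) : ∃ C : ℕ, ∀ {V K : Type} [Fintype V] {G : SimpleGraph V}
    {col : Sym2 V → K}, Proper G col → RainbowFree G col (2 * (r + 3)) →
    (cycs G (2 * j + 4)).card ≤ C * Fintype.card V ^ (j + 2) := by
  -- Common neighbours play no role in this count, so `T = 0` suffices.
  obtain ⟨k, hk⟩ := exists_twoPath_cover (r + 1) 0
  obtain ⟨k', hk'⟩ := card_thinPaths_le r k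
  refine ⟨(k ^ 2 + k') * k ^ j * Fintype.card (Finset (ZMod (2 * j + 4))),
    fun {V K} _ {G col} hp hfree => ?_⟩
  obtain ⟨M, D, hM⟩ := hk hp hfree
  rw [mul_right_comm]
  refine card_cycs_le_of_pattern (pattern M) fun P S hS hlab => ?_
  have h : HasPattern G M D 0 S P := hasPattern_of_forall (by omega) hM fun f hf =>
    ⟨mem_cycs.1 (hS hf), hlab f hf⟩
  exact h.card_le_even hM (hk' hp hfree hM) rfl

/-- Odd cycles in graphs without rainbow cycles of a given even length at least six. -/
theorem card_cycs_odd_le (r j : ℕ) : ∃ C : ℕ, ∀ {V K : Type} [Fintype V] {G : SimpleGraph V}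
    {col : Sym2 V → K}, Proper G col → RainbowFree G col (2 * (r + 3)) →
    (cycs G (2 * j + 5)).card ≤ C * Fintype.card V ^ (j + 2) := by
  obtain ⟨k, hk⟩ := exists_twoPath_cover (r + 1) 0
  obtain ⟨k', hk'⟩ := card_thinPaths_le r k
  refine ⟨(k * ((k ^ 2 + k') * k ^ j) + k ^ (2 * j + 3)) *
    Fintype.card (Finset (ZMod (2 * j + 5))), fun {V K} _ {G col} hp hfree => ?_⟩
  obtain ⟨M, D, hM⟩ := hk hp hfree
  rw [mul_right_comm]
  refine card_cycs_le_of_pattern (pattern M) fun P S hS hlab => ?_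
  have h : HasPattern G M D 0 S P := hasPattern_of_forall (by omega) hM fun f hf =>
    ⟨mem_cycs.1 (hS hf), hlab f hf⟩
  exact h.card_le_odd hM (hk' hp hfree hM) rfl

open scoped Classical in
/-- Two positions whose edges have the same colour, if there are any. -/
noncomputable def repeatedColor {V K : Type*} (col : Sym2 V → K) {s : ℕ} (f : ZMod s → V) :
    ZMod s × ZMod s :=
  if h : ∃ p : ZMod s × ZMod s, p.1 ≠ p.2 ∧
      col s(f p.1, f (p.1 + 1)) = col s(f p.2, f (p.2 + 1)) then h.choose else (0, 0)

theorem RainbowFree.repeatedColor_spec {V K : Type*} {G : SimpleGraph V} {col : Sym2 V → K} {s : ℕ}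
    (hfree : RainbowFree G col s) {f : ZMod s → V} (hf : IsCyc G s f) :
    (repeatedColor col f).1 ≠ (repeatedColor col f).2 ∧
      col s(f (repeatedColor col f).1, f ((repeatedColor col f).1 + 1)) =
        col s(f (repeatedColor col f).2, f ((repeatedColor col f).2 + 1)) := by
  have h := hfree f hf
  rw [Function.Injective] at h
  push Not at h
  obtain ⟨x, y, h1, h2⟩ := h
  have h3 : ∃ p : ZMod s × ZMod s, p.1 ≠ p.2 ∧
      col s(f p.1, f (p.1 + 1)) = col s(f p.2, f (p.2 + 1)) := ⟨(x, y), h2, h1⟩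
  rw [repeatedColor, dif_pos h3]
  exact h3.choose_spec

/-- Cycles of the length of which no rainbow cycle exists. -/
theorem card_cycs_self_le (r : ℕ) : ∃ C : ℕ, ∀ {V K : Type} [Fintype V] {G : SimpleGraph V}
    {col : Sym2 V → K}, Proper G col → RainbowFree G col (2 * r + 6) →
    (cycs G (2 * r + 6)).card ≤ C * Fintype.card V ^ (r + 2) := by
  -- The value is `7 * (r + 1) + 14`, as required for replacing every other vertex of a cycle of
  -- length `2 * (r + 1) + 4`.
  obtain ⟨k, hk⟩ := exists_twoPath_cover (r + 1) (7 * r + 21)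
  obtain ⟨k', hk'⟩ := card_thinPaths_le r k
  refine ⟨(k ^ 2 + k) * ((k ^ 2 + k') * k ^ r) *
    Fintype.card (Finset (ZMod (2 * r + 6)) × (ZMod (2 * r + 6) × ZMod (2 * r + 6))),
    fun {V K} _ {G col} hp hfree => ?_⟩
  obtain ⟨M, D, hM⟩ := hk hp hfree
  rw [mul_right_comm]
  refine card_cycs_le_of_pattern (fun f => (pattern M f, repeatedColor col f)) ?_
  rintro ⟨P, x, y⟩ S hS hlab
  simp only [Prod.mk.injEq] at hlab
  rcases S.eq_empty_or_nonempty with rfl | ⟨f, hf⟩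
  · simp
  have h : HasPattern G M D (7 * r + 21) S P := hasPattern_of_forall (by omega) hM fun f hf =>
    ⟨mem_cycs.1 (hS hf), (hlab f hf).1⟩
  have hspec : ∀ f ∈ S, x ≠ y ∧ col s(f x, f (x + 1)) = col s(f y, f (y + 1)) := by
    intro f hf
    have := hfree.repeatedColor_spec (mem_cycs.1 (hS hf))
    rwa [(hlab f hf).2] at this
  exact h.card_le_self hM hp hfree le_rfl (hk' hp hfree hM) (hspec f hf).1
    fun f hf => (hspec f hf).2

/-! ### Upper bound for `t = 4` -/

section FourCycle

variable {V K : Type*} [Fintype V] {G : SimpleGraph V} {col : Sym2 V → K} {s : ℕ}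

/-- Fix a common neighbour `v`. Another one forms a rainbow 4-cycle with it unless one of its two
edges repeats one of the two colours at `v`. This excludes at most four vertices besides `v`. -/
theorem card_commonNbrs_le_five (hp : Proper G col) (hfree : RainbowFree G col 4) {u w : V}
    (huw : u ≠ w) : (commonNbrs G u w).card ≤ 5 := by
  classical
  by_contra hcon
  push Not at hcon
  obtain ⟨v, hv⟩ := Finset.card_pos.1 (by omega : 0 < (commonNbrs G u w).card)
  obtain ⟨hu, hw⟩ := mem_commonNbrs.1 hv
  obtain ⟨x, hx, hxX, hx1, hx2⟩ := exists_fresh hp (X := {v})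
    (Y := [col s(w, v), col s(v, u)]) (O := commonNbrs G w u)
    (fun v hv => (mem_commonNbrs.1 hv).1) (fun v hv => (mem_commonNbrs.1 hv).2) (by
      have : commonNbrs G w u = commonNbrs G u w := by
        ext x; simp only [mem_commonNbrs, and_comm]
      rw [this]
      simpa using hcon)
  obtain ⟨ha1, ha2⟩ := mem_commonNbrs.1 hx
  have h1 : RPath G col [w, v, u] := by
    refine ⟨hw, ?_, ?_, hu.symm, ?_, ?_, trivial⟩
    · simp [hw.ne, huw.symm]
    · simp only [pathColors, List.mem_singleton]
      intro h
      rw [Sym2.eq_swap] at h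
      exact huw.symm (hp _ _ _ hw.symm hu.symm h)
    · simp [hu.ne']
    · simp [pathColors]
  have h2 : RPath G col [x, w, v, u] :=
    rpath_cons h1 ha1 (by simp [ha1.ne', ha2.ne', Finset.mem_singleton.not.1 hxX]) hx1
  refine h2.not_rainbowFree (d := u) rfl (by norm_num) rfl ha2 ?_ hfree
  change _ ∉ col s(x, w) :: _
  rw [List.mem_cons, not_or]
  refine ⟨fun he => huw ?_, hx2⟩
  rw [Sym2.eq_swap] at he
  exact hp _ _ _ ha2.symm ha1.symm he

open scoped Classical in
/-- The pairs of adjacent vertices. -/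
noncomputable def adjPairs (G : SimpleGraph V) : Finset (V × V) :=
  Finset.univ.filter fun p => G.Adj p.1 p.2

/-- The Kővári–Sós–Turán argument: paths of length two are counted by their middle vertex and by
their ends, followed by Cauchy–Schwarz. Equal ends contribute the extra 1 in `k + 1`. -/
theorem card_adjPairs_sq_le {k : ℕ} (h : ∀ u w, u ≠ w → (commonNbrs G u w).card ≤ k) :
    (adjPairs G).card ^ 2 ≤ (k + 1) * Fintype.card V ^ 3 := by
  classical
  let N : V → Finset V := fun v => Finset.univ.filter fun u => G.Adj v u
  have h1 : (adjPairs G).card = ∑ v, (N v).card := by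
    rw [← Finset.card_sigma]
    refine Finset.card_bij (fun p _ => ⟨p.1, p.2⟩) ?_ ?_ ?_
    · intro p hp; simpa [adjPairs, N] using hp
    · rintro ⟨a, b⟩ _ ⟨c, d⟩ _ h; simpa using h
    · rintro ⟨a, b⟩ hb; exact ⟨(a, b), by simpa [adjPairs, N] using hb, rfl⟩
  have h2 : ∑ v, (N v).card ^ 2 = ∑ p : V × V, (commonNbrs G p.1 p.2).card := by
    have e1 : ∀ v, (N v).card ^ 2 = ((N v) ×ˢ (N v)).card := fun v => by
      rw [Finset.card_product, sq]
    simp_rw [e1]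
    rw [← Finset.card_sigma, ← Finset.card_sigma]
    refine Finset.card_bij (fun q _ => ⟨q.2, q.1⟩) ?_ ?_ ?_
    · rintro ⟨v, u, w⟩ hq
      simp only [Finset.mem_sigma, Finset.mem_univ, true_and, Finset.mem_product, N,
        Finset.mem_filter, mem_commonNbrs] at hq ⊢
      exact ⟨hq.1.symm, hq.2.symm⟩
    · rintro ⟨v, u⟩ _ ⟨v', u'⟩ _ h
      simp only [Sigma.mk.injEq, heq_eq_eq] at h
      obtain ⟨rfl, rfl⟩ := h; rfl
    · rintro ⟨⟨u, w⟩, v⟩ hq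
      refine ⟨⟨v, u, w⟩, ?_, rfl⟩
      simp only [Finset.mem_sigma, Finset.mem_univ, true_and, Finset.mem_product, N,
        Finset.mem_filter, mem_commonNbrs] at hq ⊢
      exact ⟨hq.1.symm, hq.2.symm⟩
  have h3 : ∑ p : V × V, (commonNbrs G p.1 p.2).card ≤ (k + 1) * Fintype.card V ^ 2 := by
    calc _ ≤ ∑ p : V × V, (k + if p.1 = p.2 then Fintype.card V else 0) := by
          refine Finset.sum_le_sum fun p _ => ?_
          split_ifs with hp
          · exact (Finset.card_le_univ _).trans (Nat.le_add_left _ _)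
          · exact h _ _ hp
      _ = (k + 1) * Fintype.card V ^ 2 := by
          rw [Finset.sum_add_distrib, Fintype.sum_prod_type (f := fun p : V × V =>
            if p.1 = p.2 then Fintype.card V else 0)]
          simp
          ring
  have h4 := sq_sum_le_card_mul_sum_sq (s := (Finset.univ : Finset V)) (f := fun v => (N v).card)
  rw [h1]
  calc _ ≤ Fintype.card V * ∑ v, (N v).card ^ 2 := h4
    _ ≤ Fintype.card V * ((k + 1) * Fintype.card V ^ 2) := by
        rw [h2]; exact Nat.mul_le_mul_left _ h3
    _ = _ := by ring

variable {S : Finset (ZMod s → V)} {k : ℕ}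

theorem proj_insert_middle_le (hs : 3 ≤ s) (hS : ∀ f ∈ S, IsCyc G s f)
    (h : ∀ u w, u ≠ w → (commonNbrs G u w).card ≤ k) {J : Finset (ZMod s)} {i : ZMod s}
    (h1 : i - 1 ∈ J) (h2 : i + 1 ∈ J) : proj S (insert i J) ≤ k * proj S J := by
  classical
  refine proj_insert_le (fun f => if f (i - 1) = f (i + 1) then ∅ else
    commonNbrs G (f (i - 1)) (f (i + 1))) (fun f g hfg => by simp only [hfg _ h1, hfg _ h2])
    (fun f => ?_) fun f hf => ?_
  · split_ifs with he
    · simp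
    · exact h _ _ he
  · rw [if_neg, mem_commonNbrs]
    · have h3 := (hS f hf).2 (i - 1)
      rw [sub_add_cancel] at h3
      exact ⟨h3, ((hS f hf).2 i).symm⟩
    · intro he
      have h3 := (hS f hf).1 he
      refine natCast_ne_zero_of_lt (s := s) (j := 2) (by norm_num) (by omega) ?_
      push_cast; linear_combination -h3

theorem proj_blk_add_two_mul_le (hs : 3 ≤ s) (hS : ∀ f ∈ S, IsCyc G s f)
    (h : ∀ u w, u ≠ w → (commonNbrs G u w).card ≤ k) (a : ZMod s) (m j : ℕ) :
    proj S (blk a (m + 1 + 2 * j)) ≤ (k * Fintype.card V) ^ j * proj S (blk a (m + 1)) := by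
  induction j with
  | zero => simp
  | succ j ih =>
    set i : ZMod s := a + (m + 1 + 2 * j : ℕ) with hi
    have h1 : i - 1 ∈ blk a (m + 1 + 2 * j) := by
      have := mem_blk_self a (show m + 2 * j < m + 1 + 2 * j by omega)
      convert! this using 1
      rw [hi]; push_cast; ring
    have h2 : blk a (m + 1 + 2 * (j + 1)) = insert i (insert (i + 1) (blk a (m + 1 + 2 * j))) := by
      rw [show m + 1 + 2 * (j + 1) = m + 1 + 2 * j + 1 + 1 by ring, blk_succ, blk_succ, hi,
        Finset.insert_comm]
      congr 2
      push_cast; ring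
    rw [h2]
    calc _ ≤ k * (Fintype.card V * ((k * Fintype.card V) ^ j * proj S (blk a (m + 1)))) :=
          (proj_insert_middle_le hs hS h (Finset.mem_insert_of_mem h1)
            (Finset.mem_insert_self _ _)).trans (Nat.mul_le_mul_left _
            ((proj_insert_le_card_mul _ _ _).trans (Nat.mul_le_mul_left _ ih)))
      _ = _ := by ring

theorem proj_blk_two_le (hS : ∀ f ∈ S, IsCyc G s f) (a : ZMod s) :
    proj S (blk a 2) ≤ (adjPairs G).card := by
  classical
  refine (proj_le_card_image (fun f => (f a, f (a + 1))) ?_).trans (Finset.card_le_card ?_)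
  · intro f _ g _ hfg i hi
    simp only [Prod.mk.injEq] at hfg
    obtain ⟨j, hj, rfl⟩ := mem_blk.1 hi
    interval_cases j
    · simpa using hfg.1
    · simpa using hfg.2
  · intro p hp
    obtain ⟨f, hf, rfl⟩ := Finset.mem_image.1 hp
    simpa [adjPairs] using (hS f hf).2 a

theorem card_le_of_proj_blk [NeZero s] {m : ℕ} (hm : s = m + 3) (hS : ∀ f ∈ S, IsCyc G s f)
    (h : ∀ u w, u ≠ w → (commonNbrs G u w).card ≤ k) :
    S.card ≤ k * proj S (blk 1 (m + 2)) := by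
  have hcov := eq_or_mem_blk (s := s) (m := m + 2) hm 0
  have h1 : ((1 : ℕ) : ZMod s) ≠ 0 := natCast_ne_zero_of_lt (by norm_num) (by omega)
  push_cast at h1
  rw [zero_add] at hcov
  refine (card_le_proj (J := insert 0 (blk 1 (m + 2))) fun i => Finset.mem_insert.2 (hcov i)).trans
    (proj_insert_middle_le (by omega) hS h ?_ ?_)
  · exact (hcov _).resolve_left fun h => h1 (by linear_combination -h)
  · exact (hcov _).resolve_left fun h => h1 (by linear_combination h)

/-- Cycles in graphs with bounded codegrees. -/
theorem card_cycs_sq_le_of_codegree (s : ℕ) [NeZero s] (hs : 4 ≤ s)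
    (h : ∀ u w, u ≠ w → (commonNbrs G u w).card ≤ k) :
    (cycs G s).card ^ 2 ≤ (k + 1) ^ (2 * s) * Fintype.card V ^ s := by
  have hS : ∀ f ∈ cycs G s, IsCyc G s f := fun f hf => mem_cycs.1 hf
  set n := Fintype.card V
  -- For even `s` the count starts with one free vertex, for odd `s` with an edge; then every two
  -- positions cost one factor `n`, and position 0 is filled in last. Squares avoid the exponent `3
  -- / 2` for the edges.
  obtain ⟨j, hj | hj⟩ : ∃ j, s = 2 * j + 4 ∨ s = 2 * j + 5 := ⟨(s - 4) / 2, by omega⟩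
  · have h1 := card_le_of_proj_blk (m := 2 * j + 1) (by omega) hS h
    have h2 := proj_blk_add_two_mul_le (by omega) hS h 1 0 (j + 1)
    have h3 : proj (cycs G s) (blk 1 1) ≤ n := by
      rw [blk_succ]
      refine (proj_insert_le_card_mul _ _ _).trans ?_
      have := proj_empty_le (cycs G s)
      calc _ ≤ n * 1 := Nat.mul_le_mul_left _ this
        _ = n := mul_one _
    rw [show 0 + 1 + 2 * (j + 1) = 2 * j + 1 + 2 by ring] at h2
    have h4 : (cycs G s).card ≤ k ^ (j + 2) * n ^ (j + 2) := by
      calc _ ≤ k * ((k * n) ^ (j + 1) * n) :=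
            h1.trans (Nat.mul_le_mul_left _ (h2.trans (Nat.mul_le_mul_left _ h3)))
        _ = _ := by ring
    calc _ ≤ (k ^ (j + 2) * n ^ (j + 2)) ^ 2 := Nat.pow_le_pow_left h4 2
      _ = k ^ s * n ^ s := by rw [hj]; ring
      _ ≤ _ := by
        refine Nat.mul_le_mul_right _ ?_
        calc k ^ s ≤ (k + 1) ^ s := Nat.pow_le_pow_left (by omega) _
          _ ≤ _ := Nat.pow_le_pow_right (by omega) (by omega)
  · have h1 := card_le_of_proj_blk (m := 2 * j + 2) (by omega) hS h
    have h2 := proj_blk_add_two_mul_le (by omega) hS h 1 1 (j + 1)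
    have h3 := proj_blk_two_le hS 1
    have h5 := card_adjPairs_sq_le h
    rw [show 1 + 1 + 2 * (j + 1) = 2 * j + 2 + 2 by ring] at h2
    have h4 : (cycs G s).card ≤ k * ((k * n) ^ (j + 1) * (adjPairs G).card) :=
      h1.trans (Nat.mul_le_mul_left _ (h2.trans (Nat.mul_le_mul_left _ h3)))
    calc _ ≤ (k * ((k * n) ^ (j + 1) * (adjPairs G).card)) ^ 2 := Nat.pow_le_pow_left h4 2
      _ = k ^ (2 * j + 4) * n ^ (2 * j + 2) * (adjPairs G).card ^ 2 := by ring
      _ ≤ k ^ (2 * j + 4) * n ^ (2 * j + 2) * ((k + 1) * n ^ 3) := Nat.mul_le_mul_left _ h5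
      _ ≤ (k + 1) ^ (2 * j + 4) * n ^ (2 * j + 2) * ((k + 1) * n ^ 3) := by gcongr; omega
      _ = (k + 1) ^ s * n ^ s := by rw [hj]; ring
      _ ≤ _ := by
        refine Nat.mul_le_mul_right _ ?_
        exact Nat.pow_le_pow_right (by omega) (by omega)

theorem card_cycs_sq_le (hp : Proper G col) (hfree : RainbowFree G col 4) (s : ℕ) [NeZero s]
    (hs : 4 ≤ s) : (cycs G s).card ^ 2 ≤ 6 ^ (2 * s) * Fintype.card V ^ s :=
  card_cycs_sq_le_of_codegree s hs fun _ _ huw => card_commonNbrs_le_five hp hfree huw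

end FourCycle

/-! ### Upper bound for odd `s ≤ t` -/

section OddUpper

variable {V K : Type*} [Fintype V] {G : SimpleGraph V} {col : Sym2 V → K} {s : ℕ}

theorem proj_le_pow (S : Finset (ZMod s → V)) (J : Finset (ZMod s)) :
    proj S J ≤ Fintype.card V ^ J.card := by
  classical
  induction J using Finset.induction_on with
  | empty => simpa using proj_empty_le S
  | insert j J hj ih =>
    rw [Finset.card_insert_of_notMem hj, pow_succ']
    exact (proj_insert_le_card_mul S J j).trans (Nat.mul_le_mul_left _ ih)

/-- If the values at two positions are determined, up to `k` choices each, by the values at all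
other positions and by these together with the first value, then two factors are saved. -/
theorem card_le_of_two_determined [NeZero s] {S : Finset (ZMod s → V)} {k : ℕ} {i j : ZMod s}
    (hij : i ≠ j) (Φ Ψ : (ZMod s → V) → Finset V)
    (hΦ : ∀ f g, (∀ x, x ≠ i → x ≠ j → f x = g x) → Φ f = Φ g)
    (hΨ : ∀ f g, (∀ x, x ≠ j → f x = g x) → Ψ f = Ψ g) (hk : ∀ f, (Φ f).card ≤ k)
    (hk' : ∀ f, (Ψ f).card ≤ k) (hS : ∀ f ∈ S, f i ∈ Φ f ∧ f j ∈ Ψ f) :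
    S.card ≤ k ^ 2 * Fintype.card V ^ (s - 2) := by
  classical
  set J : Finset (ZMod s) := {i, j}ᶜ with hJ
  have hJcard : J.card = s - 2 := by
    rw [hJ, Finset.card_compl, ZMod.card, Finset.card_pair hij]
  calc S.card ≤ proj S (insert j (insert i J)) := card_le_proj fun x => by
        simp only [hJ, Finset.mem_insert, Finset.mem_compl, Finset.mem_singleton]; tauto
    _ ≤ k * (k * Fintype.card V ^ J.card) := by
        refine (proj_insert_le Ψ (fun f g h => hΨ f g fun x hx => h x ?_) hk'
          fun f hf => (hS f hf).2).trans (Nat.mul_le_mul_left _ ((proj_insert_le Φ (fun f g h =>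
          hΦ f g fun x hx hx' => h x ?_) hk fun f hf => (hS f hf).1).trans
          (Nat.mul_le_mul_left _ (proj_le_pow S J))))
        · simp only [hJ, Finset.mem_insert, Finset.mem_compl, Finset.mem_singleton]; tauto
        · simp only [hJ, Finset.mem_insert, Finset.mem_compl, Finset.mem_singleton]; tauto
    _ = _ := by rw [hJcard]; ring

/-- `b` and `c` are the inner vertices of a walk of length three from `a` to `d`. -/
def ThreeWalk (G : SimpleGraph V) (a d b c : V) : Prop :=
  G.Adj a b ∧ G.Adj b c ∧ G.Adj c d

open scoped Classical in
/-- Four ways in which a vertex of a closed walk is determined, up to few choices, by others: as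
one of few common neighbours of its neighbours, as first or second inner vertex of a walk of length
three, or by the colour of an edge. -/
noncomputable def chooser (G : SimpleGraph V) (col : Sym2 V → K) (T C m : ℕ) (κ : Fin 4)
    (f : ZMod s → V) (j : ZMod s) : Finset V :=
  match κ with
  | 0 => if (commonNbrs G (f (j + -1)) (f (j + 1))).card < T then
      commonNbrs G (f (j + -1)) (f (j + 1)) else ∅
  | 1 => levLeft (ThreeWalk G (f (j + -1)) (f (j + 2))) C m (f (j + 1))
  | 2 => levRight (ThreeWalk G (f (j + -2)) (f (j + 1))) C m (f (j + -1))
  | 3 => colorNbrs G col (f (j + 1)) (col s(f (j + -4), f (j + -3)))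

/-- The relative positions of the vertices that `chooser` refers to. -/
def chooserOffsets (s : ℕ) (κ : Fin 4) : List (ZMod s) :=
  match κ with
  | 0 => [-1, 1]
  | 1 => [-1, 1, 2]
  | 2 => [-2, -1, 1]
  | 3 => [1, -4, -3]

theorem chooser_congr {T C m : ℕ} {κ : Fin 4} {f g : ZMod s → V} {j : ZMod s}
    (h : ∀ d ∈ chooserOffsets s κ, f (j + d) = g (j + d)) :
    chooser G col T C m κ f j = chooser G col T C m κ g j := by
  fin_cases κ <;> simp [chooserOffsets] at h <;> simp [chooser, h]

theorem card_chooser_le (hp : Proper G col) {T C m : ℕ} (κ : Fin 4) (f : ZMod s → V) (j : ZMod s) :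
    (chooser G col T C m κ f j).card ≤ T + m * C + 1 := by
  fin_cases κ
  · simp only [chooser]
    split_ifs with h
    · omega
    · simp
  · exact (card_levLeft_le _ _).trans (by omega)
  · exact (card_levRight_le _ _).trans (by omega)
  · exact (card_colorNbrs_le hp _ _).trans (by omega)

theorem chooserOffsets_ne_zero (hs : 5 ≤ s) {κ : Fin 4} {d : ZMod s}
    (hd : d ∈ chooserOffsets s κ) : d ≠ 0 := by
  have h1 : ((1 : ℕ) : ZMod s) ≠ 0 := natCast_ne_zero_of_lt (by norm_num) (by omega)
  have h2 : ((2 : ℕ) : ZMod s) ≠ 0 := natCast_ne_zero_of_lt (by norm_num) (by omega)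
  have h3 : ((3 : ℕ) : ZMod s) ≠ 0 := natCast_ne_zero_of_lt (by norm_num) (by omega)
  have h4 : ((4 : ℕ) : ZMod s) ≠ 0 := natCast_ne_zero_of_lt (by norm_num) (by omega)
  push_cast at h1 h2 h3 h4
  fin_cases κ <;> simp only [chooserOffsets, List.mem_cons, List.not_mem_nil, or_false] at hd <;>
    rcases hd with rfl | hd <;> (try rcases hd with rfl | rfl) <;>
    simp [*]

theorem mem_chooser_zero {T C m : ℕ} {f : ZMod s → V} (hf : IsCyc G s f) {j : ZMod s}
    (h : (commonNbrs G (f (j - 1)) (f (j + 1))).card < T) :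
    f j ∈ chooser G col T C m 0 f j := by
  rw [sub_eq_add_neg] at h
  simp only [chooser]
  rw [if_pos h, mem_commonNbrs]
  refine ⟨?_, (hf.2 j).symm⟩
  have := hf.2 (j + -1)
  rwa [neg_add_cancel_right] at this

theorem mem_chooser_one {T C m : ℕ} {f : ZMod s → V} {a : ZMod s}
    (h : f (a + 1) ∈ levLeft (ThreeWalk G (f a) (f (a + 3))) C m (f (a + 2))) :
    f (a + 1) ∈ chooser G col T C m 1 f (a + 1) := by
  simp only [chooser]
  rwa [add_neg_cancel_right, show a + 1 + 2 = a + 3 by ring, show a + 1 + 1 = a + 2 by ring]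

theorem mem_chooser_two {T C m : ℕ} {f : ZMod s → V} {a : ZMod s}
    (h : f (a + 2) ∈ levRight (ThreeWalk G (f a) (f (a + 3))) C m (f (a + 1))) :
    f (a + 2) ∈ chooser G col T C m 2 f (a + 2) := by
  simp only [chooser]
  rwa [add_neg_cancel_right, show a + 2 + 1 = a + 3 by ring, show a + 2 + -1 = a + 1 by ring]

variable {p : ℕ}

theorem IsCyc.lev_threeWalk_or {f : ZMod s → V} (hf : IsCyc G s f) (C m : ℕ) (a : ZMod s) :
    lev (ThreeWalk G (f a) (f (a + 3))) C m (f (a + 1)) (f (a + 2)) ∨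
    f (a + 1) ∈ levLeft (ThreeWalk G (f a) (f (a + 3))) C m (f (a + 2)) ∨
    f (a + 2) ∈ levRight (ThreeWalk G (f a) (f (a + 3))) C m (f (a + 1)) := by
  refine lev_or_mem m ⟨hf.2 a, ?_, ?_⟩
  · have := hf.2 (a + 1)
    rwa [show a + 1 + 1 = a + 2 by ring] at this
  · have := hf.2 (a + 2)
    rwa [show a + 2 + 1 = a + 3 by ring] at this

/-- In a cycle of odd length with replaceable vertices, the inner vertices of each subpath of
length three are determined, up to few choices. -/
theorem IsCyc.not_lev_of_fat (hp : Proper G col) {q T C : ℕ} {f : ZMod (2 * p + 5) → V}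
    (hf : IsCyc G (2 * p + 5) f) (hfree : RainbowFree G col (2 * p + 5 + 2 * q))
    (hT : 7 * p + 12 ≤ T) (hC : 3 * (2 * p + 2 * q + 4) < C) {a : ZMod (2 * p + 5)}
    (hfat : ∀ j < p + 1, T ≤
      (commonNbrs G (f (a + 4 + 2 * (j : ℕ) - 1)) (f (a + 4 + 2 * (j : ℕ) + 1))).card) :
    ¬ lev (ThreeWalk G (f a) (f (a + 3))) C (2 * (q + 1)) (f (a + 1)) (f (a + 2)) := by
  classical
  intro hlev
  have hzero : ((2 * p + 5 : ℕ) : ZMod (2 * p + 5)) = 0 := ZMod.natCast_self _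
  push_cast at hzero
  -- The part of the cycle from `a + 3` round to `a` has `p + 1` double steps whose middle vertices
  -- are replaced. The resulting rainbow path on `2 * p + 3` vertices is then completed by `q + 1`
  -- zigzag steps through surviving inner pairs.
  let w : ℕ → V := fun j => f (a + 3 + 2 * j)
  have hinj : ∀ i j, i < j → j ≤ p + 1 → w i ≠ w j := by
    intro i j hij hj he
    have h1 := hf.1 he
    refine natCast_ne_zero_of_lt (s := 2 * p + 5) (j := 2 * (j - i)) (by omega) (by omega) ?_
    push_cast [Nat.cast_sub hij.le]
    linear_combination -h1
  have hw0 : w 0 = f (a + 3) := by simp [w]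
  have hwlast : w (p + 1) = f a := by
    simp only [w]
    congr 1
    push_cast
    linear_combination hzero
  obtain ⟨l, h1, h2, h3, -, -⟩ := RPath.prolong (G := G) (col := col) hp (w := w) (m := p + 1)
    (T := T) (l₀ := []) (d := w 0) (A := ∅) (Y := []) trivial rfl (fun j hj => by
      have := hfat j hj
      simp only [w]
      convert! this using 4 <;> (push_cast; ring)) hinj
    (by
      intro j hj1 hj2
      simpa using (hinj 0 j (by omega) hj2).symm)
    (by simp only [List.length_nil, Finset.card_empty]; omega)
  simp only [List.length_nil] at h3
  rw [hwlast] at h1 h2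
  rw [hw0] at h2
  refine RPath.zigzag hp (R := ThreeWalk G (f a) (f (a + 3))) (d := f (a + 3)) (C := C)
    (fun b c h => ⟨h.2.1, h.2.2⟩) q h1 h2 (Or.inr fun b c h => h.1) hlev (by omega) ?_
  convert! hfree using 1
  omega

/-- A version for subpaths next to a vertex that need not be replaceable. -/
theorem IsCyc.not_lev_of_color_ne (hp : Proper G col) {q T C : ℕ} {f : ZMod (2 * p + 5) → V}
    (hf : IsCyc G (2 * p + 5) f) (hfree : RainbowFree G col (2 * p + 5 + 2 * q))
    (hT : 7 * p + 12 ≤ T) (hC : 3 * (2 * p + 2 * q + 4) < C) {i : ZMod (2 * p + 5)}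
    (hfat : ∀ j < p, T ≤
      (commonNbrs G (f (i + 6 + 2 * (j : ℕ) - 1)) (f (i + 6 + 2 * (j : ℕ) + 1))).card)
    (hcol : col s(f i, f (i + 1)) ≠ col s(f (i + 4), f (i + 5))) :
    ¬ lev (ThreeWalk G (f (i + 1)) (f (i + 1 + 3))) C (2 * (q + 1)) (f (i + 1 + 1))
      (f (i + 1 + 2)) := by
  classical
  intro hlev
  have hzero : ((2 * p + 5 : ℕ) : ZMod (2 * p + 5)) = 0 := ZMod.natCast_self _
  push_cast at hzero
  rw [show i + 1 + 3 = i + 4 by ring] at hlev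
  have hne : ∀ m : ℕ, 0 < m → m < 2 * p + 5 → ∀ x y : ZMod (2 * p + 5), y = x + m →
      f x ≠ f y := by
    intro m h0 hm x y hxy he
    refine natCast_ne_zero_of_lt h0 hm ?_
    linear_combination -hf.1 he - hxy
  -- The edges from `i + 4` to `i + 5` and from `i` to `i + 1` are kept, since `i` and `i + 5` may
  -- not be replaceable, and have different colours. New vertices are inserted only on the way from
  -- `i + 5` round to `i`; they avoid `f (i + 1)`, and their edges avoid the colour of the last
  -- edge.
  let w : ℕ → V := fun j => f (i + 5 + 2 * j)
  have hinj : ∀ a b, a < b → b ≤ p → w a ≠ w b := by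
    intro a b hab hb
    refine hne (2 * (b - a)) (by omega) (by omega) _ _ ?_
    push_cast [Nat.cast_sub hab.le]
    ring
  have hw0 : w 0 = f (i + 5) := by simp [w]
  have hwlast : w p = f i := by
    simp only [w]
    congr 1
    linear_combination hzero
  have hadj : G.Adj (f (i + 4)) (f (i + 5)) := by
    have := hf.2 (i + 4)
    rwa [show i + 4 + 1 = i + 5 by ring] at this
  have hne1 : f (i + 1) ≠ f (i + 4) := hne 3 (by omega) (by omega) _ _ (by push_cast; ring)
  have hne2 : ∀ j ≤ p, f (i + 1) ≠ w j := fun j hj =>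
    hne (2 * j + 4) (by omega) (by omega) _ _ (by push_cast; ring)
  obtain ⟨l, h1, h2, h3, h4, h5⟩ := RPath.prolong (G := G) (col := col) hp (w := w) (m := p)
    (T := T) (l₀ := [f (i + 4)]) (d := f (i + 4)) (A := {f (i + 1)})
    (Y := [col s(f i, f (i + 1))])
    (by
      rw [hw0]
      exact ⟨hadj.symm, by simpa using hadj.ne', by simp [pathColors], trivial⟩)
    rfl (fun j hj => by
      have := hfat j hj
      simp only [w]
      convert! this using 4 <;> (push_cast; ring)) hinj
    (by
      intro j hj1 hj2
      rw [List.mem_cons, List.mem_singleton, not_or]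
      refine ⟨(hinj 0 j (by omega) hj2).symm, (hne (2 * j + 1) (by omega) (by omega) _ _ ?_).symm⟩
      push_cast; ring)
    (by
      simp only [List.length_cons, List.length_nil, Finset.card_singleton]
      omega)
  simp only [List.length_cons, List.length_nil] at h3
  have h6 : RPath G col (f (i + 1) :: w p :: l) := by
    refine rpath_cons h1 ?_ ?_ ?_
    · rw [hwlast]; exact hf.2 i
    · intro hmem
      rcases h4 _ hmem with h | ⟨j, _, hj, h⟩ | h
      · rw [List.mem_cons, List.mem_singleton] at h
        rcases h with h | h
        · exact hne2 0 (Nat.zero_le _) h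
        · exact hne1 h
      · exact hne2 j hj h
      · exact h (Finset.mem_singleton_self _)
    · rw [hwlast] at h5 ⊢
      intro hmem
      rcases h5 _ hmem with h | h
      · simp only [pathColors, List.mem_singleton] at h
        rw [hw0] at h
        exact hcol (h.trans (congrArg col Sym2.eq_swap))
      · exact h (List.mem_singleton_self _)
  refine RPath.zigzag hp (R := ThreeWalk G (f (i + 1)) (f (i + 4))) (d := f (i + 4)) (C := C)
    (fun b c h => ⟨h.2.1, h.2.2⟩) q h6 (by rw [List.getLast?_cons_cons]; exact h2)
    (Or.inr fun b c h => h.1) hlev (by simp only [List.length_cons]; omega) ?_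
  convert! hfree using 1
  simp only [List.length_cons]
  omega

/-- Call a position thin if its neighbours on the cycle have few common neighbours. Two thin
positions that are not adjacent suffice. Otherwise, if a thin position follows one that is not, only
it and its successor can be thin, and a second determined vertex is found opposite, either from an
equality of colours or from a three-edge subpath that cannot be rerouted. If no position is thin,
every three-edge subpath has a determined inner vertex, and two subpaths are combined. The vertex
`i` must be determined without reference to `j`; `j` may refer to `i`. -/
theorem IsCyc.exists_two_chooser (hp : Proper G col) {q T C : ℕ} {f : ZMod (2 * p + 5) → V}
    (hf : IsCyc G (2 * p + 5) f) (hfree : RainbowFree G col (2 * p + 5 + 2 * q))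
    (hT : 7 * p + 12 ≤ T) (hC : 3 * (2 * p + 2 * q + 4) < C) :
    ∃ κ κ' : Fin 4, ∃ i j : ZMod (2 * p + 5), i ≠ j ∧
      (∀ d ∈ chooserOffsets (2 * p + 5) κ, i + d ≠ j) ∧
      f i ∈ chooser G col T C (2 * (q + 1)) κ f i ∧
      f j ∈ chooser G col T C (2 * (q + 1)) κ' f j := by
  have h1 : ((1 : ℕ) : ZMod (2 * p + 5)) ≠ 0 := natCast_ne_zero_of_lt (by norm_num) (by omega)
  have h2 : ((2 : ℕ) : ZMod (2 * p + 5)) ≠ 0 := natCast_ne_zero_of_lt (by norm_num) (by omega)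
  have h3 : ((3 : ℕ) : ZMod (2 * p + 5)) ≠ 0 := natCast_ne_zero_of_lt (by norm_num) (by omega)
  have h4 : ((4 : ℕ) : ZMod (2 * p + 5)) ≠ 0 := natCast_ne_zero_of_lt (by norm_num) (by omega)
  push_cast at h1 h2 h3 h4
  have hzero : ((2 * p + 5 : ℕ) : ZMod (2 * p + 5)) = 0 := ZMod.natCast_self _
  push_cast at hzero
  let thin : ZMod (2 * p + 5) → Prop := fun i => (commonNbrs G (f (i - 1)) (f (i + 1))).card < T
  have hmem : ∀ i, thin i → f i ∈ chooser G col T C (2 * (q + 1)) 0 f i := fun i hi =>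
    mem_chooser_zero hf hi
  by_cases ha : ∃ i j, thin i ∧ thin j ∧ j ≠ i ∧ j ≠ i + -1 ∧ j ≠ i + 1
  · obtain ⟨i, j, hi, hj, n1, n2, n3⟩ := ha
    refine ⟨0, 0, i, j, n1.symm, ?_, hmem i hi, hmem j hj⟩
    simp only [chooserOffsets, List.mem_cons, List.not_mem_nil, or_false]
    rintro d (rfl | rfl)
    exacts [n2.symm, n3.symm]
  push Not at ha
  by_cases hb : ∃ i, thin i ∧ ¬ thin (i - 1)
  · obtain ⟨i, hi, hi'⟩ := hb
    have hfat : ∀ m : ℕ, 2 ≤ m → m < 2 * p + 5 → ¬ thin (i + m) := by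
      intro m hm hm' hthin
      have n0 : i + m ≠ i := fun h =>
        natCast_ne_zero_of_lt (s := 2 * p + 5) (by omega) hm' (by linear_combination h)
      have n1 : i + m ≠ i + -1 := fun h => hi' (by rwa [sub_eq_add_neg, ← h])
      have n2 := ha i _ hi hthin n0 n1
      refine natCast_ne_zero_of_lt (s := 2 * p + 5) (j := m - 1) (by omega) (by omega) ?_
      push_cast [Nat.cast_sub (show 1 ≤ m by omega)]
      linear_combination n2
    have hoff : ∀ m : ℕ, 2 ≤ m → m < 2 * p + 4 → i ≠ i + m ∧
        ∀ d ∈ chooserOffsets (2 * p + 5) 0, i + d ≠ i + m := by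
      intro m hm hm'
      refine ⟨fun h => natCast_ne_zero_of_lt (s := 2 * p + 5) (j := m) (by omega) (by omega)
        (by linear_combination -h), ?_⟩
      simp only [chooserOffsets, List.mem_cons, List.not_mem_nil, or_false]
      rintro d (rfl | rfl) h
      · refine natCast_ne_zero_of_lt (s := 2 * p + 5) (j := m + 1) (by omega) (by omega) ?_
        push_cast
        linear_combination -h
      · refine natCast_ne_zero_of_lt (s := 2 * p + 5) (j := m - 1) (by omega) (by omega) ?_
        push_cast [Nat.cast_sub (show 1 ≤ m by omega)]
        linear_combination -h
    by_cases hcol : col s(f i, f (i + 1)) = col s(f (i + 4), f (i + 5))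
    -- For a 5-cycle the two edges share the vertex `i = i + 5`, so equal colours are impossible.
    · rcases Nat.eq_zero_or_pos p with rfl | hp0
      · exfalso
        have e5 : i + 5 = i := by linear_combination hzero
        have hadj : G.Adj (f i) (f (i + 4)) := by
          have := (hf.2 (i + 4)).symm
          rwa [show i + 4 + 1 = i + 5 by ring, e5] at this
        rw [e5, Sym2.eq_swap (a := f (i + 4))] at hcol
        have := hf.1 (hp _ _ _ (hf.2 i) hadj hcol)
        exact h3 (by linear_combination -this)
      · have := hoff 4 (by omega) (by omega)
        push_cast at this
        refine ⟨0, 3, i, i + 4, this.1, this.2, hmem i hi, ?_⟩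
        simp only [chooser]
        rw [add_neg_cancel_right, show i + 4 + -3 = i + 1 by ring, show i + 4 + 1 = i + 5 by ring,
          mem_colorNbrs]
        have hadj := hf.2 (i + 4)
        rw [show i + 4 + 1 = i + 5 by ring] at hadj
        exact ⟨hadj.symm, by rw [hcol, Sym2.eq_swap]⟩
    · have hno := hf.not_lev_of_color_ne hp hfree hT hC (i := i) (fun j hj => not_lt.1 (by
        have := hfat (6 + 2 * j) (by omega) (by omega)
        push_cast at this
        rwa [← add_assoc] at this)) hcol
      rcases hf.lev_threeWalk_or C (2 * (q + 1)) (i + 1) with h | h | h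
      · exact absurd h hno
      · have := hoff 2 (by omega) (by omega)
        push_cast at this
        rw [show i + 2 = i + 1 + 1 by ring] at this
        exact ⟨0, 1, i, i + 1 + 1, this.1, this.2, hmem i hi, mem_chooser_one h⟩
      · have := hoff 3 (by omega) (by omega)
        push_cast at this
        rw [show i + 3 = i + 1 + 2 by ring] at this
        exact ⟨0, 2, i, i + 1 + 2, this.1, this.2, hmem i hi, mem_chooser_two h⟩
  · push Not at hb
    have hnone : ∀ i, ¬ thin i := by
      intro i hi
      have hi2 := hb _ (hb i hi)
      have n0 : i - 1 - 1 ≠ i := fun h => h2 (by linear_combination -h)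
      have n1 : i - 1 - 1 ≠ i + -1 := fun h => h1 (by linear_combination -h)
      have n2 := ha _ _ hi hi2 n0 n1
      exact h3 (by linear_combination -n2)
    have hno : ∀ a, f (a + 1) ∈ chooser G col T C (2 * (q + 1)) 1 f (a + 1) ∨
        f (a + 2) ∈ chooser G col T C (2 * (q + 1)) 2 f (a + 2) := by
      intro a
      rcases hf.lev_threeWalk_or C (2 * (q + 1)) a with h | h | h
      · exact absurd h (hf.not_lev_of_fat hp hfree hT hC fun j _ => not_lt.1 (hnone _))
      · exact Or.inl (mem_chooser_one h)
      · exact Or.inr (mem_chooser_two h)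
    obtain ⟨κ, j, hj⟩ : ∃ κ j, f j ∈ chooser G col T C (2 * (q + 1)) κ f j := by
      rcases hno 0 with h | h
      exacts [⟨_, _, h⟩, ⟨_, _, h⟩]
    -- The subpath starting at `j + 1` provides `j + 2` or `j + 3`, and the positions that these
    -- depend on lie within `j + 1, …, j + 4`, which do not include `j`.
    rcases hno (j + 1) with h | h
    · refine ⟨1, κ, j + 1 + 1, j, fun h => h2 (by linear_combination h), ?_, h, hj⟩
      simp only [chooserOffsets, List.mem_cons, List.not_mem_nil, or_false]
      rintro d (rfl | rfl | rfl) he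
      · exact h1 (by linear_combination he)
      · exact h3 (by linear_combination he)
      · exact h4 (by linear_combination he)
    · refine ⟨2, κ, j + 1 + 2, j, fun h => h3 (by linear_combination h), ?_, h, hj⟩
      simp only [chooserOffsets, List.mem_cons, List.not_mem_nil, or_false]
      rintro d (rfl | rfl | rfl) he
      · exact h1 (by linear_combination he)
      · exact h2 (by linear_combination he)
      · exact h4 (by linear_combination he)

end OddUpper

/-- Odd cycles in graphs without rainbow cycles of a given odd length that is not smaller. -/
theorem card_cycs_odd_odd_le (p q : ℕ) : ∃ C : ℕ, ∀ {V K : Type} [Fintype V] {G : SimpleGraph V}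
    {col : Sym2 V → K}, Proper G col → RainbowFree G col (2 * p + 5 + 2 * q) →
    (cycs G (2 * p + 5)).card ≤ C * Fintype.card V ^ (2 * p + 3) := by
  classical
  set T := 7 * p + 12
  set C := 3 * (2 * p + 2 * q + 4) + 1 with hC
  set m := 2 * (q + 1)
  refine ⟨(T + m * C + 1) ^ 2 * Fintype.card
    ((Fin 4 × Fin 4) × (ZMod (2 * p + 5) × ZMod (2 * p + 5))), fun {V K} _ {G col} hp hfree => ?_⟩
  rw [mul_right_comm]
  let good : (ZMod (2 * p + 5) → V) →
      (Fin 4 × Fin 4) × (ZMod (2 * p + 5) × ZMod (2 * p + 5)) → Prop := fun f b =>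
    b.2.1 ≠ b.2.2 ∧ (∀ d ∈ chooserOffsets (2 * p + 5) b.1.1, b.2.1 + d ≠ b.2.2) ∧
      f b.2.1 ∈ chooser G col T C m b.1.1 f b.2.1 ∧ f b.2.2 ∈ chooser G col T C m b.1.2 f b.2.2
  have hgood : ∀ f ∈ cycs G (2 * p + 5), ∃ b, good f b := by
    intro f hf
    obtain ⟨κ, κ', i, j, h⟩ := (mem_cycs.1 hf).exists_two_chooser hp hfree (T := T) (C := C) le_rfl
      (by omega)
    exact ⟨((κ, κ'), (i, j)), h⟩
  refine card_cycs_le_of_pattern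
    -- The default label is never attained by a cycle.
    (fun f => if h : ∃ b, good f b then h.choose else ((0, 0), (0, 0))) ?_
  rintro ⟨⟨κ, κ'⟩, i, j⟩ S hS hlab
  have hspec : ∀ f ∈ S, good f ((κ, κ'), (i, j)) := by
    intro f hf
    have h1 := hgood f (hS hf)
    have h2 := hlab f hf
    rw [dif_pos h1] at h2
    rw [← h2]
    exact h1.choose_spec
  rcases S.eq_empty_or_nonempty with rfl | ⟨f₀, hf₀⟩
  · simp
  obtain ⟨hij, hoff, -, -⟩ := hspec f₀ hf₀
  refine card_le_of_two_determined hij (fun f => chooser G col T C m κ f i)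
    (fun f => chooser G col T C m κ' f j) (fun f g h => chooser_congr fun d hd => h _ ?_ (hoff d hd))
    (fun f g h => chooser_congr fun d hd => h _ ?_)
    (fun f => card_chooser_le hp κ f i) (fun f => card_chooser_le hp κ' f j)
    fun f hf => ⟨(hspec f hf).2.2.1, (hspec f hf).2.2.2⟩
  · exact fun he => chooserOffsets_ne_zero (by omega) hd (by linear_combination he)
  · exact fun he => chooserOffsets_ne_zero (by omega) hd (by linear_combination he)

/-! ### Lower bounds for odd `t`: blow-ups of a cycle -/

section Levels

variable {s t : ℕ} {X : Type*}

/-- The graph whose vertex set consists of levels arranged in a cycle, where `R i` says which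
vertices of level `i` are joined to which vertices of level `i + 1`. -/
def levelGraph (R : ZMod s → X → X → Prop) : SimpleGraph (ZMod s × X) :=
  SimpleGraph.fromRel fun p q => q.1 = p.1 + 1 ∧ R p.1 p.2 q.2

theorem isCyc_levelGraph (hs : 2 ≤ s) {R : ZMod s → X → X → Prop} {g : ZMod s → X}
    (hg : ∀ i, R i (g i) (g (i + 1))) : IsCyc (levelGraph R) s fun i => (i, g i) := by
  refine ⟨fun i j h => (Prod.mk.inj h).1, fun i => ?_⟩
  rw [levelGraph, SimpleGraph.fromRel_adj]
  refine ⟨fun h => natCast_ne_zero_of_lt (s := s) (j := 1) one_pos (by omega) ?_,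
    Or.inl ⟨rfl, hg i⟩⟩
  have := (Prod.mk.inj h).1
  push_cast
  linear_combination -this

open scoped Classical in
/-- All edges have their own colour, except that the edges joining vertices with the same second
coordinate at the levels in `E` have the same colour. -/
noncomputable def levelCol (E : Set (ZMod s)) (e : Sym2 (ZMod s × X)) :
    Option (Sym2 (ZMod s × X)) :=
  if ∃ i ∈ E, ∃ x, e = s((i, x), (i + 1, x)) then none else some e

theorem levelCol_eq_none {E : Set (ZMod s)} {e : Sym2 (ZMod s × X)} :
    levelCol E e = none ↔ ∃ i ∈ E, ∃ x, e = s((i, x), (i + 1, x)) := by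
  simp [levelCol]

/-- No two members of `E` are consecutive, so the edges of the common colour form a matching; every
other edge has a colour of its own. -/
theorem proper_levelCol (E : Set (ZMod s)) (hE : ∀ i ∈ E, i + 1 ∉ E)
    (R : ZMod s → X → X → Prop) : Proper (levelGraph R) (levelCol E) := by
  intro a b c hab hac h
  by_cases h1 : levelCol E s(a, b) = none
  · obtain ⟨i, hi, x, hx⟩ := levelCol_eq_none.1 h1
    obtain ⟨j, hj, y, hy⟩ := levelCol_eq_none.1 (h ▸ h1)
    rw [Sym2.eq_iff] at hx hy
    rcases hx with ⟨rfl, rfl⟩ | ⟨rfl, rfl⟩ <;> rcases hy with ⟨h2, rfl⟩ | ⟨h2, rfl⟩ <;>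
      obtain ⟨h3, rfl⟩ := Prod.mk.inj h2
    · rw [h3]
    · subst h3; exact absurd hi (hE _ hj)
    · subst h3; exact absurd hj (hE _ hi)
    · rw [add_right_cancel h3]
  · have h2 : levelCol E s(a, c) ≠ none := h ▸ h1
    have h3 : ∀ e : Sym2 (ZMod s × X), levelCol E e ≠ none → levelCol E e = some e := by
      intro e he
      rw [levelCol] at he ⊢
      split_ifs at he ⊢
      · exact absurd rfl he
      · rfl
    rw [h3 _ h1, h3 _ h2] at h
    exact Sym2.congr_right.1 (Option.some.inj h)

theorem rainbowFree_levelCol {E : Set (ZMod s)} {R : ZMod s → X → X → Prop}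
    (h : ∀ f, IsCyc (levelGraph R) t f → ∃ i j, i ≠ j ∧ levelCol E s(f i, f (i + 1)) = none ∧
      levelCol E s(f j, f (j + 1)) = none) : RainbowFree (levelGraph R) (levelCol E) t := by
  intro f hf hinj
  obtain ⟨i, j, hij, hi, hj⟩ := h f hf
  exact hij (hinj (hi.trans hj.symm))

/-- The step from `a` to `b` passes between the levels `i` and `i + 1`. -/
def Passes (i a b : ZMod s) : Prop :=
  (a = i ∧ b = i + 1) ∨ (a = i + 1 ∧ b = i)

theorem levelGraph_adj {R : ZMod s → X → X → Prop} {p q : ZMod s × X}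
    (h : (levelGraph R).Adj p q) :
    (q.1 = p.1 + 1 ∧ R p.1 p.2 q.2) ∨ (p.1 = q.1 + 1 ∧ R q.1 q.2 p.2) :=
  ((SimpleGraph.fromRel_adj _ _ _).1 h).2

theorem exists_passes {R : ZMod s → X → X → Prop} {p q : ZMod s × X}
    (h : (levelGraph R).Adj p q) : ∃ i, Passes i p.1 q.1 := by
  rcases levelGraph_adj h with h | h
  · exact ⟨_, Or.inl ⟨rfl, h.1⟩⟩
  · exact ⟨_, Or.inr ⟨h.1, rfl⟩⟩

theorem Passes.eq {s : ℕ} (hs : 3 ≤ s) {i j a b : ZMod s} (h : Passes i a b) (h' : Passes j a b) :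
    i = j := by
  have h2 : ((2 : ℕ) : ZMod s) ≠ 0 := natCast_ne_zero_of_lt (by norm_num) (by omega)
  push_cast at h2
  rcases h with ⟨rfl, rfl⟩ | ⟨rfl, rfl⟩ <;> rcases h' with ⟨h3, h4⟩ | ⟨h3, h4⟩
  · exact h3
  · exact absurd (by linear_combination h4 - h3) h2
  · exact absurd (by linear_combination h3 - h4) h2
  · exact h4

/-- A closed walk along which a parity changes in each step has even length. -/
theorem even_of_parity_change {φ : ZMod t → ℕ} (h : ∀ i, φ (i + 1) % 2 ≠ φ i % 2) : Even t := by
  have key : ∀ n : ℕ, φ n % 2 = (φ 0 + n) % 2 := by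
    intro n
    induction n with
    | zero => simp
    | succ n ih =>
      have := h n
      push_cast
      omega
  have h1 := key t
  rw [ZMod.natCast_self] at h1
  exact Nat.even_iff.2 (by omega)

theorem val_add_one_parity [NeZero s] {a : ZMod s} (h : Even s ∨ a + 1 ≠ 0) :
    (a + 1).val % 2 ≠ a.val % 2 := by
  rcases val_add_one_cases a with h1 | h1
  · omega
  · rcases h with h | h
    · obtain ⟨k, hk⟩ := h; omega
    · exact absurd ((ZMod.val_eq_zero _).1 h1.2) h

theorem even_of_levels [NeZero s] (hs : Even s) {L : ZMod t → ZMod s}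
    (hL : ∀ j, ∃ i, Passes i (L j) (L (j + 1))) : Even t := by
  refine even_of_parity_change (φ := fun j => (L j).val) fun j => ?_
  obtain ⟨i, ⟨h1, h2⟩ | ⟨h1, h2⟩⟩ := hL j <;> simp only [h1, h2]
  · exact val_add_one_parity (Or.inl hs)
  · exact (val_add_one_parity (Or.inl hs)).symm

/-- A closed walk of odd length passes between any two consecutive levels. -/
theorem exists_passes_of_odd [NeZero s] (ht : Odd t) {L : ZMod t → ZMod s}
    (hL : ∀ j, ∃ i, Passes i (L j) (L (j + 1))) (i : ZMod s) :
    ∃ j, Passes i (L j) (L (j + 1)) := by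
  by_contra hcon
  push Not at hcon
  -- Shifting the levels by `i + 1` moves the passage that is not used to the jump of `val` from `s
  -- - 1` to 0. All other steps change the parity, so the walk would have even length.
  refine Nat.not_even_iff_odd.2 ht
    (even_of_parity_change (φ := fun j => (L j - (i + 1)).val) fun j => ?_)
  obtain ⟨i', h⟩ := hL j
  have hne : i' ≠ i := by rintro rfl; exact hcon j h
  have hp := val_add_one_parity (a := i' - (i + 1)) (Or.inr fun h => hne (by linear_combination h))
  rw [show i' - (i + 1) + 1 = i' + 1 - (i + 1) by ring] at hp
  rcases h with ⟨h1, h2⟩ | ⟨h1, h2⟩ <;> simp only [h1, h2]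
  · exact hp
  · exact hp.symm

theorem levelCol_eq_none_of_passes {E : Set (ZMod s)} {R : ZMod s → X → X → Prop} (hs : 3 ≤ s)
    (hR : ∀ i ∈ E, ∀ x y, R i x y → x = y) {p q : ZMod s × X} (h : (levelGraph R).Adj p q)
    {i : ZMod s} (hi : i ∈ E) (hpass : Passes i p.1 q.1) : levelCol E s(p, q) = none := by
  obtain ⟨a, x⟩ := p
  obtain ⟨b, y⟩ := q
  rw [levelCol_eq_none]
  refine ⟨i, hi, x, ?_⟩
  have h2 : ((2 : ℕ) : ZMod s) ≠ 0 := natCast_ne_zero_of_lt (by norm_num) (by omega)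
  push_cast at h2
  rcases hpass with ⟨h3, h4⟩ | ⟨h3, h4⟩ <;> simp only at h3 h4 <;> subst h3 <;> subst h4 <;>
    rcases levelGraph_adj h with ⟨h5, h6⟩ | ⟨h5, h6⟩ <;> simp only at h5 h6
  · rw [hR _ hi _ _ h6]
  · exact absurd (by linear_combination -h5) h2
  · exact absurd (by linear_combination -h5) h2
  · rw [hR _ hi _ _ h6]
    exact Sym2.eq_swap

/-- Each of the `s` levels receives `M + 1 = n / s` vertices. The `a` free choices parametrise
distinct cycles that meet every level once, and `n ≤ 2 * s * (M + 1)` turns their number into a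
multiple of `n ^ a`. -/
theorem exists_forall_eventually_le {s t a : ℕ} (hs : 2 ≤ s) (ht : 3 ≤ t)
    (h : ∀ M : ℕ, ∃ (R : ZMod s → Fin (M + 1) → Fin (M + 1) → Prop) (E : Set (ZMod s)),
      (∀ i ∈ E, i + 1 ∉ E) ∧ RainbowFree (levelGraph R) (levelCol E) t ∧
      ∃ Φ : (Fin a → Fin (M + 1)) → ZMod s → Fin (M + 1), Function.Injective Φ ∧
        ∀ h i, R i (Φ h i) (Φ h (i + 1))) :
    ∃ C : ℕ, ∀ᶠ n : ℕ in atTop, n ^ a ≤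
      C * rainbowEx n (SimpleGraph.cycleGraph s) (SimpleGraph.cycleGraph t) := by
  have : NeZero s := ⟨by omega⟩
  refine ⟨(2 * s) ^ a * s ^ s, ?_⟩
  filter_upwards [eventually_ge_atTop s] with n hn
  obtain ⟨M, hM⟩ : ∃ M, n / s = M + 1 :=
    ⟨n / s - 1, by have := Nat.div_pos hn (by omega : 0 < s); omega⟩
  have h1 : s * (M + 1) ≤ n := hM ▸ Nat.mul_div_le n s
  have h2 : n ≤ 2 * s * (M + 1) := by
    have := Nat.lt_mul_div_succ n (show 0 < s by omega)
    rw [hM] at this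
    nlinarith
  obtain ⟨R, E, hE, hfree, Φ, hΦ, hR⟩ := h M
  have h3 := card_cycs_le_rainbowEx hs ht (n := n) (by simpa [ZMod.card] using h1)
    (proper_levelCol E hE R) hfree
  have h4 : (M + 1) ^ a ≤ (cycs (levelGraph R) s).card := by
    have := Finset.card_le_card_of_injOn (s := (Finset.univ : Finset (Fin a → Fin (M + 1))))
      (t := cycs (levelGraph R) s) (fun h i => (i, Φ h i))
      (fun h _ => mem_cycs.2 (isCyc_levelGraph hs (hR h)))
      (fun h _ h' _ he => hΦ (funext fun i => (Prod.mk.inj (congrFun he i)).2))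
    simpa using this
  calc n ^ a ≤ (2 * s * (M + 1)) ^ a := Nat.pow_le_pow_left h2 a
    _ = (2 * s) ^ a * (M + 1) ^ a := mul_pow _ _ _
    _ ≤ (2 * s) ^ a * (s ^ s * rainbowEx n (SimpleGraph.cycleGraph s)
        (SimpleGraph.cycleGraph t)) := Nat.mul_le_mul_left _ (h4.trans h3)
    _ = _ := by ring

/-- The complete blow-up of `C_s` contains no `C_t`: an odd closed walk would have to cross all `s`
gaps between consecutive levels, in different steps, so that `s ≤ t`; and for even `s` the blow-up
is bipartite. -/
theorem lower_odd_even {s t : ℕ} (hs : 3 ≤ s) (ht : 3 ≤ t) (hodd : Odd t) (h : t < s ∨ Even s) :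
    ∃ C : ℕ, ∀ᶠ n : ℕ in atTop, n ^ s ≤
      C * rainbowEx n (SimpleGraph.cycleGraph s) (SimpleGraph.cycleGraph t) := by
  classical
  have : NeZero s := ⟨by omega⟩
  have : NeZero t := ⟨by omega⟩
  refine exists_forall_eventually_le (by omega) ht fun M =>
    ⟨fun _ _ _ => True, ∅, by simp, ?_, ?_⟩
  · intro f hf
    exfalso
    have hL : ∀ j, ∃ i, Passes i (f j).1 (f (j + 1)).1 := fun j => exists_passes (hf.2 j)
    rcases h with h | h
    · have hall := exists_passes_of_odd hodd (L := fun j => (f j).1) hL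
      choose g hg using hall
      have := Fintype.card_le_of_injective g fun i j hij => by
        have h1 := hg i
        rw [hij] at h1
        exact h1.eq hs (hg j)
      rw [ZMod.card, ZMod.card] at this
      omega
    · exact Nat.not_even_iff_odd.2 hodd (even_of_levels h (L := fun j => (f j).1) hL)
  · let e : ZMod s ≃ Fin s := Fintype.equivOfCardEq (by simp [ZMod.card])
    exact ⟨fun h i => h (e i), fun h h' he => funext fun x => by
      simpa using congrFun he (e.symm x), fun _ _ => trivial⟩

/-- Perfect matchings of one common colour join the levels 0, 1 and the levels 2, 3. Every odd cycle
crosses both gaps and so repeats the colour. In an `s`-cycle round the levels, positions 1 and 3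
copy 0 and 2, and the other `s - 2` are free. -/
theorem lower_odd_odd {s t : ℕ} (hs : 4 ≤ s) (ht : 3 ≤ t) (hodd : Odd t) :
    ∃ C : ℕ, ∀ᶠ n : ℕ in atTop, n ^ (s - 2) ≤
      C * rainbowEx n (SimpleGraph.cycleGraph s) (SimpleGraph.cycleGraph t) := by
  classical
  have : NeZero s := ⟨by omega⟩
  have : NeZero t := ⟨by omega⟩
  have h1 : ((1 : ℕ) : ZMod s) ≠ 0 := natCast_ne_zero_of_lt (by norm_num) (by omega)
  have h2 : ((2 : ℕ) : ZMod s) ≠ 0 := natCast_ne_zero_of_lt (by norm_num) (by omega)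
  have h3 : ((3 : ℕ) : ZMod s) ≠ 0 := natCast_ne_zero_of_lt (by norm_num) (by omega)
  push_cast at h1 h2 h3
  refine exists_forall_eventually_le (by omega) ht fun M =>
    ⟨fun i x y => i ∈ ({0, 2} : Set (ZMod s)) → x = y, {0, 2}, ?_, ?_, ?_⟩
  · simp only [Set.mem_insert_iff, Set.mem_singleton_iff, not_or]
    rintro i (rfl | rfl)
    · exact ⟨fun h => h1 (by linear_combination h), fun h => h1 (by linear_combination -h)⟩
    · exact ⟨fun h => h3 (by linear_combination h), fun h => h1 (by linear_combination h)⟩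
  · refine rainbowFree_levelCol fun f hf => ?_
    have hall := exists_passes_of_odd hodd (L := fun j => (f j).1)
      (fun j => exists_passes (hf.2 j))
    obtain ⟨i, hi⟩ := hall 0
    obtain ⟨j, hj⟩ := hall 2
    refine ⟨i, j, ?_, ?_, ?_⟩
    · rintro rfl
      exact h2 (hi.eq (by omega) hj).symm
    · exact levelCol_eq_none_of_passes (by omega) (fun i hi x y h => h hi) (hf.2 i) (by simp) hi
    · exact levelCol_eq_none_of_passes (by omega) (fun i hi x y h => h hi) (hf.2 j) (by simp) hj
  · let I : Finset (ZMod s) := {1, 3}ᶜ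
    have hI : Fintype.card I = Fintype.card (Fin (s - 2)) := by
      rw [Fintype.card_coe, Fintype.card_fin, Finset.card_compl, ZMod.card,
        Finset.card_pair fun h => h2 (by linear_combination -h)]
    let e : I ≃ Fin (s - 2) := Fintype.equivOfCardEq hI
    let ψ : (Fin (s - 2) → Fin (M + 1)) → ZMod s → Fin (M + 1) := fun h i =>
      if hi : i ∈ I then h (e ⟨i, hi⟩) else 0
    refine ⟨fun h i => if i = 1 then ψ h 0 else if i = 3 then ψ h 2 else ψ h i, ?_, ?_⟩
    · intro h h' he
      funext x
      have h4 := congrFun he (e.symm x)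
      obtain ⟨y, hy⟩ : ∃ y, e y = x := ⟨e.symm x, by simp⟩
      subst hy
      obtain ⟨y, hy⟩ := y
      have h5 : y ≠ 1 ∧ y ≠ 3 := by simpa [I] using hy
      simp only [Equiv.symm_apply_apply, h5.1, h5.2, if_false, ψ, hy, dif_pos] at h4
      exact h4
    · intro h i hi
      have n1 : (0 : ZMod s) ≠ 1 := fun h => h1 (by linear_combination -h)
      have n2 : (0 : ZMod s) ≠ 3 := fun h => h3 (by linear_combination -h)
      have n3 : (2 : ZMod s) ≠ 1 := fun h => h1 (by linear_combination h)
      have n4 : (2 : ZMod s) ≠ 3 := fun h => h1 (by linear_combination -h)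
      have n5 : (3 : ZMod s) ≠ 1 := fun h => h2 (by linear_combination h)
      rcases hi with rfl | hi
      · simp [n1, n2]
      · rw [Set.mem_singleton_iff] at hi
        subst hi
        have : (2 : ZMod s) + 1 = 3 := by ring
        simp [n3, n4, this, n5]

end Levels

/-! ### Lower bounds for even `t ≥ 6`: blowing up some of the vertices -/

section BigLevels

variable {s t : ℕ} {X : Type*} [Zero X]

/-- At the levels outside `B` only the vertex `0` is used, between two levels in `B` there is a
perfect matching, and all other edges between used vertices of consecutive levels are present. -/
def bigRel (B : Set (ZMod s)) (i : ZMod s) (x y : X) : Prop :=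
  (i ∉ B → x = 0) ∧ (i + 1 ∉ B → y = 0) ∧ (i ∈ B → i + 1 ∈ B → x = y)

theorem bigRel_adj {B : Set (ZMod s)} {p q : ZMod s × X}
    (h : (levelGraph (bigRel B)).Adj p q) :
    (q.1 = p.1 + 1 ∨ p.1 = q.1 + 1) ∧ (p.1 ∉ B → p.2 = 0) ∧ (p.1 ∈ B → q.1 ∈ B → p.2 = q.2) := by
  rcases levelGraph_adj h with ⟨h1, h2, h3, h4⟩ | ⟨h1, h2, h3, h4⟩
  · rw [← h1] at h4
    exact ⟨Or.inl h1, h2, h4⟩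
  · rw [← h1] at h3 h4
    exact ⟨Or.inr h1, h3, fun hp hq => (h4 hq hp).symm⟩

theorem levelCol_bigRel_eq_none (hs : 3 ≤ s) {B : Set (ZMod s)} {p q : ZMod s × X}
    (h : (levelGraph (bigRel B)).Adj p q) (hp : p.1 ∈ B) (hq : q.1 ∈ B) :
    levelCol {i | i ∈ B ∧ i + 1 ∈ B} s(p, q) = none := by
  obtain ⟨i, hi⟩ := exists_passes h
  refine levelCol_eq_none_of_passes hs (fun i hi x y h => h.2.2 hi.1 hi.2) h (i := i) ?_ hi
  rcases hi with ⟨h1, h2⟩ | ⟨h1, h2⟩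
  · exact ⟨h1 ▸ hp, h2 ▸ hq⟩
  · exact ⟨h2 ▸ hq, h1 ▸ hp⟩

/-- A cycle without two edges of the common colour goes steadily round the levels. -/
theorem levels_of_isCyc (hs : 3 ≤ s) (ht : 5 ≤ t) {B : Set (ZMod s)} {f : ZMod t → ZMod s × X}
    (hf : IsCyc (levelGraph (bigRel B)) t f)
    (hno : ¬ ∃ i j, i ≠ j ∧ levelCol {i | i ∈ B ∧ i + 1 ∈ B} s(f i, f (i + 1)) = none ∧
      levelCol {i | i ∈ B ∧ i + 1 ∈ B} s(f j, f (j + 1)) = none) :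
    (∀ n : ℕ, (f n).1 = (f 0).1 + n) ∨ ∀ n : ℕ, (f n).1 = (f 0).1 - n := by
  have hne : ∀ m : ℕ, 0 < m → m < t → ∀ x y : ZMod t, y = x + m → f x ≠ f y := by
    intro m h0 hm x y hxy he
    refine natCast_ne_zero_of_lt h0 hm ?_
    linear_combination -hf.1 he - hxy
  have hzero : ∀ j, (f j).1 ∉ B → (f j).2 = 0 := fun j => (bigRel_adj (hf.2 j)).2.1
  have hstep : ∀ j, (f (j + 1)).1 = (f j).1 + 1 ∨ (f j).1 = (f (j + 1)).1 + 1 := fun j =>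
    (bigRel_adj (hf.2 j)).1
  -- Suppose the cycle turns back at `j + 1`. Then the level of `j` is in `B`, as it contains two
  -- vertices, and that of `j + 1` is not, as a matching allows no turn. So `f (j + 1)` is alone on
  -- its level, and `j - 1` and `j + 3` both lie on the level at the other side of `j`. If that
  -- level is in `B`, two matching edges repeat the common colour; if not, `f (j - 1) = f (j + 3)`,
  -- which is excluded by `t ≥ 5`.
  have hback : ∀ j, (f (j + 1 + 1)).1 ≠ (f j).1 := by
    intro j he
    have hb : (f j).1 ∈ B := by
      by_contra hb
      refine hne 2 (by omega) (by omega) j (j + 1 + 1) (by push_cast; ring) (Prod.ext he.symm ?_)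
      rw [hzero _ hb, hzero _ (he ▸ hb)]
    have hc : (f (j + 1)).1 ∉ B := by
      intro hc
      refine hne 2 (by omega) (by omega) j (j + 1 + 1) (by push_cast; ring) (Prod.ext he.symm ?_)
      rw [(bigRel_adj (hf.2 j)).2.2 hb hc, (bigRel_adj (hf.2 (j + 1))).2.2 hc (he ▸ hb)]
    have hc0 := hzero _ hc
    have d1 : (f (j - 1)).1 ≠ (f (j + 1)).1 := by
      intro h
      refine hne 2 (by omega) (by omega) (j - 1) (j + 1) (by push_cast; ring) (Prod.ext h ?_)
      rw [hzero _ (h ▸ hc), hc0]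
    have d2 : (f (j + 1 + 1 + 1)).1 ≠ (f (j + 1)).1 := by
      intro h
      refine hne 2 (by omega) (by omega) (j + 1) (j + 1 + 1 + 1) (by push_cast; ring)
        (Prod.ext h.symm ?_)
      rw [hc0, hzero (j + 1 + 1 + 1) (h ▸ hc)]
    have hadj := hf.2 (j - 1)
    rw [sub_add_cancel] at hadj
    have e : (f (j - 1)).1 = (f (j + 1 + 1 + 1)).1 := by
      have s1 := (bigRel_adj hadj).1
      have s2 := hstep j
      have s3 := hstep (j + 1 + 1)
      rw [he] at s3
      rcases s2 with s2 | s2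
      · have s1' : (f j).1 = (f (j - 1)).1 + 1 :=
          s1.resolve_right fun h => d1 (h.trans s2.symm)
        have s3' : (f j).1 = (f (j + 1 + 1 + 1)).1 + 1 :=
          s3.resolve_left fun h => d2 (h.trans s2.symm)
        exact add_right_cancel (s1'.symm.trans s3')
      · have s1' : (f (j - 1)).1 = (f j).1 + 1 :=
          s1.resolve_left fun h => d1 (add_right_cancel (h.symm.trans s2))
        have s3' : (f (j + 1 + 1 + 1)).1 = (f j).1 + 1 :=
          s3.resolve_right fun h => d2 (add_right_cancel (h.symm.trans s2))
        exact s1'.trans s3'.symm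
    by_cases hd : (f (j - 1)).1 ∈ B
    · refine hno ⟨j - 1, j + 1 + 1, ?_, ?_, ?_⟩
      · exact fun h => hne 3 (by omega) (by omega) (j - 1) (j + 1 + 1) (by push_cast; ring)
          (congrArg f h)
      · rw [sub_add_cancel]
        exact levelCol_bigRel_eq_none hs hadj hd hb
      · exact levelCol_bigRel_eq_none hs (hf.2 _) (he ▸ hb) (e ▸ hd)
    · refine hne 4 (by omega) (by omega) (j - 1) (j + 1 + 1 + 1) (by push_cast; ring)
        (Prod.ext e ?_)
      rw [hzero _ hd, hzero _ (e ▸ hd)]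
  rcases hstep 0 with h0 | h0
  · left
    have key : ∀ n : ℕ, (f (n + 1)).1 = (f n).1 + 1 := by
      intro n
      induction n with
      | zero => simpa using h0
      | succ n ih =>
        push_cast
        exact (hstep _).resolve_right fun h => hback n (add_right_cancel (h.symm.trans ih))
    intro n
    induction n with
    | zero => simp
    | succ n ih =>
      push_cast
      rw [key, ih]
      ring
  · right
    have key : ∀ n : ℕ, (f n).1 = (f (n + 1)).1 + 1 := by
      intro n
      induction n with
      | zero => simpa using h0
      | succ n ih =>
        push_cast
        exact (hstep _).resolve_left fun h => hback n (h.trans ih.symm)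
    intro n
    induction n with
    | zero => simp
    | succ n ih =>
      push_cast
      have := key n
      linear_combination ih - this

theorem exists_passes_of_steady [NeZero s] {L : ℕ → ZMod s}
    (h : (∀ n, L n = L 0 + n) ∨ ∀ n, L n = L 0 - n) (i : ZMod s) :
    ∃ n, Passes i (L n) (L (n + 1)) := by
  rcases h with h | h
  · refine ⟨(i - L 0).val, Or.inl ⟨?_, ?_⟩⟩ <;> rw [h] <;> push_cast <;>
      rw [ZMod.natCast_zmod_val] <;> ring
  · refine ⟨(L 0 - i - 1).val, Or.inr ⟨?_, ?_⟩⟩ <;> rw [h] <;> push_cast <;>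
      rw [ZMod.natCast_zmod_val] <;> ring

/-- Returning after `t` steps gives `s ∣ t`. The single vertex of level 0 is met again after `s`
steps, which gives `t ∣ s`. -/
theorem eq_of_steady [NeZero s] {B : Set (ZMod s)} (h0 : (0 : ZMod s) ∉ B)
    {f : ZMod t → ZMod s × X} (hf : IsCyc (levelGraph (bigRel B)) t f)
    (h : (∀ n : ℕ, (f n).1 = (f 0).1 + n) ∨ ∀ n : ℕ, (f n).1 = (f 0).1 - n) : s = t := by
  refine Nat.dvd_antisymm ?_ ?_
  · rw [← ZMod.natCast_eq_zero_iff]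
    rcases h with h | h
    · have := h t
      rw [ZMod.natCast_self] at this
      linear_combination -this
    · have := h t
      rw [ZMod.natCast_self] at this
      linear_combination this
  · rw [← ZMod.natCast_eq_zero_iff]
    obtain ⟨n, hn, hn'⟩ : ∃ n : ℕ, (f n).1 = 0 ∧ (f (n + s : ℕ)).1 = 0 := by
      rcases h with h | h
      · refine ⟨(-(f 0).1).val, ?_, ?_⟩ <;> rw [h] <;> simp
      · refine ⟨((f 0).1).val, ?_, ?_⟩ <;> rw [h] <;> simp
    have hzero : ∀ j, (f j).1 = 0 → f j = (0, 0) := fun j hj =>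
      Prod.ext hj ((bigRel_adj (hf.2 j)).2.1 (hj ▸ h0))
    have := hf.1 ((hzero _ hn').trans (hzero _ hn).symm)
    push_cast at this
    linear_combination this

/-- A rainbow cycle has at most one edge of the common colour, so it goes steadily round the levels.
Its length is then `s`, and it uses an edge of every matching, hence two edges of the common colour
if there are two matchings. -/
theorem rainbowFree_bigRel [NeZero s] (hs : 3 ≤ s) (ht : 5 ≤ t) {B : Set (ZMod s)}
    (h0 : (0 : ZMod s) ∉ B)
    (h : s ≠ t ∨ ∃ i j : ZMod s, i ≠ j ∧ (i ∈ B ∧ i + 1 ∈ B) ∧ j ∈ B ∧ j + 1 ∈ B) :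
    RainbowFree (levelGraph (bigRel (X := X) B)) (levelCol {i | i ∈ B ∧ i + 1 ∈ B}) t := by
  refine rainbowFree_levelCol fun f hf => ?_
  by_contra hno
  have hL := levels_of_isCyc hs ht hf hno
  rcases h with h | ⟨i, j, hij, hi, hj⟩
  · exact h (eq_of_steady h0 hf hL)
  · have hL' : (∀ n : ℕ, (fun n : ℕ => (f n).1) n = (fun n : ℕ => (f n).1) 0 + n) ∨
        ∀ n : ℕ, (fun n : ℕ => (f n).1) n = (fun n : ℕ => (f n).1) 0 - n := by
      simpa using hL
    obtain ⟨m, hm⟩ := exists_passes_of_steady hL' i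
    obtain ⟨n, hn⟩ := exists_passes_of_steady hL' j
    push_cast at hm hn
    refine hno ⟨m, n, ?_, ?_, ?_⟩
    · intro he
      rw [he] at hm
      exact hij (hm.eq hs hn)
    · exact levelCol_eq_none_of_passes hs (fun i hi x y h => h.2.2 hi.1 hi.2) (hf.2 _)
        (i := i) hi hm
    · exact levelCol_eq_none_of_passes hs (fun i hi x y h => h.2.2 hi.1 hi.2) (hf.2 _)
        (i := j) hj hn

/-- The predicate `b` marks the big levels, and `idx` names the free choice that a big level uses;
matched levels use the same one. Level 0 is small, so no matching runs across the end of the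
numbering, and no three consecutive big levels means that matchings do not touch. -/
theorem exists_forall_eventually_le_of_big {s t a : ℕ} (hs : 3 ≤ s) (ht : 5 ≤ t) {b : ℕ → Prop}
    {idx : ℕ → ℕ} (h0 : ¬ b 0) (h3 : ∀ v, b v → b (v + 1) → ¬ b (v + 2))
    (hidx : ∀ v, b v → b (v + 1) → idx v = idx (v + 1)) (hsurj : ∀ m < a, ∃ v < s, b v ∧ idx v = m)
    (h : s ≠ t ∨ ∃ v w, v < w ∧ w + 1 < s ∧ (b v ∧ b (v + 1)) ∧ b w ∧ b (w + 1)) :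
    ∃ C : ℕ, ∀ᶠ n : ℕ in atTop, n ^ a ≤
      C * rainbowEx n (SimpleGraph.cycleGraph s) (SimpleGraph.cycleGraph t) := by
  classical
  have : NeZero s := ⟨by omega⟩
  set B : Set (ZMod s) := {i | b i.val} with hB
  have hcons : ∀ i, i ∈ B → i + 1 ∈ B → b i.val ∧ b (i.val + 1) ∧ (i + 1).val = i.val + 1 := by
    intro i hi hi1
    rcases val_add_one_cases i with h1 | h1
    · exact ⟨hi, h1.2 ▸ hi1, h1.2⟩
    · rw [hB, Set.mem_ofPred_eq, h1.2] at hi1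
      exact absurd hi1 h0
  refine exists_forall_eventually_le (by omega) (by omega) fun M =>
    ⟨bigRel B, {i | i ∈ B ∧ i + 1 ∈ B}, ?_, ?_, ?_⟩
  · rintro i ⟨h1, h2⟩ ⟨-, h4⟩
    obtain ⟨e1, e2, e3⟩ := hcons i h1 h2
    obtain ⟨-, e4, -⟩ := hcons _ h2 h4
    rw [e3] at e4
    exact h3 _ e1 e2 e4
  · refine rainbowFree_bigRel hs ht ?_ (h.imp_right ?_)
    · rw [hB, Set.mem_ofPred_eq, ZMod.val_zero]
      exact h0
    · rintro ⟨v, w, hvw, hw, hv, hw'⟩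
      have hval : ∀ v, v + 1 < s → b v ∧ b (v + 1) → (v : ZMod s) ∈ B ∧ (v : ZMod s) + 1 ∈ B := by
        intro v hv h
        refine ⟨?_, ?_⟩
        · rw [hB, Set.mem_ofPred_eq, ZMod.val_cast_of_lt (by omega)]
          exact h.1
        · have e : (v : ZMod s) + 1 = (v + 1 : ℕ) := by push_cast; ring
          rw [e, hB, Set.mem_ofPred_eq, ZMod.val_cast_of_lt hv]
          exact h.2
      refine ⟨v, w, fun he => ?_, hval v (by omega) hv, hval w hw hw'⟩
      have := congrArg ZMod.val he
      rw [ZMod.val_cast_of_lt (by omega), ZMod.val_cast_of_lt (by omega)] at this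
      omega
  · refine ⟨fun h i => if b i.val then (if hm : idx i.val < a then h ⟨_, hm⟩ else 0) else 0, ?_, ?_⟩
    · intro h h' he
      funext ⟨m, hm⟩
      obtain ⟨v, hv, hbv, rfl⟩ := hsurj m hm
      have := congrFun he (v : ZMod s)
      simpa [ZMod.val_cast_of_lt hv, hbv, hm] using this
    · intro h i
      refine ⟨fun hi => if_neg hi, fun hi => if_neg hi, fun hi hi1 => ?_⟩
      obtain ⟨e1, e2, e3⟩ := hcons i hi hi1
      simp only [e1, e2, e3, if_true, hidx _ e1 e2]

theorem lower_even {s t : ℕ} (hs : 3 ≤ s) (ht : 5 ≤ t) (hst : s ≠ t) :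
    ∃ C : ℕ, ∀ᶠ n : ℕ in atTop, n ^ (s / 2) ≤
      C * rainbowEx n (SimpleGraph.cycleGraph s) (SimpleGraph.cycleGraph t) := by
  refine exists_forall_eventually_le_of_big hs ht (b := fun v => v % 2 = 1) (idx := fun v => v / 2)
    (by omega) (fun v _ _ => by omega) (fun v _ _ => by omega) (fun m hm => ?_) (Or.inl hst)
  exact ⟨2 * m + 1, by omega, by omega, by omega⟩

/-- The pairs of levels 1, 2 and 4, 5 are matched and account for one free choice each; the single
big levels `7, 9, …, s - 1` supply the remaining `s / 2 - 3`. -/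
theorem lower_self {s : ℕ} (hs : 6 ≤ s) (heven : Even s) :
    ∃ C : ℕ, ∀ᶠ n : ℕ in atTop, n ^ (s / 2 - 1) ≤
      C * rainbowEx n (SimpleGraph.cycleGraph s) (SimpleGraph.cycleGraph s) := by
  have hmod := Nat.even_iff.1 heven
  refine exists_forall_eventually_le_of_big (by omega) (by omega)
    (b := fun v => v = 1 ∨ v = 2 ∨ v = 4 ∨ v = 5 ∨ (7 ≤ v ∧ v % 2 = 1))
    (idx := fun v => if v ≤ 2 then 0 else if v ≤ 5 then 1 else (v - 3) / 2)
    (by omega) (fun v _ _ => by omega) (fun v _ _ => by split_ifs <;> omega) (fun m hm => ?_)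
    (Or.inr ⟨1, 4, by omega, by omega, by omega, by omega⟩)
  rcases Nat.lt_or_ge m 2 with h | h
  · interval_cases m
    · exact ⟨1, by omega, by omega, by norm_num⟩
    · exact ⟨4, by omega, by omega, by norm_num⟩
  · refine ⟨2 * m + 3, by omega, by omega, ?_⟩
    rw [if_neg (by omega), if_neg (by omega)]
    omega

end BigLevels

/-! ### Lower bound for `s = t = 4`: a Cayley graph in characteristic 2 -/

section CubicCayley

variable {F : Type*} [Field F]

/-- The Cayley graph on `F × F` generated by the points `(x, x ^ 3)`. -/
def cubicGraph (F : Type*) [Field F] : SimpleGraph (F × F) :=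
  SimpleGraph.fromRel fun p q => ∃ x, p + q = (x, x ^ 3)

/-- The sum of the endpoints. -/
def sumCol (F : Type*) [Field F] (e : Sym2 (F × F)) : F × F :=
  Sym2.lift ⟨fun a b => a + b, add_comm⟩ e

theorem cubicGraph_adj {p q : F × F} :
    (cubicGraph F).Adj p q ↔ p ≠ q ∧ ∃ x, p + q = (x, x ^ 3) := by
  rw [cubicGraph, SimpleGraph.fromRel_adj, add_comm q p, or_self]

theorem proper_sumCol : Proper (cubicGraph F) (sumCol F) := fun _ _ _ _ _ h => add_left_cancel h

variable [CharP F 2]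

/-- A rainbow 4-cycle would yield four different `x i` such that both they and their cubes sum to
zero. In characteristic 2, `a^3 + b^3 + c^3 + (a + b + c)^3 = (a + b) * (b + c) * (a + c)`, so two
of them would be equal. -/
theorem rainbowFree_sumCol : RainbowFree (cubicGraph F) (sumCol F) 4 := by
  intro f hf hinj
  have hadd : ∀ a : F, a + a = 0 := CharTwo.add_self_eq_zero
  have h : ∀ i, ∃ x, f i + f (i + 1) = (x, x ^ 3) := fun i => (cubicGraph_adj.1 (hf.2 i)).2
  choose x hx using h
  have h1 : ∀ i, (f i).1 + (f (i + 1)).1 = x i := fun i => congrArg Prod.fst (hx i)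
  have h2 : ∀ i, (f i).2 + (f (i + 1)).2 = x i ^ 3 := fun i => congrArg Prod.snd (hx i)
  have hne : ∀ i j, i ≠ j → x i ≠ x j := by
    intro i j hij he
    refine hij (hinj ?_)
    change f i + f (i + 1) = f j + f (j + 1)
    rw [hx, hx, he]
  have e3 : (3 : ZMod 4) + 1 = 0 := rfl
  have e2 : (2 : ZMod 4) + 1 = 3 := rfl
  have e1 : (1 : ZMod 4) + 1 = 2 := rfl
  have a0 := h1 0
  have a1 := h1 1
  have a2 := h1 2
  have a3 := h1 3
  have b0 := h2 0
  have b1 := h2 1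
  have b2 := h2 2
  have b3 := h2 3
  rw [e1] at a1 b1
  rw [e2] at a2 b2
  rw [e3] at a3 b3
  rw [zero_add] at a0 b0
  have two : (2 : F) = 0 := by rw [← one_add_one_eq_two]; exact hadd 1
  have hs : x 3 = x 0 + x 1 + x 2 := by
    rw [← a0, ← a1, ← a2, ← a3]
    linear_combination (-(f 1).1 - (f 2).1) * two
  have hc : x 0 ^ 3 + x 1 ^ 3 + x 2 ^ 3 + x 3 ^ 3 = 0 := by
    rw [← b0, ← b1, ← b2, ← b3]
    linear_combination ((f 0).2 + (f 1).2 + (f 2).2 + (f 3).2) * two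
  have hprod : (x 0 + x 1) * (x 1 + x 2) * (x 0 + x 2) = 0 := by
    rw [hs] at hc
    linear_combination hc - (x 0 ^ 3 + x 1 ^ 3 + x 2 ^ 3 + (x 0 + x 1) * (x 1 + x 2) * (x 0 + x 2)) * two
  have hsub : ∀ a b : F, a + b = 0 → a = b := fun a b h => CharTwo.add_eq_zero.1 h
  rcases mul_eq_zero.1 hprod with h | h
  · rcases mul_eq_zero.1 h with h | h
    · exact hne 0 1 (by decide) (hsub _ _ h)
    · exact hne 1 2 (by decide) (hsub _ _ h)
  · exact hne 0 2 (by decide) (hsub _ _ h)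

/-- The 4-cycles counted are parallelograms, given by a base point and two different nonzero
generators. -/
theorem card_le_card_cycs_cubicGraph [Fintype F] [DecidableEq F] :
    Fintype.card F ^ 2 * ((Fintype.card F - 1) * (Fintype.card F - 2)) ≤
      (cycs (cubicGraph F) 4).card := by
  have hcard : ((Finset.univ : Finset (F × F)) ×ˢ (Finset.univ : Finset Fˣ).offDiag).card =
      Fintype.card F ^ 2 * ((Fintype.card F - 1) * (Fintype.card F - 2)) := by
    rw [Finset.card_product, Finset.offDiag_card, Finset.card_univ, Finset.card_univ,
      Fintype.card_prod, Fintype.card_units, ← sq]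
    congr 1
    rw [← Nat.mul_sub_one, Nat.sub_sub]
  rw [← hcard]
  let S : Fˣ → F × F := fun x => ((x : F), (x : F) ^ 3)
  let c : (F × F) × (Fˣ × Fˣ) → Fin 4 → F × F := fun q =>
    ![q.1, q.1 + S q.2.1, q.1 + S q.2.1 + S q.2.2, q.1 + S q.2.2]
  have hadd : ∀ a : F × F, a + a = 0 := fun a =>
    Prod.ext (CharTwo.add_self_eq_zero a.1) (CharTwo.add_self_eq_zero a.2)
  have hS0 : ∀ x, S x ≠ 0 := fun x h => x.ne_zero (congrArg Prod.fst h)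
  have hSinj : ∀ x y, S x = S y → x = y := fun x y h => Units.ext (congrArg Prod.fst h)
  have hstep : ∀ (a : F × F) x, (cubicGraph F).Adj a (a + S x) := by
    intro a x
    refine cubicGraph_adj.2 ⟨fun h => hS0 x (left_eq_add.1 h), x, ?_⟩
    rw [← add_assoc, hadd, zero_add]
  refine Finset.card_le_card_of_injOn (fun q i => c q (show Fin 4 from i)) ?_ ?_
  · rintro ⟨a, x, y⟩ hq
    simp only [Finset.coe_product, Set.mem_prod, Finset.mem_coe, Finset.mem_offDiag,
      Finset.mem_univ, true_and] at hq
    refine mem_cycs.2 ⟨?_, ?_⟩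
    · have hxy : S x ≠ S y := fun h => hq (hSinj _ _ h)
      have hxy' : S x + S y ≠ 0 := fun h => hxy (by
        have := congrArg (· + S y) h
        simpa [add_assoc, hadd] using this)
      have key : Function.Injective (c (a, x, y)) := by
        intro i j hij
        fin_cases i <;> fin_cases j <;>
          simp [c, hS0, hxy, hxy.symm, hxy', add_assoc] at hij ⊢
      exact key
    · have key : ∀ i : Fin 4, (cubicGraph F).Adj (c (a, x, y) i) (c (a, x, y) (i + 1)) := by
        intro i
        fin_cases i
        · exact hstep a x
        · exact hstep (a + S x) y
        · have := hstep (a + S y) x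
          rw [add_right_comm] at this
          exact this.symm
        · exact (hstep a y).symm
      exact key
  · rintro ⟨a, x, y⟩ - ⟨a', x', y'⟩ - h
    have h0 : a = a' := congrFun h (0 : Fin 4)
    have h1 : a + S x = a' + S x' := congrFun h (1 : Fin 4)
    have h3 : a + S y = a' + S y' := congrFun h (3 : Fin 4)
    subst h0
    rw [hSinj _ _ (add_left_cancel h1), hSinj _ _ (add_left_cancel h3)]

end CubicCayley

theorem lower_four_four : ∃ C : ℕ, ∀ᶠ n : ℕ in atTop, n ^ 4 ≤
    C * rainbowEx n (SimpleGraph.cycleGraph 4) (SimpleGraph.cycleGraph 4) ^ 2 := by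
  classical
  refine ⟨(48 * 4 ^ 4) ^ 2, ?_⟩
  filter_upwards [eventually_ge_atTop 16] with n hn
  -- With `q = 2 ^ m` the graph has `q ^ 2 = 4 ^ m` vertices, which is at most `n` and more than `n
  -- / 4`.
  set m := Nat.log 4 n
  have hm : 2 ≤ m := Nat.le_log_of_pow_le (by norm_num) (by omega)
  have h1 : 4 ^ m ≤ n := Nat.pow_log_le_self 4 (by omega)
  have h2 : n < 4 ^ (m + 1) := Nat.lt_pow_succ_log_self (by norm_num) n
  have : Fintype (GaloisField 2 m) := Fintype.ofFinite _
  have hq : Fintype.card (GaloisField 2 m) = 2 ^ m := by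
    rw [← Nat.card_eq_fintype_card, GaloisField.card 2 m (by omega)]
  have h3 := card_le_card_cycs_cubicGraph (F := GaloisField 2 m)
  have h4 := card_cycs_le_rainbowEx (G := cubicGraph (GaloisField 2 m)) (n := n) (s := 4) (t := 4)
    (by norm_num) (by norm_num) (by
      rw [Fintype.card_prod, hq, ← mul_pow]
      exact h1) proper_sumCol rainbowFree_sumCol
  rw [hq] at h3
  have h5 : 4 ≤ 2 ^ m := by
    calc 4 = 2 ^ 2 := by norm_num
      _ ≤ 2 ^ m := Nat.pow_le_pow_right (by norm_num) hm
  have h6 : n ≤ 4 * (2 ^ m) ^ 2 := by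
    have e : 4 ^ m = (2 ^ m) ^ 2 := by
      rw [← pow_mul, mul_comm m 2, pow_mul]; norm_num
    rw [pow_succ, e] at h2
    linarith
  have h7 : (2 ^ m) ^ 2 ≤ 3 * ((2 ^ m - 1) * (2 ^ m - 2)) := by
    obtain ⟨a, ha⟩ := Nat.exists_eq_add_of_le h5
    rw [ha, show 4 + a - 1 = 3 + a by omega, show 4 + a - 2 = 2 + a by omega]
    nlinarith
  have h8 : n ^ 2 ≤ 48 * 4 ^ 4 *
      rainbowEx n (SimpleGraph.cycleGraph 4) (SimpleGraph.cycleGraph 4) := by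
    calc n ^ 2 ≤ (4 * (2 ^ m) ^ 2) ^ 2 := Nat.pow_le_pow_left h6 2
      _ = 16 * (2 ^ m) ^ 2 * (2 ^ m) ^ 2 := by ring
      _ ≤ 16 * (2 ^ m) ^ 2 * (3 * ((2 ^ m - 1) * (2 ^ m - 2))) := Nat.mul_le_mul_left _ h7
      _ = 48 * ((2 ^ m) ^ 2 * ((2 ^ m - 1) * (2 ^ m - 2))) := by ring
      _ ≤ 48 * (4 ^ 4 * rainbowEx n (SimpleGraph.cycleGraph 4) (SimpleGraph.cycleGraph 4)) :=
          Nat.mul_le_mul_left _ (h3.trans h4)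
      _ = _ := by ring
  calc n ^ 4 = (n ^ 2) ^ 2 := by ring
    _ ≤ _ := Nat.pow_le_pow_left h8 2
    _ = _ := by ring

/-! ### Lower bounds for `t = 4` and `s ≠ 4`: graphs without 4-cycles -/

section FourCycleFree

variable {F : Type*} [Field F]

/-- The points `p` and `q` satisfy `p.2 + q.2 = p.1 * q.1`. -/
def Polar (p q : F × F) : Prop := p.2 + q.2 = p.1 * q.1

theorem Polar.symm {p q : F × F} (h : Polar p q) : Polar q p := by
  rw [Polar, add_comm, mul_comm]
  exact h

/-- The alternating sum of the four equations is `(a.1 - c.1) * (b.1 - d.1) = 0`, and equal first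
coordinates force equal second ones. Geometrically, two points lie on at most one common line. -/
theorem Polar.eq_or_eq {a b c d : F × F} (hab : Polar a b) (hbc : Polar b c) (hcd : Polar c d)
    (hda : Polar d a) : a = c ∨ b = d := by
  rw [Polar] at *
  have h : (a.1 - c.1) * (b.1 - d.1) = 0 := by linear_combination -hab + hbc - hcd + hda
  rcases mul_eq_zero.1 h with h | h
  · refine Or.inl (Prod.ext (sub_eq_zero.1 h) ?_)
    linear_combination hab - hbc + b.1 * h
  · refine Or.inr (Prod.ext (sub_eq_zero.1 h) ?_)
    linear_combination hab - hda + a.1 * h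

theorem proper_id {V : Type*} (G : SimpleGraph V) : Proper G (id : Sym2 V → Sym2 V) :=
  fun _ _ _ _ _ h => Sym2.congr_right.1 h

/-- The graph given by `Polar`, or its bipartite double cover. -/
def polarGraph (F : Type*) [Field F] {τ : Type*} (r : τ → τ → Prop) : SimpleGraph (τ × F × F) :=
  SimpleGraph.fromRel fun p q => r p.1 q.1 ∧ Polar p.2 q.2

theorem polarGraph_adj {τ : Type*} {r : τ → τ → Prop} (hr : ∀ a b, r a b → r b a)
    {p q : τ × F × F} : (polarGraph F r).Adj p q ↔ p ≠ q ∧ r p.1 q.1 ∧ Polar p.2 q.2 := by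
  rw [polarGraph, SimpleGraph.fromRel_adj]
  refine and_congr_right fun _ => ⟨?_, Or.inl⟩
  rintro (h | h)
  · exact h
  · exact ⟨hr _ _ h.1, h.2.symm⟩

theorem rainbowFree_polarGraph {τ K : Type*} {r : τ → τ → Prop} (hr : ∀ a b, r a b → r b a)
    (hr' : ∀ a b c, r a b → r a c → b = c) (col : Sym2 (τ × F × F) → K) :
    RainbowFree (polarGraph F r) col 4 := by
  intro f hf
  exfalso
  have h : ∀ i, r (f i).1 (f (i + 1)).1 ∧ Polar (f i).2 (f (i + 1)).2 := fun i =>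
    ((polarGraph_adj hr).1 (hf.2 i)).2
  have h0 := h 0
  have h1 := h 1
  have h2 := h 2
  have h3 := h 3
  rw [zero_add] at h0
  rw [show (1 : ZMod 4) + 1 = 2 from rfl] at h1
  rw [show (2 : ZMod 4) + 1 = 3 from rfl] at h2
  rw [show (3 : ZMod 4) + 1 = 0 from rfl] at h3
  rcases h0.2.eq_or_eq h1.2 h2.2 h3.2 with e | e
  · exact absurd (hf.1 (Prod.ext (hr' _ _ _ (hr _ _ h0.1) h1.1) e)) (by decide)
  · exact absurd (hf.1 (Prod.ext (hr' _ _ _ (hr _ _ h1.1) h2.1) e)) (by decide)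

/-- Bertrand's postulate applied to a quarter of the square root of `n`. The lower bound `4 * p ^ 2`
leaves room for two copies of the plane over `ZMod p`. -/
theorem eventually_exists_prime (N : ℕ) : ∀ᶠ n : ℕ in atTop, ∃ p : ℕ, p.Prime ∧ N ≤ p ∧
    4 * p ^ 2 ≤ n ∧ n ≤ 16 * p ^ 2 := by
  filter_upwards [eventually_ge_atTop (16 * (N + 1) ^ 2)] with n hn
  set r := Nat.sqrt n
  have h1 : r * r ≤ n := Nat.sqrt_le n
  have h2 : n < (r + 1) * (r + 1) := Nat.lt_succ_sqrt n
  have h3 : 4 * (N + 1) ≤ r := Nat.le_sqrt.2 (by nlinarith)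
  obtain ⟨p, hp, hlt, hle⟩ := Nat.exists_prime_lt_and_le_two_mul (r / 4) (by omega)
  have h4 : 2 * p ≤ r := by omega
  have h5 : r + 1 ≤ 4 * p := by omega
  exact ⟨p, hp, by omega, by nlinarith, by nlinarith⟩

/-- A solution of `y i + y (i + 1) = z i` around an odd cycle. -/
theorem exists_add_succ_eq {s : ℕ} (hs : Odd s) (h2 : (2 : F) ≠ 0) (z : ZMod s → F) :
    ∃ y : ZMod s → F, ∀ i, y i + y (i + 1) = z i := by
  -- The alternating sum once round the cycle telescopes when added to its shift; as `s` is odd,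
  -- both boundary terms equal `z i`, hence the division by 2.
  refine ⟨fun i => (∑ j ∈ Finset.range s, (-1) ^ j * z (i + j)) / 2, fun i => ?_⟩
  have e1 : ∑ j ∈ Finset.range s, (-1 : F) ^ j * z (i + j) + (-1) ^ s * z (i + s) =
      ∑ j ∈ Finset.range s, (-1 : F) ^ (j + 1) * z (i + (j + 1 : ℕ)) + (-1) ^ 0 * z (i + (0 : ℕ)) := by
    rw [← Finset.sum_range_succ (fun j : ℕ => (-1 : F) ^ j * z (i + j)),
      Finset.sum_range_succ' (fun j : ℕ => (-1 : F) ^ j * z (i + j))]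
  have e2 : ∑ j ∈ Finset.range s, (-1 : F) ^ (j + 1) * z (i + (j + 1 : ℕ)) =
      -∑ j ∈ Finset.range s, (-1 : F) ^ j * z (i + 1 + j) := by
    rw [← Finset.sum_neg_distrib]
    refine Finset.sum_congr rfl fun j _ => ?_
    rw [show i + ((j + 1 : ℕ) : ZMod s) = i + 1 + j by push_cast; ring]
    ring
  rw [e2, hs.neg_one_pow, ZMod.natCast_self] at e1
  simp only [add_zero, pow_zero, Nat.cast_zero] at e1
  field_simp
  linear_combination e1

/-- Different first coordinates can be prescribed arbitrarily; the adjacency conditions are then a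
linear system for the second coordinates, solvable round an odd cycle. -/
theorem card_le_card_cycs_polarGraph_odd [Fintype F] {s : ℕ} [NeZero s] (hs : 2 ≤ s)
    (hodd : Odd s) (h2 : (2 : F) ≠ 0) :
    (Fintype.card F).descFactorial s ≤
      (cycs (polarGraph F (fun _ _ : Unit => True)) s).card := by
  classical
  choose y hy using exists_add_succ_eq (F := F) hodd h2
  have hcard : Fintype.card (ZMod s ↪ F) = (Fintype.card F).descFactorial s := by
    rw [Fintype.card_embedding_eq, ZMod.card]
  rw [← hcard]
  refine Finset.card_le_card_of_injOn (s := (Finset.univ : Finset (ZMod s ↪ F)))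
    (fun x i => ((), x i, y (fun i => x i * x (i + 1)) i)) ?_ ?_
  · intro x _
    have hinj : Function.Injective fun i => ((), x i, y (fun i => x i * x (i + 1)) i) :=
      fun i j h => x.injective (congrArg (fun p => p.2.1) h)
    refine mem_cycs.2 ⟨hinj, fun i => (polarGraph_adj (by simp)).2 ⟨fun h => ?_, trivial, hy _ i⟩⟩
    refine natCast_ne_zero_of_lt (s := s) (j := 1) one_pos (by omega) ?_
    have := hinj h
    push_cast
    linear_combination -this
  · intro x _ x' _ h
    ext i
    exact congrArg (fun p => p.2.1) (congrFun h i)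

theorem lower_odd_four {s : ℕ} (hs : 3 ≤ s) (hodd : Odd s) : ∃ C : ℕ, ∀ᶠ n : ℕ in atTop, n ^ s ≤
    C * rainbowEx n (SimpleGraph.cycleGraph s) (SimpleGraph.cycleGraph 4) ^ 2 := by
  have : NeZero s := ⟨by omega⟩
  refine ⟨64 ^ s * (s ^ s) ^ 2, ?_⟩
  filter_upwards [eventually_exists_prime (2 * s)] with n hn
  obtain ⟨p, hp, hps, h1, h2⟩ := hn
  have : Fact p.Prime := ⟨hp⟩
  have hp2 : (2 : ZMod p) ≠ 0 := by
    have := natCast_ne_zero_of_lt (s := p) (j := 2) two_pos (by omega)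
    exact_mod_cast this
  have h3 := card_le_card_cycs_polarGraph_odd (F := ZMod p) (s := s) (by omega) hodd hp2
  have h4 := card_cycs_le_rainbowEx (n := n) (s := s) (t := 4) (by omega) (by norm_num) (by
      simp only [Fintype.card_prod, Fintype.card_unit, ZMod.card]
      nlinarith) (proper_id _) (rainbowFree_polarGraph (F := ZMod p) (r := fun _ _ : Unit => True)
        (by simp) (by simp) id)
  rw [ZMod.card] at h3
  have h5 : p ^ s ≤ 2 ^ s * (s ^ s * rainbowEx n (SimpleGraph.cycleGraph s)
      (SimpleGraph.cycleGraph 4)) := by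
    calc p ^ s ≤ (2 * (p + 1 - s)) ^ s := Nat.pow_le_pow_left (by omega) s
      _ = 2 ^ s * (p + 1 - s) ^ s := mul_pow _ _ _
      _ ≤ _ := Nat.mul_le_mul_left _ ((Nat.pow_sub_le_descFactorial p s).trans (h3.trans h4))
  calc n ^ s ≤ (16 * p ^ 2) ^ s := Nat.pow_le_pow_left h2 s
    _ = 16 ^ s * (p ^ s) ^ 2 := by rw [mul_pow, ← pow_mul, ← pow_mul, mul_comm 2 s]
    _ ≤ 16 ^ s * (2 ^ s * (s ^ s * rainbowEx n (SimpleGraph.cycleGraph s)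
      (SimpleGraph.cycleGraph 4))) ^ 2 := Nat.mul_le_mul_left _ (Nat.pow_le_pow_left h5 2)
    _ = _ := by
      rw [mul_pow (2 ^ s), mul_pow (s ^ s), show (64 : ℕ) = 16 * 2 ^ 2 by norm_num, mul_pow 16,
        ← pow_mul 2 2 s, ← pow_mul 2 s 2, mul_comm 2 s]
      ring

/-! ### Even cycles of incidences from polygons in general position -/

section GeneralPosition

variable {k : ℕ}

/-- No two of the points have the same first coordinate, and no three lie on a line. -/
def GeneralPosition (P : ZMod k → F × F) : Prop :=
  ∀ i j l, l ≠ i → l ≠ j → (P l).1 ≠ (P i).1 ∧ ((P i).1 ≠ (P j).1 →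
    ((P l).2 - (P i).2) * ((P j).1 - (P i).1) ≠ ((P j).2 - (P i).2) * ((P l).1 - (P i).1))

open scoped Classical in
/-- The points on a vertical or on a given line. -/
noncomputable def forbidden [Fintype F] (a b : F × F) : Finset (F × F) :=
  Finset.univ.filter fun p => p.1 = a.1 ∨ (a.1 ≠ b.1 ∧
    (p.2 - a.2) * (b.1 - a.1) = (b.2 - a.2) * (p.1 - a.1))

theorem card_forbidden_le [Fintype F] (a b : F × F) :
    (forbidden a b).card ≤ 2 * Fintype.card F := by
  classical
  have h1 : (Finset.univ.filter fun p : F × F => p.1 = a.1).card ≤ Fintype.card F := by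
    refine Finset.card_le_card_of_injOn (fun p => p.2) (fun _ _ => Finset.mem_univ _) ?_
    intro p hp q hq h
    simp only [Finset.coe_filter, Finset.mem_univ, true_and, Set.mem_ofPred_eq] at hp hq
    exact Prod.ext (hp.trans hq.symm) h
  have h2 : (Finset.univ.filter fun p : F × F => a.1 ≠ b.1 ∧
      (p.2 - a.2) * (b.1 - a.1) = (b.2 - a.2) * (p.1 - a.1)).card ≤ Fintype.card F := by
    refine Finset.card_le_card_of_injOn (fun p => p.1) (fun _ _ => Finset.mem_univ _) ?_
    intro p hp q hq h
    simp only [Finset.coe_filter, Finset.mem_univ, true_and, Set.mem_ofPred_eq] at hp hq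
    simp only at h
    have e : (p.2 - a.2) * (b.1 - a.1) = (q.2 - a.2) * (b.1 - a.1) := by rw [hp.2, hq.2, h]
    exact Prod.ext h (sub_left_inj.1 (mul_right_cancel₀ (sub_ne_zero.2 hp.1.symm) e))
  rw [forbidden, Finset.filter_or]
  exact (Finset.card_union_le _ _).trans (by omega)

-- A union bound over the `k ^ 3` triples `i, j, l`: given all other points, `P l` is confined to at
-- most `2 * q` of the `q ^ 2` points. For `4 * k ^ 3 ≤ q` at most half of all configurations are
-- lost.
open scoped Classical in
theorem card_generalPosition [Fintype F] [NeZero k] (hF : 4 * k ^ 3 ≤ Fintype.card F) :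
    Fintype.card F ^ (2 * k) ≤
      2 * (Finset.univ.filter fun P : ZMod k → F × F => GeneralPosition P).card := by
  set q := Fintype.card F
  let bad : ZMod k × ZMod k × ZMod k → Finset (ZMod k → F × F) := fun x =>
    Finset.univ.filter fun P => (x.2.2 ≠ x.1 ∧ x.2.2 ≠ x.2.1) ∧
      P x.2.2 ∈ forbidden (P x.1) (P x.2.1)
  have hk : 0 < k := NeZero.pos k
  have hq : Fintype.card (F × F) = q ^ 2 := by rw [Fintype.card_prod, sq]
  have hbad : ∀ x, (bad x).card ≤ 2 * q * (q ^ 2) ^ (k - 1) := by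
    rintro ⟨i, j, l⟩
    by_cases hl : l ≠ i ∧ l ≠ j
    · have h1 := proj_insert_le (S := bad (i, j, l)) (J := {l}ᶜ) (j := l) (k := 2 * q)
        (fun P => forbidden (P i) (P j))
        (fun f g h => by rw [h i (by simpa using hl.1.symm), h j (by simpa using hl.2.symm)])
        (fun f => card_forbidden_le _ _) (fun f hf => by
          simp only [bad, Finset.mem_filter] at hf
          exact hf.2.2)
      have h2 := proj_le_pow (bad (i, j, l)) {l}ᶜ
      rw [Finset.card_compl, ZMod.card, Finset.card_singleton, hq] at h2
      refine (card_le_proj fun x => ?_).trans (h1.trans (Nat.mul_le_mul_left _ h2))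
      simp only [Finset.mem_insert, Finset.mem_compl, Finset.mem_singleton]
      tauto
    · have : bad (i, j, l) = ∅ := by
        simp only [bad, Finset.filter_eq_empty_iff]
        intro P _ h
        exact hl h.1
      simp [this]
  have hcover : (Finset.univ : Finset (ZMod k → F × F)) ⊆
      (Finset.univ.filter fun P => GeneralPosition P) ∪ Finset.univ.biUnion bad := by
    intro P _
    by_cases hP : GeneralPosition P
    · simp [hP]
    · rw [GeneralPosition] at hP
      push Not at hP
      obtain ⟨i, j, l, hi, hj, h⟩ := hP
      refine Finset.mem_union_right _ (Finset.mem_biUnion.2 ⟨(i, j, l), Finset.mem_univ _, ?_⟩)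
      simp only [bad, forbidden, Finset.mem_filter, Finset.mem_univ, true_and]
      refine ⟨⟨hi, hj⟩, ?_⟩
      by_cases he : (P l).1 = (P i).1
      · exact Or.inl he
      · exact Or.inr (h he)
  have h1 := Finset.card_le_card hcover
  have h2 := Finset.card_union_le (Finset.univ.filter fun P : ZMod k → F × F => GeneralPosition P)
    (Finset.univ.biUnion bad)
  have h3 := Finset.card_biUnion_le_card_mul Finset.univ bad _ fun x _ => hbad x
  have h4 : 2 * ((Finset.univ : Finset (ZMod k × ZMod k × ZMod k)).card *
      (2 * q * (q ^ 2) ^ (k - 1))) ≤ q ^ (2 * k) := by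
    rw [Finset.card_univ, Fintype.card_prod, Fintype.card_prod, ZMod.card]
    calc _ = 4 * k ^ 3 * (q * (q ^ 2) ^ (k - 1)) := by ring
      _ ≤ q * (q * (q ^ 2) ^ (k - 1)) := Nat.mul_le_mul_right _ hF
      _ = q ^ (2 * k) := by
        obtain ⟨m, rfl⟩ : ∃ m, k = m + 1 := ⟨k - 1, by omega⟩
        rw [Nat.add_sub_cancel, ← pow_mul]
        ring
  have h5 : (Finset.univ : Finset (ZMod k → F × F)).card = q ^ (2 * k) := by
    rw [Finset.card_univ, Fintype.card_fun, hq, ZMod.card, ← pow_mul]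
  omega

/-- The line through two points with different first coordinates. -/
def lineThrough (a b : F × F) : F × F :=
  ((b.2 - a.2) / (b.1 - a.1), a.1 * ((b.2 - a.2) / (b.1 - a.1)) - a.2)

theorem polar_lineThrough (a b : F × F) : Polar a (lineThrough a b) := by
  rw [Polar, lineThrough]
  ring

theorem polar_lineThrough_right {a b : F × F} (h : b.1 ≠ a.1) : Polar b (lineThrough a b) := by
  have h' := sub_ne_zero.2 h
  rw [Polar, lineThrough]
  field_simp
  ring

theorem GeneralPosition.fst_ne {P : ZMod k → F × F} (hP : GeneralPosition P) {i j : ZMod k}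
    (hij : i ≠ j) : (P i).1 ≠ (P j).1 :=
  (hP j j i hij hij).1

theorem GeneralPosition.not_polar {P : ZMod k → F × F} (hP : GeneralPosition P) {i j l : ZMod k}
    (hij : i ≠ j) (hi : l ≠ i) (hj : l ≠ j) {L : F × F} (h1 : Polar (P i) L) (h2 : Polar (P j) L) :
    ¬ Polar (P l) L := by
  intro h3
  rw [Polar] at h1 h2 h3
  refine (hP i j l hi hj).2 (hP.fst_ne hij) ?_
  linear_combination ((P j).1 - (P i).1) * (h3 - h1) - ((P l).1 - (P i).1) * (h2 - h1)

/-- If two sides of the polygon lay on one line, this line would contain three of the points,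
because `k ≥ 3`. -/
theorem GeneralPosition.lineThrough_injective (hk : 3 ≤ k) {P : ZMod k → F × F}
    (hP : GeneralPosition P) : Function.Injective fun i => lineThrough (P i) (P (i + 1)) := by
  have h1 : ((1 : ℕ) : ZMod k) ≠ 0 := natCast_ne_zero_of_lt (by norm_num) (by omega)
  have h2 : ((2 : ℕ) : ZMod k) ≠ 0 := natCast_ne_zero_of_lt (by norm_num) (by omega)
  push_cast at h1 h2
  have hright : ∀ i, Polar (P (i + 1)) (lineThrough (P i) (P (i + 1))) := fun i =>
    polar_lineThrough_right (hP.fst_ne fun h => h1 (by linear_combination h))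
  intro i j h
  by_contra hij
  simp only at h
  have a1 := polar_lineThrough (P i) (P (i + 1))
  have a2 := hright i
  have a3 := polar_lineThrough (P j) (P (j + 1))
  have a4 := hright j
  rw [← h] at a3 a4
  have hne : i ≠ i + 1 := fun h => h1 (by linear_combination -h)
  by_cases hj : j = i + 1
  · subst hj
    exact hP.not_polar hne (fun h => h2 (by linear_combination h))
      (fun h => h1 (by linear_combination h)) a1 a2 a4
  · exact hP.not_polar hne (Ne.symm hij) hj a1 a2 a3

/-- The cycle of incidences formed by points and the lines joining consecutive points. -/
noncomputable def polygon (P : ZMod k → F × F) (i : ZMod (2 * k)) : Bool × F × F :=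
  if i.val % 2 = 0 then (false, P (i.val / 2 : ℕ)) else
    (true, lineThrough (P (i.val / 2 : ℕ)) (P ((i.val / 2 : ℕ) + 1)))

theorem isCyc_polygon (hk : 3 ≤ k) {P : ZMod k → F × F} (hP : GeneralPosition P) :
    IsCyc (polarGraph F (fun a b : Bool => a ≠ b)) (2 * k) (polygon P) := by
  have : NeZero (2 * k) := ⟨by omega⟩
  have h1 : ((1 : ℕ) : ZMod k) ≠ 0 := natCast_ne_zero_of_lt (by norm_num) (by omega)
  push_cast at h1
  have hcast : ∀ m n : ℕ, m < k → n < k → (m : ZMod k) = n → m = n := by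
    intro m n hm hn h
    have := congrArg ZMod.val h
    rwa [ZMod.val_cast_of_lt hm, ZMod.val_cast_of_lt hn] at this
  have hPinj : Function.Injective P := fun i j h => by
    by_contra hij
    exact hP.fst_ne hij (congrArg Prod.fst h)
  refine ⟨fun i j h => ?_, fun i => (polarGraph_adj fun _ _ => Ne.symm).2 ?_⟩
  · have hi := ZMod.val_lt i
    have hj := ZMod.val_lt j
    apply ZMod.val_injective
    rw [polygon, polygon] at h
    split_ifs at h with ei ej ej
    · have := hcast _ _ (by omega) (by omega) (hPinj (Prod.mk.inj h).2)
      omega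
    · exact absurd (Prod.mk.inj h).1 (by decide)
    · exact absurd (Prod.mk.inj h).1 (by decide)
    · have := hcast _ _ (by omega) (by omega) (hP.lineThrough_injective hk (Prod.mk.inj h).2)
      omega
  · have hi := ZMod.val_lt i
    have key : (polygon P i).1 ≠ (polygon P (i + 1)).1 ∧
        Polar (polygon P i).2 (polygon P (i + 1)).2 := by
      rcases Nat.mod_two_eq_zero_or_one i.val with e | e
      · have h2 : (i + 1).val = i.val + 1 :=
          ((val_add_one_cases i).resolve_right fun h => by omega).2
        rw [polygon, polygon, h2, if_pos e, if_neg (by omega)]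
        refine ⟨by simp, ?_⟩
        rw [show (i.val + 1) / 2 = i.val / 2 by omega]
        exact polar_lineThrough _ _
      · have h2 : (i + 1).val % 2 = 0 ∧
            (((i + 1).val / 2 : ℕ) : ZMod k) = ((i.val / 2 : ℕ) : ZMod k) + 1 := by
          rcases val_add_one_cases i with ⟨h, h'⟩ | ⟨h, h'⟩
          · rw [h', show (i.val + 1) / 2 = i.val / 2 + 1 by omega]
            exact ⟨by omega, by push_cast; ring⟩
          · have h3 : ((i.val / 2 + 1 : ℕ) : ZMod k) = 0 := by
              rw [show i.val / 2 + 1 = k by omega, ZMod.natCast_self]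
            rw [h']
            push_cast at h3
            simp [h3]
        rw [polygon, polygon, if_neg (by omega), if_pos h2.1, h2.2]
        exact ⟨by simp, (polar_lineThrough_right
          (hP.fst_ne fun h => h1 (by linear_combination h))).symm⟩
    exact ⟨fun h => key.1 (congrArg Prod.fst h), key⟩

theorem polygon_injective [NeZero k] :
    Function.Injective (polygon : (ZMod k → F × F) → ZMod (2 * k) → Bool × F × F) := by
  intro P P' h
  funext i
  have hi := ZMod.val_lt i
  have h1 := congrFun h ((2 * i.val : ℕ) : ZMod (2 * k))
  rw [polygon, polygon, ZMod.val_cast_of_lt (by omega), if_pos (by omega), if_pos (by omega),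
    show 2 * i.val / 2 = i.val by omega, ZMod.natCast_zmod_val] at h1
  exact (Prod.mk.inj h1).2

end GeneralPosition

theorem lower_even_four {k : ℕ} (hk : 3 ≤ k) : ∃ C : ℕ, ∀ᶠ n : ℕ in atTop, n ^ (2 * k) ≤
    C * rainbowEx n (SimpleGraph.cycleGraph (2 * k)) (SimpleGraph.cycleGraph 4) ^ 2 := by
  classical
  have : NeZero k := ⟨by omega⟩
  have : NeZero (2 * k) := ⟨by omega⟩
  refine ⟨16 ^ (2 * k) * (2 * (2 * k) ^ (2 * k)) ^ 2, ?_⟩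
  filter_upwards [eventually_exists_prime (4 * k ^ 3)] with n hn
  obtain ⟨p, hp, hps, h1, h2⟩ := hn
  have : Fact p.Prime := ⟨hp⟩
  have h3 := card_generalPosition (F := ZMod p) (k := k) (by rwa [ZMod.card])
  have h4 := card_cycs_le_rainbowEx (n := n) (s := 2 * k) (t := 4) (by omega) (by norm_num) (by
      simp only [Fintype.card_prod, Fintype.card_bool, ZMod.card]
      nlinarith) (proper_id _) (rainbowFree_polarGraph (F := ZMod p)
        (r := fun a b : Bool => a ≠ b) (fun _ _ => Ne.symm) (by decide) id)
  have h5 : (Finset.univ.filter fun P : ZMod k → ZMod p × ZMod p => GeneralPosition P).card ≤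
      (cycs (polarGraph (ZMod p) (fun a b : Bool => a ≠ b)) (2 * k)).card := by
    refine Finset.card_le_card_of_injOn polygon (fun P hP => ?_) polygon_injective.injOn
    simp only [Finset.coe_filter, Finset.mem_univ, true_and, Set.mem_ofPred_eq] at hP
    exact mem_cycs.2 (isCyc_polygon hk hP)
  rw [ZMod.card] at h3
  have h6 : p ^ (2 * k) ≤ 2 * (2 * k) ^ (2 * k) * rainbowEx n (SimpleGraph.cycleGraph (2 * k))
      (SimpleGraph.cycleGraph 4) := by
    rw [mul_assoc]
    exact h3.trans (Nat.mul_le_mul_left _ (h5.trans h4))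
  calc n ^ (2 * k) ≤ (16 * p ^ 2) ^ (2 * k) := Nat.pow_le_pow_left h2 _
    _ = 16 ^ (2 * k) * (p ^ (2 * k)) ^ 2 := by rw [mul_pow, ← pow_mul, ← pow_mul, mul_comm 2 (2 * k)]
    _ ≤ 16 ^ (2 * k) * (2 * (2 * k) ^ (2 * k) * rainbowEx n (SimpleGraph.cycleGraph (2 * k))
      (SimpleGraph.cycleGraph 4)) ^ 2 := Nat.mul_le_mul_left _ (Nat.pow_le_pow_left h6 2)
    _ = _ := by rw [mul_pow _ (rainbowEx _ _ _), mul_assoc]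

end FourCycleFree

/-! ### Assembling the cases -/

theorem isTheta_of_le {f : ℕ → ℕ} {a : ℕ} {r : ℝ} (hr : r = a)
    (h1 : ∃ C : ℕ, ∀ n, f n ≤ C * n ^ a) (h2 : ∃ C : ℕ, ∀ᶠ n in atTop, n ^ a ≤ C * f n) :
    (fun n => (f n : ℝ)) =Θ[atTop] fun n : ℕ => (n : ℝ) ^ r := by
  subst hr
  simp only [Real.rpow_natCast]
  obtain ⟨C, hC⟩ := h1
  obtain ⟨C', hC'⟩ := h2
  refine ⟨IsBigO.of_bound C (Eventually.of_forall fun n => ?_),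
    IsBigO.of_bound C' (hC'.mono fun n hn => ?_)⟩
  · rw [Real.norm_of_nonneg (by positivity), Real.norm_of_nonneg (by positivity)]
    exact_mod_cast hC n
  · rw [Real.norm_of_nonneg (by positivity), Real.norm_of_nonneg (by positivity)]
    exact_mod_cast hn

/-- For odd `s` the exponent `s / 2` is not an integer, so the bounds for `t = 4` are stated for
squares and the root is taken here. -/
theorem isTheta_of_sq_le {f : ℕ → ℕ} {s : ℕ} (h1 : ∃ C : ℕ, ∀ n, f n ^ 2 ≤ C * n ^ s)
    (h2 : ∃ C : ℕ, ∀ᶠ n in atTop, n ^ s ≤ C * f n ^ 2) :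
    (fun n => (f n : ℝ)) =Θ[atTop] fun n : ℕ => (n : ℝ) ^ ((s : ℝ) / 2) := by
  have h3 := isTheta_of_le (f := fun n => f n ^ 2) rfl h1 h2
  have e1 : (fun n => ((f n ^ 2 : ℕ) : ℝ)) = (fun n => (f n : ℝ)) ^ 2 := by
    funext n; simp
  have e2 : (fun n : ℕ => (n : ℝ) ^ (s : ℝ)) = (fun n : ℕ => (n : ℝ) ^ ((s : ℝ) / 2)) ^ 2 := by
    funext n
    rw [Pi.pow_apply, ← Real.rpow_natCast, ← Real.rpow_mul (Nat.cast_nonneg n)]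
    congr 1
    push_cast
    ring
  rw [e1, e2] at h3
  exact ⟨h3.1.of_pow two_ne_zero, h3.2.of_pow two_ne_zero⟩

theorem upper_of_card_cycs_le {s t a : ℕ} [NeZero s] (hs : 2 ≤ s) (ht : 2 ≤ t)
    (h : ∃ C : ℕ, ∀ {V K : Type} [Fintype V] {G : SimpleGraph V} {col : Sym2 V → K},
      Proper G col → RainbowFree G col t → (cycs G s).card ≤ C * Fintype.card V ^ a) :
    ∃ C : ℕ, ∀ n, rainbowEx n (SimpleGraph.cycleGraph s) (SimpleGraph.cycleGraph t) ≤
      C * n ^ a := by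
  obtain ⟨C, hC⟩ := h
  refine ⟨C, fun n => rainbowEx_le_of_card_cycs_le hs ht fun G col hp hfree => ?_⟩
  simpa using hC hp hfree

theorem upper_four {s : ℕ} (hs : 4 ≤ s) : ∃ C : ℕ, ∀ n,
    rainbowEx n (SimpleGraph.cycleGraph s) (SimpleGraph.cycleGraph 4) ^ 2 ≤ C * n ^ s := by
  have : NeZero s := ⟨by omega⟩
  refine ⟨6 ^ (2 * s), fun n => ?_⟩
  have h := rainbowEx_le_of_card_cycs_le (n := n) (s := s) (t := 4)
    (B := Nat.sqrt (6 ^ (2 * s) * n ^ s)) (by omega) (by norm_num) fun G col hp hfree =>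
      Nat.le_sqrt'.2 (by simpa using card_cycs_sq_le hp hfree s hs)
  exact Nat.le_sqrt'.1 h

/-- The exponent is the integer part of `s / 2`, so even and odd `s` are covered together. -/
theorem upper_even {s t : ℕ} (hs : 4 ≤ s) (ht : 6 ≤ t) (heven : Even t) : ∃ C : ℕ, ∀ n,
    rainbowEx n (SimpleGraph.cycleGraph s) (SimpleGraph.cycleGraph t) ≤ C * n ^ (s / 2) := by
  obtain ⟨r, rfl⟩ : ∃ r, t = 2 * (r + 3) := by
    obtain ⟨k, rfl⟩ := heven
    exact ⟨k - 3, by omega⟩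
  obtain ⟨j, rfl | rfl⟩ : ∃ j, s = 2 * j + 4 ∨ s = 2 * j + 5 := ⟨(s - 4) / 2, by omega⟩
  · rw [show (2 * j + 4) / 2 = j + 2 by omega]
    exact upper_of_card_cycs_le (by omega) (by omega) (card_cycs_even_le r j)
  · rw [show (2 * j + 5) / 2 = j + 2 by omega]
    exact upper_of_card_cycs_le (by omega) (by omega) (card_cycs_odd_le r j)

theorem upper_self {s : ℕ} (hs : 6 ≤ s) (heven : Even s) : ∃ C : ℕ, ∀ n,
    rainbowEx n (SimpleGraph.cycleGraph s) (SimpleGraph.cycleGraph s) ≤ C * n ^ (s / 2 - 1) := by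
  obtain ⟨r, rfl⟩ : ∃ r, s = 2 * r + 6 := by
    obtain ⟨k, rfl⟩ := heven
    exact ⟨k - 3, by omega⟩
  rw [show (2 * r + 6) / 2 - 1 = r + 2 by omega]
  exact upper_of_card_cycs_le (by omega) (by omega) (card_cycs_self_le r)

theorem upper_odd_odd {s t : ℕ} (hs : 4 ≤ s) (hodd : Odd s) (hodd' : Odd t) (hst : s ≤ t) :
    ∃ C : ℕ, ∀ n,
    rainbowEx n (SimpleGraph.cycleGraph s) (SimpleGraph.cycleGraph t) ≤ C * n ^ (s - 2) := by
  obtain ⟨p, rfl⟩ : ∃ p, s = 2 * p + 5 := by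
    obtain ⟨k, rfl⟩ := hodd
    exact ⟨k - 2, by omega⟩
  obtain ⟨q, rfl⟩ : ∃ q, t = 2 * p + 5 + 2 * q := by
    obtain ⟨k, rfl⟩ := hodd'
    exact ⟨k - p - 2, by omega⟩
  exact upper_of_card_cycs_le (by omega) (by omega) (card_cycs_odd_odd_le p q)

theorem upper_trivial {s t : ℕ} (hs : 2 ≤ s) (ht : 2 ≤ t) : ∃ C : ℕ, ∀ n,
    rainbowEx n (SimpleGraph.cycleGraph s) (SimpleGraph.cycleGraph t) ≤ C * n ^ s := by
  have : NeZero s := ⟨by omega⟩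
  refine upper_of_card_cycs_le hs ht ⟨1, fun {V K} _ {G col} _ _ => ?_⟩
  classical
  refine (Finset.card_le_univ _).trans ?_
  rw [Fintype.card_fun, ZMod.card, one_mul]

/-- The case `s = 4` stands apart: graphs without 4-cycles are useless there, and the colouring has
to do the work. -/
theorem lower_four {s : ℕ} (hs : 4 ≤ s) : ∃ C : ℕ, ∀ᶠ n : ℕ in atTop, n ^ s ≤
    C * rainbowEx n (SimpleGraph.cycleGraph s) (SimpleGraph.cycleGraph 4) ^ 2 := by
  rcases Nat.even_or_odd s with ⟨k, hk⟩ | h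
  · rcases Nat.lt_or_ge k 3 with h | h
    · obtain rfl : s = 4 := by omega
      exact lower_four_four
    · obtain rfl : s = 2 * k := by omega
      exact lower_even_four h
  · exact lower_odd_four (by omega) h

theorem isTheta_four {s : ℕ} (hs : 4 ≤ s) : (fun n : ℕ =>
    (rainbowEx n (SimpleGraph.cycleGraph s) (SimpleGraph.cycleGraph 4) : ℝ)) =Θ[atTop]
      fun n : ℕ => (n : ℝ) ^ ((s : ℝ) / 2) :=
  isTheta_of_sq_le (upper_four hs) (lower_four hs)

theorem cast_half_of_even {s : ℕ} (h : Even s) : (s : ℝ) / 2 = (s / 2 : ℕ) := by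
  rw [Nat.cast_div h.two_dvd two_ne_zero, Nat.cast_ofNat]

end RainbowTuran

theorem theorem1p2 (s t : ℕ) (hs : 4 ≤ s) (ht : 3 ≤ t) :
    (t = 4 → (fun n : ℕ => (RainbowTuran.rainbowEx n (SimpleGraph.cycleGraph s)
      (SimpleGraph.cycleGraph t) : ℝ)) =Θ[atTop] fun n : ℕ => (n : ℝ) ^ ((s : ℝ) / 2)) ∧
    (Even s → Even t → s ≠ t → (fun n : ℕ => (RainbowTuran.rainbowEx n (SimpleGraph.cycleGraph s)
      (SimpleGraph.cycleGraph t) : ℝ)) =Θ[atTop] fun n : ℕ => (n : ℝ) ^ ((s : ℝ) / 2)) ∧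
    (s = t → 6 ≤ t → Even t → (fun n : ℕ => (RainbowTuran.rainbowEx n (SimpleGraph.cycleGraph s)
      (SimpleGraph.cycleGraph t) : ℝ)) =Θ[atTop] fun n : ℕ => (n : ℝ) ^ ((s : ℝ) / 2 - 1)) ∧
    (6 ≤ t → Even t → Odd s → (fun n : ℕ => (RainbowTuran.rainbowEx n (SimpleGraph.cycleGraph s)
      (SimpleGraph.cycleGraph t) : ℝ)) =Θ[atTop] fun n : ℕ => (n : ℝ) ^ (((s : ℝ) - 1) / 2)) ∧
    (Odd s → Odd t → s ≤ t → (fun n : ℕ => (RainbowTuran.rainbowEx n (SimpleGraph.cycleGraph s)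
      (SimpleGraph.cycleGraph t) : ℝ)) =Θ[atTop] fun n : ℕ => (n : ℝ) ^ ((s : ℝ) - 2)) ∧
    (Odd t → (t < s ∨ Even s) → (fun n : ℕ => (RainbowTuran.rainbowEx n (SimpleGraph.cycleGraph s)
      (SimpleGraph.cycleGraph t) : ℝ)) =Θ[atTop] fun n : ℕ => (n : ℝ) ^ (s : ℝ)) := by
  refine ⟨?_, fun hse hte hst => ?_, ?_, fun ht6 hte hso => ?_, fun hso hto hst => ?_,
    fun hto h => ?_⟩
  · rintro rfl
    exact RainbowTuran.isTheta_four hs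
  · by_cases h4 : t = 4
    · subst h4
      exact RainbowTuran.isTheta_four hs
    · have ht6 : 6 ≤ t := by
        obtain ⟨k, rfl⟩ := hte
        omega
      exact RainbowTuran.isTheta_of_le (RainbowTuran.cast_half_of_even hse) (RainbowTuran.upper_even hs ht6 hte)
        (RainbowTuran.lower_even (by omega) (by omega) hst)
  · rintro rfl hs6 hse
    refine RainbowTuran.isTheta_of_le ?_ (RainbowTuran.upper_self hs6 hse) (RainbowTuran.lower_self hs6 hse)
    rw [Nat.cast_sub (by omega), RainbowTuran.cast_half_of_even hse, Nat.cast_one]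
  · refine RainbowTuran.isTheta_of_le ?_ (RainbowTuran.upper_even hs ht6 hte)
      (RainbowTuran.lower_even (by omega) (by omega) fun h => Nat.not_even_iff_odd.2 hso (h ▸ hte))
    obtain ⟨k, rfl⟩ := hso
    rw [show (2 * k + 1) / 2 = k by omega]
    push_cast
    ring
  · refine RainbowTuran.isTheta_of_le ?_ (RainbowTuran.upper_odd_odd hs hso hto hst) (RainbowTuran.lower_odd_odd hs ht hto)
    rw [Nat.cast_sub (by omega), Nat.cast_ofNat]
  · exact RainbowTuran.isTheta_of_le rfl (RainbowTuran.upper_trivial (by omega) (by omega)) (RainbowTuran.lower_odd_even (by omega) ht hto h)
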